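/- Let $\gamma>-1$ and let $\mathbb{D}=\{z\in\mathbb{C}: |z|\le 1\}$ be the Euclidean unit disk, with $d(z)=1-|z|^2$. Write $L^2_\gamma(\mathbb{D})=L^2(\mathbb{D},d^\gamma\,dx\,dy)$ (complex-valued). On $\partial_+S\mathbb{D}=(\mathbb{R}/2\pi\mathbb{Z})_\beta\times[-\tfrac{\pi}{2},\tfrac{\pi}{2}]_\alpha$ put $\mu=\cos\alpha$ and $L^2_\gamma(\partial_+S\mathbb{D})=L^2(\partial_+S\mathbb{D},\mu^{-2\gamma}\,d\beta\,d\alpha)$. For $m\ge 1$ let $L^2_\gamma(\mathbb{D},S_{tt}^m(T^*\mathbb{D}))$ be the space of symmetric $m$-tensor fields $f\,dz^m+g\,d\bar z^m$, where $f,g\in L^2_\gamma(\mathbb{D})$, $f$ is analytic and $g$ is antianalytic in the open disk, with the $L^2_\gamma$ topology. For an $L^2_\gamma$ symmetric $m$-tensor field $F$ define $$I_md^\gamma F(\beta,\alpha)=\int_0^{2\cos\alpha}F_{z(t)}(\dot z(t),\dots,\dot z(t))\,d(z(t))^\gamma\,dt,\qquad z(t)=e^{i\beta}+te^{i(\beta+\alpha+\pi)}.$$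 For $n\ge 0$ let $\hat L_n^\gamma$ be the orthogonal polynomial of degree $n$ for the weight $(1-x^2)^{\gamma+1/2}$ on $[-1,1]$, with positive leading coefficient and norm $\sqrt{2\pi}$ (a positive multiple of the Gegenbauer polynomial $C_n^{\gamma+1}$). For $k\in\mathbb{Z}$ set $$\psi_{n,k}^{\gamma,+}=\frac{1}{2\pi}\,\mu^{2\gamma+1}e^{i(n-2k)(\beta+\alpha+\pi)}\hat L_n^\gamma(\sin\alpha),\qquad \psi_{n,k}^{\gamma,-}=e^{i(\beta+\alpha+\pi)}\psi_{n,k}^{\gamma,+}.$$ For an orthonormal family $(f_n)_{n\ge0}$ in a Hilbert space and $s\ge 0$ let $$h^s(f_n,\,n\ge0)=\Big\{\sum_{n\ge0}a_nf_n:\ \sum_{n\ge0}(n+1)^{2s}|a_n|^2<\infty\Big\},$$ normed by $\big(\sum_n(n+1)^{2s}|a_n|^2\big)^{1/2}$. Then for every $F$ in the spaces $L^2_\gamma(\mathbb{D},S_{tt}^m(T^*\mathbb{D}))$ below, the integral defining $I_md^\gamma F(\beta,\alpha)$ converges absolutely for almost every $(\beta,\alpha)$, and the following operators are linear homeomorphisms: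 $$I_{2p}d^\gamma\colon L^2_\gamma(\mathbb{D},S_{tt}^{2p}(T^*\mathbb{D}))\to h^{(1+\gamma)/2}(\psi_{n,-p}^{\gamma,+},\,n\ge0)\oplus h^{(1+\gamma)/2}(\psi_{n,n+p}^{\gamma,+},\,n\ge0),\qquad p\ge1,$$ $$I_{2p+1}d^\gamma\colon L^2_\gamma(\mathbb{D},S_{tt}^{2p+1}(T^*\mathbb{D}))\to h^{(1+\gamma)/2}(\psi_{n,-p}^{\gamma,-},\,n\ge0)\oplus h^{(1+\gamma)/2}(\psi_{n,n+p+1}^{\gamma,-},\,n\ge0),\qquad p\ge0.$$ In each line the two families on the right together form an orthonormal system in $L^2_\gamma(\partial_+S\mathbb{D})$, so that the sum is an orthogonal direct sum of subspaces. -/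

import Mathlib

open MeasureTheory

noncomputable section

namespace TTXray

/-! ### Weighted `L²` spaces -/

/-- The boundary defining function `d(z) = 1 - |z|²` of the unit disk. -/
def bdf (z : ℂ) : ℝ := 1 - ‖z‖ ^ 2

/-- The measure `d^γ |dz|²` on the closed unit disk, `|dz|² = dx dy`. -/
def diskMeasure (γ : ℝ) : Measure ℂ :=
  (volume.restrict (Metric.closedBall (0 : ℂ) 1)).withDensity
    (fun z => ENNReal.ofReal (bdf z ^ γ))

/-- The inward boundary in fan-beam coordinates `(β, α)`. The circle `ℝ/2πℤ` is
represented by its fundamental domain `[0, 2π)`. -/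
def inward : Set (ℝ × ℝ) :=
  Set.Ico 0 (2 * Real.pi) ×ˢ Set.Icc (-(Real.pi / 2)) (Real.pi / 2)

/-- The measure `μ^{-2γ} dβ dα` on the inward boundary, where `μ = cos α`. -/
def inwardMeasure (γ : ℝ) : Measure (ℝ × ℝ) :=
  (volume.restrict inward).withDensity
    (fun q => ENNReal.ofReal (Real.cos q.2 ^ (-2 * γ)))

/-- `L²_γ` of the inward boundary, complex valued. -/
abbrev L2Inward (γ : ℝ) : Type := Lp ℂ 2 (inwardMeasure γ)

/-! ### Symmetric tensor fields -/

/-- Symmetric covariant complex valued `m`-tensors on a tangent space of the disk; each tangent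
space is identified with `ℂ = ℝ²` as a real vector space. -/
def symTensors (m : ℕ) :
    Submodule ℂ (ContinuousMultilinearMap ℝ (fun _ : Fin m => ℂ) ℂ) where
  carrier := {T | ∀ (σ : Equiv.Perm (Fin m)) (v : Fin m → ℂ), T (fun i => v (σ i)) = T v}
  add_mem' := by
    intro S T hS hT σ v
    simp only [add_apply, hS σ v, hT σ v]
  zero_mem' := by
    intro σ v
    simp
  smul_mem' := by
    intro c T hT σ v
    simp only [smul_apply, hT σ v]

/-- The space of symmetric `m`-tensors as a normed space, with the operator norm. -/
def SymTensor (m : ℕ) : Type := symTensors m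

instance (m : ℕ) : NormedAddCommGroup (SymTensor m) :=
  inferInstanceAs (NormedAddCommGroup (symTensors m))

instance (m : ℕ) : NormedSpace ℂ (SymTensor m) :=
  inferInstanceAs (NormedSpace ℂ (symTensors m))

/-- The tensor `dz^m = dz ⊗ ⋯ ⊗ dz`, that is `(v₁, …, vₘ) ↦ v₁ ⋯ vₘ`. -/
def dzPow (m : ℕ) : SymTensor m :=
  ⟨ContinuousMultilinearMap.mkPiAlgebra ℝ (Fin m) ℂ, by
    intro σ v
    simp only [ContinuousMultilinearMap.mkPiAlgebra_apply]
    exact Equiv.prod_comp σ v⟩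

/-- The tensor `dz̄^m`, that is `(v₁, …, vₘ) ↦ v̄₁ ⋯ v̄ₘ`. -/
def dzbarPow (m : ℕ) : SymTensor m :=
  ⟨(ContinuousMultilinearMap.mkPiAlgebra ℝ (Fin m) ℂ).compContinuousLinearMap
      (fun _ => (Complex.conjCLE : ℂ →L[ℝ] ℂ)), by
    intro σ v
    simp only [ContinuousMultilinearMap.compContinuousLinearMap_apply,
      ContinuousMultilinearMap.mkPiAlgebra_apply]
    exact Equiv.prod_comp σ (fun i => (Complex.conjCLE : ℂ →L[ℝ] ℂ) (v i))⟩

/-- `L²_γ(𝔻; S^m(T^*𝔻))`. The fibre is finite dimensional, so square integrability and the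
`L²_γ` topology are those of the components. -/
abbrev L2Tensor (γ : ℝ) (m : ℕ) : Type := Lp (SymTensor m) 2 (diskMeasure γ)

/-- The `L²_γ` functions that are analytic in the open disk. -/
def IsL2Analytic (γ : ℝ) (f : ℂ → ℂ) : Prop :=
  MemLp f 2 (diskMeasure γ) ∧ DifferentiableOn ℂ f (Metric.ball 0 1)

/-- The `L²_γ` functions that are antianalytic in the open disk. -/
def IsL2Antianalytic (γ : ℝ) (g : ℂ → ℂ) : Prop :=
  MemLp g 2 (diskMeasure γ) ∧
    DifferentiableOn ℂ (fun z => (starRingEnd ℂ) (g z)) (Metric.ball 0 1)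

/-- The space of `L²_γ` transverse-tracefree `m`-tensors `f dz^m + g dz̄^m`, with `f` analytic and
`g` antianalytic, as a subspace of `L²_γ(𝔻; S^m(T^*𝔻))` (with the subspace topology). -/
def ttTensors (γ : ℝ) (m : ℕ) : Submodule ℂ (L2Tensor γ m) where
  carrier := {F | ∃ f g : ℂ → ℂ, IsL2Analytic γ f ∧ IsL2Antianalytic γ g ∧
    F =ᵐ[diskMeasure γ] fun z => f z • dzPow m + g z • dzbarPow m}
  add_mem' := by
    rintro F G ⟨f, g, hf, hg, hF⟩ ⟨f', g', hf', hg', hG⟩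
    refine ⟨f + f', g + g', ⟨hf.1.add hf'.1, hf.2.add hf'.2⟩, ⟨hg.1.add hg'.1, ?_⟩, ?_⟩
    · refine (hg.2.add hg'.2).congr fun z _ => ?_
      simp
    · filter_upwards [Lp.coeFn_add F G, hF, hG] with z h1 h2 h3
      rw [h1, Pi.add_apply, h2, h3, Pi.add_apply, Pi.add_apply, add_smul, add_smul]
      abel
  zero_mem' := by
    refine ⟨0, 0, ⟨MemLp.zero, differentiableOn_const 0⟩, ⟨MemLp.zero, by simp⟩, ?_⟩
    filter_upwards [Lp.coeFn_zero (SymTensor m) 2 (diskMeasure γ)] with z h1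
    rw [h1]
    simp
  smul_mem' := by
    rintro c F ⟨f, g, hf, hg, hF⟩
    refine ⟨c • f, c • g, ⟨hf.1.const_smul c, hf.2.const_smul c⟩,
      ⟨hg.1.const_smul c, ?_⟩, ?_⟩
    · refine (hg.2.const_mul ((starRingEnd ℂ) c)).congr fun z _ => ?_
      simp
    · filter_upwards [Lp.coeFn_smul c F, hF] with z h1 h2
      rw [h1, Pi.smul_apply, h2, smul_add, smul_smul, smul_smul]
      rfl

/-! ### The weighted X-ray transform -/

/-- The direction angle `θ = β + α + π` of the geodesic with fan-beam coordinates `(β, α)`. -/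
def geoAngle (q : ℝ × ℝ) : ℝ := q.1 + q.2 + Real.pi

/-- The unit vector `e^{iθ}`, `θ = β + α + π`. -/
def geoDir (q : ℝ × ℝ) : ℂ := Complex.exp ((geoAngle q : ℂ) * Complex.I)

/-- The geodesic `t ↦ e^{iβ} + t e^{i(β+α+π)}`. -/
def geoPoint (q : ℝ × ℝ) (t : ℝ) : ℂ :=
  Complex.exp ((q.1 : ℂ) * Complex.I) + (t : ℂ) * geoDir q

/-- The function `ℓ_m F (z, v) = F_z(v, …, v)`. -/
def ell {m : ℕ} (F : ℂ → SymTensor m) (z v : ℂ) : ℂ := (F z).val (fun _ => v)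

/-- The integrand `t ↦ ℓ_m F(z(t), ż(t)) d^γ(z(t))`. -/
def xrayIntegrand (γ : ℝ) {m : ℕ} (F : ℂ → SymTensor m) (q : ℝ × ℝ) (t : ℝ) : ℂ :=
  ell F (geoPoint q t) (geoDir q) * ((bdf (geoPoint q t) ^ γ : ℝ) : ℂ)

/-- `u = I_m d^γ F`: on almost every geodesic the integral defining `I_m d^γ F` converges
absolutely and equals `u`. -/
def IsXrayTransform (γ : ℝ) {m : ℕ} (F : L2Tensor γ m) (u : L2Inward γ) : Prop :=
  ∀ᵐ q ∂(inwardMeasure γ),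
    IntervalIntegrable (xrayIntegrand γ F q) volume 0 (2 * Real.cos q.2) ∧
      u q = ∫ t in (0 : ℝ)..(2 * Real.cos q.2), xrayIntegrand γ F q t

/-! ### Fan-beam polynomials -/

/-- The Gegenbauer polynomial `C_n^l(x)`, the coefficient of `w^n` in `(1 - 2 w x + w²)^{-l}`:
`∑_{j ≤ n/2} (-1)^j (l)_{n-j} / (j! (n-2j)!) (2x)^{n-2j}` with the rising factorial `(l)_k`. -/
def gegenbauer (l : ℝ) (n : ℕ) (x : ℝ) : ℝ :=
  ∑ j ∈ Finset.range (n / 2 + 1),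
    (-1) ^ j * (ascPochhammer ℝ (n - j)).eval l /
      ((Nat.factorial j : ℝ) * (Nat.factorial (n - 2 * j) : ℝ)) * (2 * x) ^ (n - 2 * j)

/-- The square of the norm of `C_n^{γ+1}` in `L²([-1,1], (1-x²)^{γ+1/2} dx)`. -/
def gegenbauerNormSq (γ : ℝ) (n : ℕ) : ℝ :=
  ∫ x in (-1 : ℝ)..1, gegenbauer (γ + 1) n x ^ 2 * (1 - x ^ 2) ^ (γ + 1 / 2)

/-- The orthogonal polynomial of degree `n` for the weight `(1-x²)^{γ+1/2}` on `[-1,1]`, with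
positive leading coefficient and norm `√(2π)`. -/
def Lhat (γ : ℝ) (n : ℕ) (x : ℝ) : ℝ :=
  Real.sqrt (2 * Real.pi) / Real.sqrt (gegenbauerNormSq γ n) * gegenbauer (γ + 1) n x

/-- `ψ_{n,k}^γ = μ^{2γ+1} e^{i(n-2k)(β+α+π)} L̂_n^γ(sin α) / 2π` as a function of `(β, α)`. -/
def psiFun (γ : ℝ) (n : ℕ) (k : ℤ) (q : ℝ × ℝ) : ℂ :=
  ((Real.cos q.2 ^ (2 * γ + 1) : ℝ) : ℂ) * geoDir q ^ ((n : ℤ) - 2 * k) *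
    (Lhat γ n (Real.sin q.2) : ℂ) / (2 * (Real.pi : ℂ))

theorem norm_geoDir (q : ℝ × ℝ) : ‖geoDir q‖ = 1 := Complex.norm_exp_ofReal_mul_I _

theorem continuous_geoDir : Continuous geoDir := by
  unfold geoDir geoAngle
  fun_prop

theorem continuous_Lhat (γ : ℝ) (n : ℕ) : Continuous (Lhat γ n) := by
  unfold Lhat gegenbauer
  fun_prop

theorem measurable_psiFun (γ : ℝ) (n : ℕ) (k : ℤ) : Measurable (psiFun γ n k) := by
  have h1 : Measurable fun q : ℝ × ℝ => geoDir q ^ ((n : ℤ) - 2 * k) := by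
    refine Continuous.measurable (continuous_geoDir.zpow₀ _ fun q => Or.inl ?_)
    rw [← norm_ne_zero_iff, norm_geoDir]
    exact one_ne_zero
  have h2 : Measurable fun q : ℝ × ℝ => Lhat γ n (Real.sin q.2) :=
    ((continuous_Lhat γ n).comp (Real.continuous_sin.comp continuous_snd)).measurable
  have h3 : Measurable fun q : ℝ × ℝ => Real.cos q.2 ^ (2 * γ + 1) :=
    (Real.continuous_cos.comp continuous_snd).measurable.pow_const _
  unfold psiFun
  fun_prop

theorem rpow_bound {γ c : ℝ} (hγ : -1 < γ) (h0 : 0 ≤ c) (h1 : c ≤ 1) :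
    (c ^ (2 * γ + 1)) ^ 2 * c ^ (-2 * γ) ≤ 1 := by
  rcases h0.eq_or_lt with rfl | hc
  · have ha := Real.zero_rpow_le_one (2 * γ + 1)
    have hb := Real.zero_rpow_le_one (-2 * γ)
    have ha' := Real.rpow_nonneg (le_refl (0 : ℝ)) (2 * γ + 1)
    have hb' := Real.rpow_nonneg (le_refl (0 : ℝ)) (-2 * γ)
    exact mul_le_one₀ (pow_le_one₀ ha' ha) hb' hb
  · rw [← Real.rpow_natCast, ← Real.rpow_mul h0, ← Real.rpow_add hc]
    refine Real.rpow_le_one h0 h1 ?_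
    push_cast
    linarith

theorem memLp_psiFun {γ : ℝ} (hγ : -1 < γ) (n : ℕ) (k : ℤ) :
    MemLp (psiFun γ n k) 2 (inwardMeasure γ) := by
  have hm := measurable_psiFun γ n k
  rw [memLp_two_iff_integrable_sq_norm hm.aestronglyMeasurable, inwardMeasure,
    integrable_withDensity_iff (by
      refine ENNReal.measurable_ofReal.comp ?_
      exact (Real.continuous_cos.comp continuous_snd).measurable.pow_const _)
      (Filter.Eventually.of_forall fun _ => ENNReal.ofReal_lt_top)]
  obtain ⟨C, hC⟩ := (isCompact_Icc (a := (-1 : ℝ)) (b := 1)).exists_bound_of_continuousOn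
    (continuous_Lhat γ n).continuousOn
  have hfin : volume inward < ⊤ := by
    unfold inward
    rw [Measure.volume_eq_prod, Measure.prod_prod, Real.volume_Ico, Real.volume_Icc]
    exact ENNReal.mul_lt_top ENNReal.ofReal_lt_top ENNReal.ofReal_lt_top
  have hmeas : MeasurableSet inward := measurableSet_Ico.prod measurableSet_Icc
  refine IntegrableOn.of_bound hfin ?_ ((C / (2 * Real.pi)) ^ 2) ?_
  · have h3 : Measurable fun q : ℝ × ℝ => Real.cos q.2 ^ (-2 * γ) :=
      (Real.continuous_cos.comp continuous_snd).measurable.pow_const _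
    exact ((hm.norm.pow_const 2).mul h3.ennreal_ofReal.ennreal_toReal).aestronglyMeasurable
  · rw [ae_restrict_iff' hmeas]
    refine Filter.Eventually.of_forall fun q hq => ?_
    have hc0 : 0 ≤ Real.cos q.2 := Real.cos_nonneg_of_mem_Icc ⟨hq.2.1, hq.2.2⟩
    have hb := rpow_bound hγ hc0 (Real.cos_le_one q.2)
    have hL := hC (Real.sin q.2) ⟨Real.neg_one_le_sin _, Real.sin_le_one _⟩
    have hr : 0 ≤ Real.cos q.2 ^ (-2 * γ) := Real.rpow_nonneg hc0 _
    have hn : ‖psiFun γ n k q‖ =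
        Real.cos q.2 ^ (2 * γ + 1) * (‖Lhat γ n (Real.sin q.2)‖ / (2 * Real.pi)) := by
      unfold psiFun
      rw [norm_div, norm_mul, norm_mul, norm_zpow, norm_geoDir, one_zpow, Complex.norm_real,
        Complex.norm_real, Real.norm_of_nonneg (Real.rpow_nonneg hc0 _), norm_mul,
        Complex.norm_real, Real.norm_of_nonneg Real.pi_pos.le]
      simp only [Complex.norm_ofNat]
      ring
    rw [ENNReal.toReal_ofReal hr, hn, Real.norm_of_nonneg (by positivity), mul_pow]
    have hpi : 0 < 2 * Real.pi := by positivity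
    have hq2 : (‖Lhat γ n (Real.sin q.2)‖ / (2 * Real.pi)) ^ 2 ≤ (C / (2 * Real.pi)) ^ 2 := by
      gcongr
    calc _ = ((Real.cos q.2 ^ (2 * γ + 1)) ^ 2 * Real.cos q.2 ^ (-2 * γ)) *
          (‖Lhat γ n (Real.sin q.2)‖ / (2 * Real.pi)) ^ 2 := by ring
      _ ≤ 1 * (C / (2 * Real.pi)) ^ 2 := by gcongr
      _ = _ := one_mul _

theorem memLp_geoDir_mul_psiFun {γ : ℝ} (hγ : -1 < γ) (n : ℕ) (k : ℤ) :
    MemLp (fun q => geoDir q * psiFun γ n k q) 2 (inwardMeasure γ) := by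
  refine (memLp_psiFun hγ n k).of_le ?_ (Filter.Eventually.of_forall fun q => ?_)
  · exact (continuous_geoDir.measurable.mul (measurable_psiFun γ n k)).aestronglyMeasurable
  · rw [norm_mul, norm_geoDir, one_mul]

/-- `ψ_{n,k}^{γ,+} = ψ_{n,k}^γ` in `L²_γ` of the inward boundary. -/
def psiPlus {γ : ℝ} (hγ : -1 < γ) (n : ℕ) (k : ℤ) : L2Inward γ :=
  (memLp_psiFun hγ n k).toLp

/-- `ψ_{n,k}^{γ,-} = e^{i(β+α+π)} ψ_{n,k}^γ` in `L²_γ` of the inward boundary. -/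
def psiMinus {γ : ℝ} (hγ : -1 < γ) (n : ℕ) (k : ℤ) : L2Inward γ :=
  (memLp_geoDir_mul_psiFun hγ n k).toLp

/-! ### Hilbert scales -/

section HilbertScale

variable {H : Type*} [NormedAddCommGroup H] [InnerProductSpace ℂ H]

/-- The subspace `{∑ aₙ fₙ | ∑ (n+1)^{2s} |aₙ|² < ∞}` of `H` (for orthonormal `f`). -/
def hilbertScale (s : ℝ) (f : ℕ → H) : Submodule ℂ H where
  carrier := {u | ∃ a : ℕ → ℂ, Summable (fun n : ℕ => ((n : ℝ) + 1) ^ (2 * s) * ‖a n‖ ^ 2) ∧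
    HasSum (fun n => a n • f n) u}
  add_mem' := by
    rintro u v ⟨a, ha, hu⟩ ⟨b, hb, hv⟩
    refine ⟨a + b, ?_, by simpa [add_smul] using hu.add hv⟩
    refine Summable.of_nonneg_of_le (fun n => by positivity) (fun n => ?_)
      ((ha.add hb).mul_left 2)
    have h1 : ‖(a + b) n‖ ^ 2 ≤ 2 * (‖a n‖ ^ 2 + ‖b n‖ ^ 2) := by
      have h2 : ‖a n + b n‖ ≤ ‖a n‖ + ‖b n‖ := norm_add_le _ _
      have h3 : ‖a n + b n‖ ^ 2 ≤ (‖a n‖ + ‖b n‖) ^ 2 := by gcongr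
      rw [Pi.add_apply]
      nlinarith [sq_nonneg (‖a n‖ - ‖b n‖)]
    calc _ ≤ ((n : ℝ) + 1) ^ (2 * s) * (2 * (‖a n‖ ^ 2 + ‖b n‖ ^ 2)) := by gcongr
      _ = _ := by ring
  zero_mem' := ⟨0, by simp, by simp⟩
  smul_mem' := by
    rintro c u ⟨a, ha, hu⟩
    refine ⟨c • a, ?_, by simpa [smul_smul] using hu.const_smul c⟩
    refine (ha.mul_left (‖c‖ ^ 2)).congr fun n => ?_
    rw [Pi.smul_apply, norm_smul]
    ring

/-- The Hilbert scale `h^s(fₙ, n ≥ 0)` of an orthonormal family `f`: the subspace above, but with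
the topology of its own norm `(∑ (n+1)^{2s} |aₙ|²)^{1/2}` instead of the topology of `H`. -/
def HScale (s : ℝ) (f : ℕ → H) : Type _ := hilbertScale s f

variable {s : ℝ} {f : ℕ → H}

instance : AddCommGroup (HScale s f) := inferInstanceAs (AddCommGroup (hilbertScale s f))

instance : Module ℂ (HScale s f) := inferInstanceAs (Module ℂ (hilbertScale s f))

/-- The inclusion of `h^s(fₙ)` into `H`. -/
def HScale.incl : HScale s f →ₗ[ℂ] H := (hilbertScale s f).subtype

/-- The norm `(∑ (n+1)^{2s} |aₙ|²)^{1/2}` of `∑ aₙ fₙ`, where `aₙ = ⟪fₙ, u⟫` as `f` is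
orthonormal: the `ℓ²` norm of the sequence `(n+1)^s aₙ`. -/
def HScale.enorm (u : HScale s f) : ENNReal :=
  eLpNorm (fun n : ℕ => ((((n : ℝ) + 1) ^ s : ℝ) : ℂ) * inner ℂ (f n) u.incl) 2 Measure.count

instance : PseudoEMetricSpace (HScale s f) where
  edist u v := HScale.enorm (u - v)
  edist_self u := by
    simp [HScale.enorm]
  edist_comm u v := by
    unfold HScale.enorm
    rw [← eLpNorm_neg]
    congr 1
    funext n
    rw [Pi.neg_apply, ← neg_sub v u, map_neg, inner_neg_right]
    ring
  edist_triangle u v w := by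
    unfold HScale.enorm
    refine le_trans (le_of_eq ?_) (eLpNorm_add_le
      (measurable_from_nat.aestronglyMeasurable) (measurable_from_nat.aestronglyMeasurable)
      one_le_two)
    congr 1
    funext n
    rw [Pi.add_apply, ← sub_add_sub_cancel u v w, map_add, inner_add_right]
    ring

end HilbertScale

end TTXray

end

open MeasureTheory

noncomputable section

namespace TTXray

/-! On the chord with direction angle θ = β + α + π one has z(t) = e^{iθ}(s + i sin α) with s = t −
μ running over [−μ, μ], and d = μ² − s² there (`geoPoint_eq`, `bdf_geoPoint`). Hence z^n dz^m is
sent to e^{i(n+m)θ} ∫ (s + i sin α)^n (μ² − s²)^γ ds. Integration by parts shows that these moments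
satisfy, up to explicit constants, the three-term recurrence of C_n^{γ+1}, so the integral is i^n
κ_n μ^{2γ+1} C_n^{γ+1}(sin α) (`lineMoment_eq_gegenbauer`). Thus the normalized monomials,
orthonormal in the weighted Bergman space, go to multiples τ_n of fan-beam functions of angular
frequency n + m, and their conjugates times dz̄^m go to frequency −(n + m). For m ≥ 1 these
frequencies are all distinct, so the images are orthogonal because of the β-integral alone.

What remains is the size of τ_n, where |τ_n|² = 2π κ_n² ‖C_n‖² / ‖z^n‖². Each factor obeys a
one-step recurrence; together they give |τ_{n+1}|²/|τ_n|² = (n+γ+1)/(n+2γ+2)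
(`singularValueSq_succ`), and Euler's limit for Γ makes |τ_n|² comparable to (n+1)^{-(1+γ)}
(`tendsto_mul_rpow_of_ratio`, `transformCoeff_bounds`). This is the source of the exponent (1+γ)/2.
The recurrence for ‖C_n‖² uses orthogonality of the C_n, which comes from the disk: ∫ z^n d^γ
vanishes by rotation, and sliced along horizontal lines it is a multiple of ∫ C_n (1−y²)^{γ+1/2} dy.

Domain and target are then both identified with ℓ² × ℓ²: the domain because the monomials are
complete (`exists_synthesis_eq_of_analytic`) and the two components of a tensor can be read off
continuously (`exists_equiv_ttTensors`), the target by diagonal weights (`HScale.exists_equiv_lp`).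
The composite is a homeomorphism by construction. That it is the X-ray transform is checked on
monomials and passes to infinite sums because the transform has closed graph
(`IsLineTransform.of_tendsto`), a consequence of Santaló's formula and Cauchy–Schwarz. -/

/-! ### The Gegenbauer recurrence -/

/-- The `j`-th term of the Gegenbauer sum, extended by zero beyond the degree. -/
def gegenbauerTerm (l : ℝ) (n : ℕ) (x : ℝ) (j : ℕ) : ℝ :=
  if 2 * j ≤ n then
    (-1) ^ j * (ascPochhammer ℝ (n - j)).eval l /
      ((Nat.factorial j : ℝ) * (Nat.factorial (n - 2 * j) : ℝ)) * (2 * x) ^ (n - 2 * j)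
  else 0

theorem gegenbauer_eq_sum_gegenbauerTerm (l : ℝ) (n : ℕ) (x : ℝ) {N : ℕ} (hN : n / 2 + 1 ≤ N) :
    gegenbauer l n x = ∑ j ∈ Finset.range N, gegenbauerTerm l n x j := by
  unfold gegenbauer
  rw [← Finset.sum_subset (Finset.range_mono hN)]
  · refine Finset.sum_congr rfl fun j hj => ?_
    rw [gegenbauerTerm, if_pos]
    have := Finset.mem_range.1 hj
    omega
  · intro j _ hj
    rw [gegenbauerTerm, if_neg]
    rw [Finset.mem_range] at hj
    omega

theorem gegenbauerTerm_zero_add_two (l : ℝ) (n : ℕ) (x : ℝ) :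
    ((n : ℝ) + 2) * gegenbauerTerm l (n + 2) x 0 =
      2 * (n + 1 + l) * x * gegenbauerTerm l (n + 1) x 0 := by
  simp only [gegenbauerTerm, Nat.mul_zero, Nat.zero_le, if_true, Nat.sub_zero]
  rw [ascPochhammer_succ_eval, Nat.factorial_succ (n + 1)]
  have := Nat.factorial_ne_zero (n + 1)
  push_cast
  field_simp
  ring

/-- The index shift aligns equal powers of `x`, so the three-term recurrence holds coefficient by
coefficient. -/
theorem gegenbauerTerm_succ_add_two (l : ℝ) (n : ℕ) (x : ℝ) (j : ℕ) :
    ((n : ℝ) + 2) * gegenbauerTerm l (n + 2) x (j + 1) =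
      2 * (n + 1 + l) * x * gegenbauerTerm l (n + 1) x (j + 1) -
        (n + 2 * l) * gegenbauerTerm l n x j := by
  by_cases h : 2 * j ≤ n
  · obtain ⟨k, rfl⟩ := Nat.exists_eq_add_of_le h
    have e1 : 2 * j + k + 2 - (j + 1) = (j + k) + 1 := by omega
    have e2 : 2 * j + k + 2 - 2 * (j + 1) = k := by omega
    have e3 : 2 * j + k - j = j + k := by omega
    have e4 : 2 * j + k - 2 * j = k := by omega
    have e5 : 2 * j + k + 1 - (j + 1) = j + k := by omega
    rw [gegenbauerTerm, gegenbauerTerm, gegenbauerTerm, if_pos (by omega), if_pos h, e1, e2, e3,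
      e4, e5, ascPochhammer_succ_eval, Nat.factorial_succ j]
    -- For `n = 2 * j` the term of degree `n + 1` with index `j + 1` lies beyond the sum and is
    -- zero.
    rcases k with _ | k
    · rw [if_neg (by omega)]
      have := Nat.factorial_ne_zero j
      push_cast
      field_simp
      ring
    · have e6 : 2 * j + (k + 1) + 1 - 2 * (j + 1) = k := by omega
      rw [if_pos (by omega), e6, Nat.factorial_succ k]
      have := Nat.factorial_ne_zero j
      have := Nat.factorial_ne_zero k
      push_cast
      field_simp
      ring
  · rw [gegenbauerTerm, gegenbauerTerm, gegenbauerTerm, if_neg (by omega), if_neg (by omega),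
      if_neg (by omega)]
    ring

theorem gegenbauer_zero (l x : ℝ) : gegenbauer l 0 x = 1 := by
  simp [gegenbauer]

theorem gegenbauer_one (l x : ℝ) : gegenbauer l 1 x = 2 * l * x := by
  simp [gegenbauer]
  ring

theorem gegenbauer_add_two (l : ℝ) (n : ℕ) (x : ℝ) :
    ((n : ℝ) + 2) * gegenbauer l (n + 2) x =
      2 * (n + 1 + l) * x * gegenbauer l (n + 1) x - (n + 2 * l) * gegenbauer l n x := by
  rw [gegenbauer_eq_sum_gegenbauerTerm l (n + 2) x (N := n + 3) (by omega),
    gegenbauer_eq_sum_gegenbauerTerm l (n + 1) x (N := n + 3) (by omega),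
    gegenbauer_eq_sum_gegenbauerTerm l n x (N := n + 2) (by omega),
    Finset.sum_range_succ', Finset.sum_range_succ' (gegenbauerTerm l (n + 1) x), mul_add, mul_add,
    gegenbauerTerm_zero_add_two, Finset.mul_sum, Finset.mul_sum, Finset.mul_sum]
  simp only [gegenbauerTerm_succ_add_two]
  rw [Finset.sum_sub_distrib]
  ring

theorem continuous_gegenbauer (l : ℝ) (n : ℕ) : Continuous (gegenbauer l n) := by
  unfold gegenbauer
  fun_prop

/-! ### The weight `(1 - x²)^γ` -/

/-- For negative γ both endpoints are singular. On [0, 1] the weight is (1−x)^γ times the continuous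
factor (1+x)^γ; the other half follows by reflection. -/
theorem intervalIntegrable_one_sub_sq_rpow {γ : ℝ} (hγ : -1 < γ) :
    IntervalIntegrable (fun x : ℝ => (1 - x ^ 2) ^ γ) volume (-1) 1 := by
  have h0 : IntervalIntegrable (fun x : ℝ => (1 - x) ^ γ) volume 0 1 := by
    have := (intervalIntegral.intervalIntegrable_rpow' (a := 0) (b := 1) hγ).comp_sub_left 1
    simpa using this.symm
  have h1 : IntervalIntegrable (fun x : ℝ => (1 - x ^ 2) ^ γ) volume 0 1 := by
    have h2 := h0.mul_continuousOn (g := fun x : ℝ => (1 + x) ^ γ) (by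
      rw [Set.uIcc_of_le zero_le_one]
      intro x hx
      exact ContinuousAt.continuousWithinAt <|
        (by fun_prop : ContinuousAt (fun x : ℝ => 1 + x) x).rpow_const
          (Or.inl (by linarith [hx.1])))
    refine h2.congr ?_
    intro x hx
    rw [Set.uIoc_of_le zero_le_one] at hx
    simp only
    rw [← Real.mul_rpow (by linarith [hx.2]) (by linarith [hx.1])]
    congr 1
    ring
  refine IntervalIntegrable.trans ?_ h1
  have h3 := h1.comp_sub_left 0
  simpa using h3.symm

/-! ### Moments of the weight along a chord -/

/-- `∫_{-1}^1 (iy + √(1-y²) x)^n (1-x²)^γ dx`. -/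
def lineMoment (γ : ℝ) (n : ℕ) (y : ℝ) : ℂ :=
  ∫ x in (-1 : ℝ)..1,
    (Complex.I * y + Real.sqrt (1 - y ^ 2) * x) ^ n * (((1 - x ^ 2) ^ γ : ℝ) : ℂ)

theorem intervalIntegrable_mul_weight {γ : ℝ} (hγ : -1 < γ) {f : ℝ → ℂ} (hf : Continuous f) :
    IntervalIntegrable (fun x : ℝ => f x * (((1 - x ^ 2) ^ γ : ℝ) : ℂ)) volume (-1) 1 := by
  have h := intervalIntegrable_one_sub_sq_rpow hγ
  have h' : IntervalIntegrable (fun x : ℝ => (((1 - x ^ 2) ^ γ : ℝ) : ℂ)) volume (-1) 1 :=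
    ⟨h.1.ofReal, h.2.ofReal⟩
  exact h'.continuousOn_mul hf.continuousOn

/-- Put w = iy + rx with r = √(1−y²), and integrate the derivative of r (1−x²)^{γ+1} w^n, which
vanishes at ±1 because γ + 1 > 0. The identities rx = w − iy and r²(1−x²) = 1 − w² + 2iyw turn the
derivative into powers of w times the weight. At n = 0 the truncated index `n - 1` is harmless, its
coefficient being zero. -/
theorem lineMoment_succ {γ : ℝ} (hγ : -1 < γ) (n : ℕ) {y : ℝ} (hy : y ^ 2 ≤ 1) :
    ((n : ℂ) + 2 * (γ + 1)) * lineMoment γ (n + 1) y =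
      2 * (n + (γ + 1)) * Complex.I * y * lineMoment γ n y + n * lineMoment γ (n - 1) y := by
  set r : ℝ := Real.sqrt (1 - y ^ 2) with hr
  have hr2 : (r : ℂ) ^ 2 = 1 - (y : ℂ) ^ 2 := by
    have : r ^ 2 = 1 - y ^ 2 := Real.sq_sqrt (by linarith)
    exact_mod_cast congrArg (fun a : ℝ => (a : ℂ)) this
  set w : ℝ → ℂ := fun x => Complex.I * y + r * x with hw
  have hwc : Continuous w := by fun_prop
  set D : ℝ → ℂ := fun x => (-((n : ℂ) + 2 * (γ + 1)) * w x ^ (n + 1) +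
    2 * (n + (γ + 1)) * Complex.I * y * w x ^ n + n * w x ^ (n - 1)) *
      (((1 - x ^ 2) ^ γ : ℝ) : ℂ) with hD
  have hDi : IntervalIntegrable D volume (-1) 1 :=
    intervalIntegrable_mul_weight hγ (by fun_prop)
  let P : ℝ → ℂ := fun x => (r : ℂ) * ((((1 - x ^ 2) ^ (γ + 1) : ℝ) : ℂ) * w x ^ n)
  have hF : ∫ x in (-1 : ℝ)..1, D x = P 1 - P (-1) := by
    refine intervalIntegral.integral_eq_sub_of_hasDerivAt_of_le (by norm_num) ?_ ?_ hDi
    · have : Continuous fun x : ℝ => (1 - x ^ 2) ^ (γ + 1) :=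
        (by fun_prop : Continuous fun x : ℝ => 1 - x ^ 2).rpow_const
          (fun x => Or.inr (by linarith))
      have := Complex.continuous_ofReal.comp this
      simp only [Function.comp_def] at this
      simp only [P]
      fun_prop
    · intro x hx
      have hx2 : 0 < 1 - x ^ 2 := by nlinarith [hx.1, hx.2]
      have d1 : HasDerivAt (fun x : ℝ => (1 - x ^ 2) ^ (γ + 1))
          (-(2 * x) * (γ + 1) * (1 - x ^ 2) ^ γ) x := by
        have h := (((hasDerivAt_id x).pow 2).const_sub 1).rpow_const (p := γ + 1)
          (Or.inl hx2.ne')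
        simpa using h
      have d2 : HasDerivAt w r x := by
        have h := ((hasDerivAt_id x).ofReal_comp.const_mul (r : ℂ)).const_add
          (Complex.I * (y : ℂ))
        rw [Complex.ofReal_one, mul_one] at h
        exact h
      have d3 := ((d1.ofReal_comp.mul (d2.pow n)).const_mul (r : ℂ))
      refine d3.congr_deriv ?_
      simp only [hD, Pi.pow_apply]
      have hsplit : (1 - x ^ 2) ^ (γ + 1) = (1 - x ^ 2) ^ γ * (1 - x ^ 2) := by
        rw [Real.rpow_add_one hx2.ne']
      rw [hsplit]
      push_cast
      have hrx : (r : ℂ) * x = w x - Complex.I * y := by simp [hw]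
      have hrx2 : (r : ℂ) ^ 2 * (1 - (x : ℂ) ^ 2) =
          1 - w x ^ 2 + 2 * Complex.I * y * w x := by
        have : (r : ℂ) ^ 2 * (1 - (x : ℂ) ^ 2) = r ^ 2 - (r * x) ^ 2 := by ring
        rw [this, hrx, hr2]
        linear_combination (-(y : ℂ) ^ 2) * Complex.I_sq
      rcases n with _ | n
      · simp
        linear_combination (-(2 * ((γ : ℂ) + 1) * (((1 - x ^ 2) ^ γ : ℝ) : ℂ))) * hrx
      · simp only [Nat.add_sub_cancel]
        push_cast
        set g : ℂ := (((1 - x ^ 2) ^ γ : ℝ) : ℂ)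
        linear_combination (-(2 * ((γ : ℂ) + 1) * g * w x ^ (n + 1))) * hrx +
          (((n : ℂ) + 1) * g * w x ^ n) * hrx2
  have hz : (0 : ℝ) ^ (γ + 1) = 0 := Real.zero_rpow (by linarith)
  have hI : ∀ k : ℕ, IntervalIntegrable
      (fun x : ℝ => w x ^ k * (((1 - x ^ 2) ^ γ : ℝ) : ℂ)) volume (-1) 1 :=
    fun k => intervalIntegrable_mul_weight hγ (by fun_prop)
  have hDs : ∫ x in (-1 : ℝ)..1, D x = -((n : ℂ) + 2 * (γ + 1)) * lineMoment γ (n + 1) y +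
      2 * (n + (γ + 1)) * Complex.I * y * lineMoment γ n y + n * lineMoment γ (n - 1) y := by
    unfold lineMoment
    rw [← intervalIntegral.integral_const_mul, ← intervalIntegral.integral_const_mul,
      ← intervalIntegral.integral_const_mul, ← intervalIntegral.integral_add,
      ← intervalIntegral.integral_add]
    · refine intervalIntegral.integral_congr fun x _ => ?_
      simp only [hD, hw]
      ring
    · exact ((hI _).const_mul _).add ((hI _).const_mul _)
    · exact (hI _).const_mul _
    · exact (hI _).const_mul _
    · exact (hI _).const_mul _
  rw [hDs] at hF
  norm_num [P, hz] at hF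
  linear_combination -hF

/-- The factor between `lineMoment` and the Gegenbauer polynomial. -/
def momentFactor (γ : ℝ) (n : ℕ) : ℝ :=
  (∫ x in (-1 : ℝ)..1, (1 - x ^ 2) ^ γ) * ∏ k ∈ Finset.range n, ((k : ℝ) + 1) / (k + 2 * (γ + 1))

theorem momentFactor_succ {γ : ℝ} (hγ : -1 < γ) (n : ℕ) :
    ((n : ℝ) + 2 * (γ + 1)) * momentFactor γ (n + 1) = (n + 1) * momentFactor γ n := by
  have : (0 : ℝ) < (n : ℝ) + 2 * (γ + 1) := by
    have := n.cast_nonneg (α := ℝ)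
    linarith
  rw [momentFactor, momentFactor, Finset.prod_range_succ]
  field_simp

theorem weightIntegral_pos {γ : ℝ} (hγ : -1 < γ) : 0 < ∫ x in (-1 : ℝ)..1, (1 - x ^ 2) ^ γ := by
  refine intervalIntegral.intervalIntegral_pos_of_pos_on (intervalIntegrable_one_sub_sq_rpow hγ)
    (fun x hx => Real.rpow_pos_of_pos ?_ _) (by norm_num)
  nlinarith [hx.1, hx.2]

theorem momentFactor_pos {γ : ℝ} (hγ : -1 < γ) (n : ℕ) : 0 < momentFactor γ n := by
  refine mul_pos (weightIntegral_pos hγ) (Finset.prod_pos fun k _ => ?_)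
  have := k.cast_nonneg (α := ℝ)
  exact div_pos (by linarith) (by linarith)

theorem lineMoment_zero (γ y : ℝ) :
    lineMoment γ 0 y = ((∫ x in (-1 : ℝ)..1, (1 - x ^ 2) ^ γ : ℝ) : ℂ) := by
  simp only [lineMoment, pow_zero, one_mul]
  exact intervalIntegral.integral_ofReal

/-- The factors i^n and `momentFactor γ n` convert the recurrence `lineMoment_succ` into
`gegenbauer_add_two`; the sign of the last term is i² = −1. The leading coefficient n + 2(γ+1) is
positive, so the recurrence determines the moments. -/
theorem lineMoment_eq_gegenbauer {γ : ℝ} (hγ : -1 < γ) {y : ℝ} (hy : y ^ 2 ≤ 1) (n : ℕ) :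
    lineMoment γ n y =
      Complex.I ^ n * ((momentFactor γ n * gegenbauer (γ + 1) n y : ℝ) : ℂ) := by
  have hne : ∀ n : ℕ, (n : ℂ) + 2 * ((γ : ℂ) + 1) ≠ 0 := fun n => by
    have h : (0 : ℝ) < (n : ℝ) + 2 * (γ + 1) := by
      have := n.cast_nonneg (α := ℝ)
      linarith
    exact_mod_cast h.ne'
  have hk : ∀ n : ℕ, ((n : ℂ) + 2 * (γ + 1)) * momentFactor γ (n + 1) =
      (n + 1) * momentFactor γ n := fun n => by
    exact_mod_cast congrArg (fun a : ℝ => (a : ℂ)) (momentFactor_succ hγ n)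
  induction n using Nat.twoStepInduction with
  | zero =>
    rw [lineMoment_zero, gegenbauer_zero]
    simp [momentFactor]
  | one =>
    refine mul_left_cancel₀ (hne 0) ?_
    have h0 := lineMoment_succ hγ 0 hy
    rw [h0, lineMoment_zero, gegenbauer_one]
    have hk0 := hk 0
    have hk1 : (momentFactor γ 0 : ℂ) = ((∫ x in (-1 : ℝ)..1, (1 - x ^ 2) ^ γ : ℝ) : ℂ) := by
      simp [momentFactor]
    rw [← hk1]
    push_cast at *
    linear_combination (-(2 * Complex.I * ((γ : ℂ) + 1) * y)) * hk0
  | more n ih0 ih1 =>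
    refine mul_left_cancel₀ (hne (n + 1)) ?_
    have h0 := lineMoment_succ hγ (n + 1) hy
    rw [Nat.add_sub_cancel, ih0, ih1] at h0
    rw [h0]
    have hk0 := hk n
    have hk1 := hk (n + 1)
    have hg : ((n : ℂ) + 2) * gegenbauer (γ + 1) (n + 2) y =
      2 * (n + 1 + (γ + 1)) * y * gegenbauer (γ + 1) (n + 1) y -
        (n + 2 * (γ + 1)) * gegenbauer (γ + 1) n y := by
      exact_mod_cast congrArg (fun a : ℝ => (a : ℂ)) (gegenbauer_add_two (γ + 1) n y)
    have hI := Complex.I_sq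
    push_cast at *
    rw [pow_add Complex.I n 2, hI, pow_succ]
    linear_combination (Complex.I ^ n * gegenbauer (γ + 1) (n + 2) y) * hk1 +
      (Complex.I ^ n * momentFactor γ (n + 1)) * hg -
      (Complex.I ^ n * gegenbauer (γ + 1) n y) * hk0 + (2 * ((n : ℂ) + 1 + (γ + 1)) * y *
        Complex.I ^ n * momentFactor γ (n + 1) * gegenbauer (γ + 1) (n + 1) y) * hI

/-- The moments of `(μ² - s²)^γ` over `[-μ, μ]`, by rescaling. -/
theorem integral_pow_mul_weight {γ : ℝ} {y μ : ℝ} (hμ : 0 < μ) (h : y ^ 2 + μ ^ 2 = 1) (n : ℕ) :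
    ∫ s in (-μ)..μ, ((s : ℂ) + Complex.I * y) ^ n * (((μ ^ 2 - s ^ 2) ^ γ : ℝ) : ℂ) =
      ((μ ^ (2 * γ + 1) : ℝ) : ℂ) * lineMoment γ n y := by
  have hs : Real.sqrt (1 - y ^ 2) = μ := by
    rw [show 1 - y ^ 2 = μ ^ 2 by linarith, Real.sqrt_sq hμ.le]
  have h1 := intervalIntegral.smul_integral_comp_mul_left (a := -1) (b := 1)
    (fun s : ℝ => ((s : ℂ) + Complex.I * y) ^ n * (((μ ^ 2 - s ^ 2) ^ γ : ℝ) : ℂ)) μ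
  rw [mul_neg, mul_one] at h1
  rw [← h1, lineMoment, ← intervalIntegral.integral_const_mul, ← intervalIntegral.integral_smul]
  refine intervalIntegral.integral_congr fun x hx => ?_
  rw [Set.uIcc_of_le (by norm_num)] at hx
  have hx2 : 0 ≤ 1 - x ^ 2 := by nlinarith [hx.1, hx.2]
  have h2 : (μ ^ 2 - (μ * x) ^ 2) ^ γ = μ ^ (2 * γ) * (1 - x ^ 2) ^ γ := by
    rw [show μ ^ 2 - (μ * x) ^ 2 = μ ^ 2 * (1 - x ^ 2) by ring,
      Real.mul_rpow (by positivity) hx2, ← Real.rpow_natCast, ← Real.rpow_mul hμ.le]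
    norm_num
  simp only [hs]
  rw [h2, Real.rpow_add_one hμ.ne', Complex.real_smul]
  push_cast
  ring

/-! ### The weighted measure on the disk -/

theorem measurable_bdf : Measurable bdf := by
  unfold bdf
  fun_prop

theorem measurable_bdf_rpow (γ : ℝ) : Measurable fun z => bdf z ^ γ :=
  measurable_bdf.pow_const _

theorem bdf_pos {z : ℂ} (hz : z ∈ Metric.ball (0 : ℂ) 1) : 0 < bdf z := by
  rw [mem_ball_zero_iff] at hz
  unfold bdf
  nlinarith [norm_nonneg z]

/-- The unit circle is Lebesgue null. Discarding it removes the points where d = 0, and the density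
is strictly positive on what is left. -/
theorem diskMeasure_eq_ball (γ : ℝ) :
    diskMeasure γ = (volume.restrict (Metric.ball (0 : ℂ) 1)).withDensity
      (fun z => ENNReal.ofReal (bdf z ^ γ)) := by
  rw [diskMeasure, Measure.restrict_congr_set (s := Metric.closedBall (0 : ℂ) 1)
    (t := Metric.ball (0 : ℂ) 1)]
  rw [← Metric.ball_union_sphere]
  exact union_ae_eq_left_of_ae_eq_empty (ae_eq_empty.2 (Measure.addHaar_sphere volume 0 1))

theorem ae_diskMeasure_iff {γ : ℝ} {P : ℂ → Prop} :
    (∀ᵐ z ∂diskMeasure γ, P z) ↔ ∀ᵐ z, z ∈ Metric.ball (0 : ℂ) 1 → P z := by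
  rw [diskMeasure_eq_ball, ae_withDensity_iff (measurable_bdf_rpow γ).ennreal_ofReal,
    ae_restrict_iff' Metric.isOpen_ball.measurableSet]
  refine Filter.eventually_congr (Filter.Eventually.of_forall fun z => ?_)
  refine forall_congr' fun hz => ?_
  have : ENNReal.ofReal (bdf z ^ γ) ≠ 0 :=
    (ENNReal.ofReal_pos.2 (Real.rpow_pos_of_pos (bdf_pos hz) _)).ne'
  simp [this]

theorem lintegral_diskMeasure (γ : ℝ) (f : ℂ → ENNReal) :
    ∫⁻ z, f z ∂diskMeasure γ =
      ∫⁻ z in Metric.ball (0 : ℂ) 1, ENNReal.ofReal (bdf z ^ γ) * f z := by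
  rw [diskMeasure_eq_ball, lintegral_withDensity_eq_lintegral_mul_non_measurable _
    (measurable_bdf_rpow γ).ennreal_ofReal
    (Filter.Eventually.of_forall fun _ => ENNReal.ofReal_lt_top)]
  rfl

theorem integral_diskMeasure (γ : ℝ) {E : Type*} [NormedAddCommGroup E] [NormedSpace ℝ E]
    (f : ℂ → E) :
    ∫ z, f z ∂diskMeasure γ = ∫ z in Metric.ball (0 : ℂ) 1, bdf z ^ γ • f z := by
  rw [diskMeasure_eq_ball, integral_withDensity_eq_integral_toReal_smul
    (measurable_bdf_rpow γ).ennreal_ofReal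
    (Filter.Eventually.of_forall fun _ => ENNReal.ofReal_lt_top)]
  refine setIntegral_congr_fun Metric.isOpen_ball.measurableSet fun z hz => ?_
  rw [ENNReal.toReal_ofReal (Real.rpow_nonneg (bdf_pos hz).le _)]

theorem integrable_diskMeasure_iff {γ : ℝ} {E : Type*} [NormedAddCommGroup E] [NormedSpace ℝ E]
    {f : ℂ → E} :
    Integrable f (diskMeasure γ) ↔
      IntegrableOn (fun z => bdf z ^ γ • f z) (Metric.ball (0 : ℂ) 1) := by
  rw [diskMeasure_eq_ball, integrable_withDensity_iff_integrable_smul'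
    (measurable_bdf_rpow γ).ennreal_ofReal
    (Filter.Eventually.of_forall fun _ => ENNReal.ofReal_lt_top)]
  refine integrableOn_congr_fun (fun z hz => ?_) Metric.isOpen_ball.measurableSet
  rw [ENNReal.toReal_ofReal (Real.rpow_nonneg (bdf_pos hz).le _)]

theorem integrableOn_one_sub_sq_rpow {γ : ℝ} (hγ : -1 < γ) :
    IntegrableOn (fun x : ℝ => (1 - x ^ 2) ^ γ) (Set.Ioo 0 1) :=
  ((intervalIntegrable_iff_integrableOn_Ioo_of_le (by norm_num)).1
    (intervalIntegrable_one_sub_sq_rpow hγ)).mono_set (Set.Ioo_subset_Ioo (by norm_num) le_rfl)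

/-- In polar coordinates the mass is governed by r(1−r²)^γ on (0, 1), which is integrable exactly
because γ > −1. -/
theorem isFiniteMeasure_diskMeasure {γ : ℝ} (hγ : -1 < γ) : IsFiniteMeasure (diskMeasure γ) := by
  have h : Integrable (fun _ => (1 : ℝ)) (diskMeasure γ) := by
    rw [integrable_diskMeasure_iff]
    simp only [smul_eq_mul, mul_one, bdf]
    rw [integrableOn_fun_norm_addHaar (μ := (volume : Measure ℂ))
      (f := fun r : ℝ => (1 - r ^ 2) ^ γ), Complex.finrank_real_complex]
    simp only [smul_eq_mul, Nat.add_one_sub_one, pow_one]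
    have h1 := (integrableOn_one_sub_sq_rpow hγ).integrable
    refine Integrable.bdd_mul (c := 1) h1 (by fun_prop) ?_
    rw [ae_restrict_iff' measurableSet_Ioo]
    refine Filter.Eventually.of_forall fun x hx => ?_
    rw [Real.norm_of_nonneg hx.1.le]
    exact hx.2.le
  rw [integrable_const_iff] at h
  simpa using h

theorem memLp_of_continuous {γ : ℝ} (hγ : -1 < γ) {f : ℂ → ℂ} (hf : Continuous f)
    (p : ENNReal) : MemLp f p (diskMeasure γ) := by
  have := isFiniteMeasure_diskMeasure hγ
  obtain ⟨C, hC⟩ := (isCompact_closedBall (0 : ℂ) 1).exists_bound_of_continuousOn hf.continuousOn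
  refine MemLp.of_bound hf.aestronglyMeasurable C ?_
  rw [ae_diskMeasure_iff]
  exact Filter.Eventually.of_forall fun z hz => hC z (Metric.ball_subset_closedBall hz)

/-! ### Rotation invariance -/

theorem measurePreserving_mul_left {ω : ℂ} (hω : ‖ω‖ = 1) :
    MeasurePreserving (fun z : ℂ => ω * z) volume volume :=
  (rotation (⟨ω, mem_sphere_zero_iff_norm.2 hω⟩ : Circle)).measurePreserving

theorem integral_diskMeasure_comp_mul {γ : ℝ} {ω : ℂ} (hω : ‖ω‖ = 1) (f : ℂ → ℂ) :
    ∫ z, f (ω * z) ∂diskMeasure γ = ∫ z, f z ∂diskMeasure γ := by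
  have he : MeasurableEmbedding (fun z : ℂ => ω * z) := by
    refine (Homeomorph.mulLeft₀ ω ?_).measurableEmbedding
    rw [← norm_ne_zero_iff, hω]
    exact one_ne_zero
  rw [integral_diskMeasure, integral_diskMeasure,
    ← integral_indicator Metric.isOpen_ball.measurableSet,
    ← integral_indicator Metric.isOpen_ball.measurableSet,
    ← (measurePreserving_mul_left hω).integral_comp he
      ((Metric.ball (0 : ℂ) 1).indicator fun z => bdf z ^ γ • f z)]
  refine integral_congr_ae (Filter.Eventually.of_forall fun z => ?_)
  simp only [Set.indicator, Metric.mem_ball, dist_zero_right, norm_mul, hω, one_mul, bdf]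

/-- Rotation by e^{iπ/(n−m)} multiplies the integrand by e^{iπ} = −1 and preserves the measure, so
the integral equals its own negative. The radial factor is kept arbitrary so that cutoffs to smaller
disks are covered. -/
theorem integral_radial_mul_conj_pow_mul_pow {γ : ℝ} (h : ℝ → ℂ) {m n : ℕ} (hmn : m ≠ n) :
    ∫ z, h ‖z‖ * ((starRingEnd ℂ) (z ^ m) * z ^ n) ∂diskMeasure γ = 0 := by
  have hd : ((n : ℂ) - m) ≠ 0 := sub_ne_zero.2 (by exact_mod_cast hmn.symm)
  set t : ℝ := Real.pi / ((n : ℝ) - m) with ht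
  have htc : (t : ℂ) * ((n : ℂ) - m) = Real.pi := by
    rw [ht]
    push_cast
    field_simp
  set ω : ℂ := Complex.exp (t * Complex.I) with hωd
  have hω : ‖ω‖ = 1 := Complex.norm_exp_ofReal_mul_I t
  have hrot := integral_diskMeasure_comp_mul (γ := γ) hω
    (fun z => h ‖z‖ * ((starRingEnd ℂ) (z ^ m) * z ^ n))
  have hc : (starRingEnd ℂ) (ω ^ m) * ω ^ n = -1 := by
    rw [map_pow, hωd, ← Complex.exp_conj, ← Complex.exp_nat_mul, ← Complex.exp_nat_mul,
      ← Complex.exp_add, ← Complex.exp_pi_mul_I]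
    congr 1
    rw [map_mul, Complex.conj_ofReal, Complex.conj_I]
    linear_combination Complex.I * htc
  have h2 : ∀ z : ℂ, h ‖ω * z‖ * ((starRingEnd ℂ) ((ω * z) ^ m) * (ω * z) ^ n) =
      -1 * (h ‖z‖ * ((starRingEnd ℂ) (z ^ m) * z ^ n)) := fun z => by
    rw [norm_mul, hω, one_mul, mul_pow, mul_pow, map_mul, ← hc]
    ring
  simp only [h2] at hrot
  rw [integral_const_mul] at hrot
  linear_combination (-1 / 2) * hrot

theorem integral_conj_pow_mul_pow {γ : ℝ} {m n : ℕ} (hmn : m ≠ n) :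
    ∫ z, (starRingEnd ℂ) (z ^ m) * z ^ n ∂diskMeasure γ = 0 := by
  simpa using integral_radial_mul_conj_pow_mul_pow (γ := γ) (fun _ => 1) hmn

/-! ### Norms of the monomials -/

/-- The square of the norm of `z^n` in `L²_γ(𝔻)`. -/
def monomialNormSq (γ : ℝ) (n : ℕ) : ℝ := ∫ z, ‖z‖ ^ (2 * n) ∂diskMeasure γ

/-- `∫_0^1 r^{2n+1} (1-r²)^γ dr`. -/
def radialMoment (γ : ℝ) (n : ℕ) : ℝ := ∫ r in (0 : ℝ)..1, r ^ (2 * n + 1) * (1 - r ^ 2) ^ γ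

theorem intervalIntegrable_radial {γ : ℝ} (hγ : -1 < γ) (n : ℕ) :
    IntervalIntegrable (fun r : ℝ => r ^ n * (1 - r ^ 2) ^ γ) volume 0 1 := by
  have h := (intervalIntegrable_iff_integrableOn_Ioo_of_le zero_le_one).2
    (integrableOn_one_sub_sq_rpow hγ)
  exact h.continuousOn_mul (by fun_prop)

theorem monomialNormSq_eq_radialMoment (γ : ℝ) (n : ℕ) :
    monomialNormSq γ n = 2 * Real.pi * radialMoment γ n := by
  have hb : volume.real (Metric.ball (0 : ℂ) 1) = Real.pi := by
    simp [Measure.real, Complex.volume_ball]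
  have h := integral_fun_norm_addHaar (volume : Measure ℂ)
    (fun r : ℝ => (Set.Iio (1 : ℝ)).indicator (fun r => (1 - r ^ 2) ^ γ * r ^ (2 * n)) r)
  rw [hb, Complex.finrank_real_complex] at h
  rw [monomialNormSq, integral_diskMeasure, ← integral_indicator Metric.isOpen_ball.measurableSet]
  have e1 : (fun z : ℂ => (Set.Iio (1 : ℝ)).indicator
      (fun r : ℝ => (1 - r ^ 2) ^ γ * r ^ (2 * n)) ‖z‖) =
      (Metric.ball (0 : ℂ) 1).indicator (fun z => bdf z ^ γ • ‖z‖ ^ (2 * n)) := by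
    funext z
    simp [Set.indicator, bdf]
  rw [← e1, h, nsmul_eq_mul, smul_eq_mul, radialMoment, intervalIntegral.integral_of_le zero_le_one,
    integral_Ioc_eq_integral_Ioo, ← integral_indicator measurableSet_Ioi,
    ← integral_indicator measurableSet_Ioo, mul_assoc]
  congr 3
  funext r
  by_cases h0 : 0 < r <;> by_cases h1 : r < 1 <;> simp [Set.indicator, h0, h1]
  ring

theorem radialMoment_pos {γ : ℝ} (hγ : -1 < γ) (n : ℕ) : 0 < radialMoment γ n := by
  refine intervalIntegral.intervalIntegral_pos_of_pos_on (intervalIntegrable_radial hγ _)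
    (fun x hx => mul_pos (pow_pos hx.1 _) (Real.rpow_pos_of_pos ?_ _)) (by norm_num)
  nlinarith [hx.1, hx.2]

theorem monomialNormSq_pos {γ : ℝ} (hγ : -1 < γ) (n : ℕ) : 0 < monomialNormSq γ n := by
  rw [monomialNormSq_eq_radialMoment]
  exact mul_pos (by positivity) (radialMoment_pos hγ n)

/-- Integrate the derivative of r^{2n+2}(1−r²)^{γ+1}, which vanishes at 0 and at 1. -/
theorem radialMoment_succ {γ : ℝ} (hγ : -1 < γ) (n : ℕ) :
    ((n : ℝ) + 1 + (γ + 1)) * radialMoment γ (n + 1) = (n + 1) * radialMoment γ n := by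
  let P : ℝ → ℝ := fun r => r ^ (2 * n + 2) * (1 - r ^ 2) ^ (γ + 1)
  let D : ℝ → ℝ := fun r => (2 * n + 2) * (r ^ (2 * n + 1) * (1 - r ^ 2) ^ γ) -
    (2 * n + 2 + 2 * (γ + 1)) * (r ^ (2 * (n + 1) + 1) * (1 - r ^ 2) ^ γ)
  have hi1 := intervalIntegrable_radial hγ (2 * n + 1)
  have hi2 := intervalIntegrable_radial hγ (2 * (n + 1) + 1)
  have hDi : IntervalIntegrable D volume 0 1 := (hi1.const_mul _).sub (hi2.const_mul _)
  have hF : ∫ r in (0 : ℝ)..1, D r = P 1 - P 0 := by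
    refine intervalIntegral.integral_eq_sub_of_hasDerivAt_of_le (by norm_num) ?_ ?_ hDi
    · have : Continuous fun x : ℝ => (1 - x ^ 2) ^ (γ + 1) :=
        (by fun_prop : Continuous fun x : ℝ => 1 - x ^ 2).rpow_const
          (fun x => Or.inr (by linarith))
      simp only [P]
      fun_prop
    · intro x hx
      have hx2 : 0 < 1 - x ^ 2 := by nlinarith [hx.1, hx.2]
      have d1 : HasDerivAt (fun x : ℝ => (1 - x ^ 2) ^ (γ + 1))
          (-(2 * x) * (γ + 1) * (1 - x ^ 2) ^ γ) x := by
        have h := (((hasDerivAt_id x).pow 2).const_sub 1).rpow_const (p := γ + 1)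
          (Or.inl hx2.ne')
        simpa using h
      have d3 := (hasDerivAt_pow (2 * n + 2) x).mul d1
      refine d3.congr_deriv ?_
      simp only [D]
      rw [Real.rpow_add_one hx2.ne', show 2 * n + 2 - 1 = 2 * n + 1 by omega]
      push_cast
      ring
  have hs : ∫ r in (0 : ℝ)..1, D r = (2 * n + 2) * radialMoment γ n -
      (2 * n + 2 + 2 * (γ + 1)) * radialMoment γ (n + 1) := by
    rw [radialMoment, radialMoment, ← intervalIntegral.integral_const_mul,
      ← intervalIntegral.integral_const_mul, ← intervalIntegral.integral_sub]
    · exact hi1.const_mul _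
    · exact hi2.const_mul _
  have hz : (0 : ℝ) ^ (γ + 1) = 0 := Real.zero_rpow (by linarith)
  rw [hs] at hF
  norm_num [P, hz] at hF
  linarith

theorem monomialNormSq_succ {γ : ℝ} (hγ : -1 < γ) (n : ℕ) :
    ((n : ℝ) + 1 + (γ + 1)) * monomialNormSq γ (n + 1) = (n + 1) * monomialNormSq γ n := by
  rw [monomialNormSq_eq_radialMoment, monomialNormSq_eq_radialMoment]
  linear_combination (2 * Real.pi) * radialMoment_succ hγ n

/-! ### Integration along horizontal lines -/

theorem ball_fiber {y s : ℝ} :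
    ((s : ℂ) + Complex.I * y) ∈ Metric.ball (0 : ℂ) 1 ↔ s ^ 2 + y ^ 2 < 1 := by
  rw [mem_ball_zero_iff, ← sq_lt_one_iff₀ (norm_nonneg _), ← Complex.normSq_eq_norm_sq,
    Complex.normSq_apply]
  simp [sq]

theorem bdf_fiber (y s : ℝ) : bdf ((s : ℂ) + Complex.I * y) = 1 - y ^ 2 - s ^ 2 := by
  rw [bdf, ← Complex.normSq_eq_norm_sq, Complex.normSq_apply]
  simp
  ring

/-- The integral of `z^n` over the disk, computed along horizontal lines. -/
theorem integral_pow_eq_integral_gegenbauer {γ : ℝ} (hγ : -1 < γ) (n : ℕ) :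
    ∫ z, z ^ n ∂diskMeasure γ = Complex.I ^ n * (momentFactor γ n *
      ∫ y in (-1 : ℝ)..1, gegenbauer (γ + 1) n y * (1 - y ^ 2) ^ (γ + 1 / 2) : ℝ) := by
  have hint : Integrable (fun z : ℂ => z ^ n) (diskMeasure γ) :=
    memLp_one_iff_integrable.1 (memLp_of_continuous hγ (by fun_prop) 1)
  rw [integrable_diskMeasure_iff, ← integrable_indicator_iff Metric.isOpen_ball.measurableSet]
    at hint
  set g := (Metric.ball (0 : ℂ) 1).indicator (fun z : ℂ => bdf z ^ γ • z ^ n) with hg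
  have mp := Complex.volume_preserving_equiv_real_prod.symm
  have hint2 := (mp.integrable_comp_emb
    Complex.measurableEquivRealProd.symm.measurableEmbedding).2 hint
  rw [integral_diskMeasure, ← integral_indicator Metric.isOpen_ball.measurableSet, ← hg,
    ← mp.integral_comp Complex.measurableEquivRealProd.symm.measurableEmbedding]
  rw [Measure.volume_eq_prod] at hint2 ⊢
  have hsw := integral_prod_symm _ hint2
  simp only [Function.comp_def] at hsw
  rw [hsw, ← intervalIntegral.integral_const_mul, ← intervalIntegral.integral_ofReal,
    ← intervalIntegral.integral_const_mul, intervalIntegral.integral_of_le (by norm_num),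
    integral_Ioc_eq_integral_Ioo, ← integral_indicator measurableSet_Ioo]
  congr 1
  funext y
  have hz : ∀ s : ℝ, Complex.measurableEquivRealProd.symm (s, y) = (s : ℂ) + Complex.I * y := by
    intro s
    rw [Complex.measurableEquivRealProd_symm_apply]
    apply Complex.ext <;> simp
  simp only [hz, hg]
  by_cases hy : y ∈ Set.Ioo (-1 : ℝ) 1
  · have hy2 : 0 < 1 - y ^ 2 := by nlinarith [hy.1, hy.2]
    rw [Set.indicator_of_mem hy]
    set μ := Real.sqrt (1 - y ^ 2) with hμ
    have hμ0 : 0 < μ := Real.sqrt_pos.2 hy2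
    have hμ2 : y ^ 2 + μ ^ 2 = 1 := by
      rw [hμ, Real.sq_sqrt hy2.le]
      ring
    have h1 := integral_pow_mul_weight (γ := γ) hμ0 hμ2 n
    rw [lineMoment_eq_gegenbauer hγ (by linarith)] at h1
    -- The scaling factor of the chord at height y is the Gegenbauer weight.
    have h2 : μ ^ (2 * γ + 1) = (1 - y ^ 2) ^ (γ + 1 / 2) := by
      rw [hμ, Real.sqrt_eq_rpow, ← Real.rpow_mul hy2.le]
      congr 1
      ring
    rw [h2, intervalIntegral.integral_of_le (by linarith), integral_Ioc_eq_integral_Ioo,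
      ← integral_indicator measurableSet_Ioo] at h1
    refine Eq.trans ?_ (h1.trans ?_)
    · congr 1
      funext s
      have hiff : ((s : ℂ) + Complex.I * y) ∈ Metric.ball (0 : ℂ) 1 ↔ s ∈ Set.Ioo (-μ) μ := by
        rw [ball_fiber, Set.mem_Ioo, ← abs_lt, ← sq_lt_sq₀ (abs_nonneg s) hμ0.le, sq_abs]
        constructor <;> intro h <;> linarith
      by_cases hs : s ∈ Set.Ioo (-μ) μ
      · rw [Set.indicator_of_mem hs, Set.indicator_of_mem (hiff.2 hs), bdf_fiber,
          show 1 - y ^ 2 - s ^ 2 = μ ^ 2 - s ^ 2 by linarith, Complex.real_smul, mul_comm]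
      · rw [Set.indicator_of_notMem hs, Set.indicator_of_notMem (fun h => hs (hiff.1 h))]
    · push_cast
      ring
  · rw [Set.indicator_of_notMem hy]
    refine integral_eq_zero_of_ae (Filter.Eventually.of_forall fun s => ?_)
    refine Set.indicator_of_notMem (fun h => hy ?_) _
    rw [ball_fiber] at h
    have : |y| < 1 := by
      rw [← sq_lt_one_iff_abs_lt_one]
      nlinarith [sq_nonneg s]
    exact abs_lt.1 this

/-- Rotation invariance kills the disk integral of z^n, while slicing by horizontal lines expresses
it as a nonzero multiple of the integral here. This is orthogonality to the constant polynomial and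
starts the induction for all pairs. -/
theorem integral_gegenbauer_eq_zero {γ : ℝ} (hγ : -1 < γ) {n : ℕ} (hn : n ≠ 0) :
    ∫ y in (-1 : ℝ)..1, gegenbauer (γ + 1) n y * (1 - y ^ 2) ^ (γ + 1 / 2) = 0 := by
  have h := integral_pow_eq_integral_gegenbauer hγ n
  have h0 := integral_conj_pow_mul_pow (γ := γ) hn.symm
  simp only [pow_zero, map_one, one_mul] at h0
  rw [h0] at h
  have h2 := (mul_eq_zero.1 h.symm).resolve_left (pow_ne_zero _ Complex.I_ne_zero)
  exact (mul_eq_zero.1 (Complex.ofReal_eq_zero.1 h2)).resolve_left (momentFactor_pos hγ n).ne'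

/-! ### Orthogonality and norms of the Gegenbauer polynomials -/

/-- The inner product of two functions on `[-1, 1]` for the weight `(1-x²)^{γ+1/2}`. -/
def weightInner (γ : ℝ) (f g : ℝ → ℝ) : ℝ :=
  ∫ x in (-1 : ℝ)..1, f x * g x * (1 - x ^ 2) ^ (γ + 1 / 2)

theorem intervalIntegrable_weightInner {γ : ℝ} (hγ : -1 < γ) {f : ℝ → ℝ} (hf : Continuous f) :
    IntervalIntegrable (fun x : ℝ => f x * (1 - x ^ 2) ^ (γ + 1 / 2)) volume (-1) 1 :=
  (intervalIntegrable_one_sub_sq_rpow (by linarith)).continuousOn_mul hf.continuousOn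

theorem weightInner_comm (γ : ℝ) (f g : ℝ → ℝ) : weightInner γ f g = weightInner γ g f := by
  simp only [weightInner, mul_comm (f _)]

theorem weightInner_id_mul (γ : ℝ) (f g : ℝ → ℝ) :
    weightInner γ (fun x => x * f x) g = weightInner γ f (fun x => x * g x) := by
  unfold weightInner
  congr 1
  funext x
  ring

theorem weightInner_recurrence {γ : ℝ} (hγ : -1 < γ) {f : ℝ → ℝ} (hf : Continuous f) (n : ℕ) :
    ((n : ℝ) + 2) * weightInner γ f (gegenbauer (γ + 1) (n + 2)) =
      2 * (n + 1 + (γ + 1)) * weightInner γ f (fun x => x * gegenbauer (γ + 1) (n + 1) x) -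
        (n + 2 * (γ + 1)) * weightInner γ f (gegenbauer (γ + 1) n) := by
  have h0 := continuous_gegenbauer (γ + 1) n
  have h1 := continuous_gegenbauer (γ + 1) (n + 1)
  unfold weightInner
  rw [← intervalIntegral.integral_const_mul, ← intervalIntegral.integral_const_mul,
    ← intervalIntegral.integral_const_mul, ← intervalIntegral.integral_sub]
  · congr 1
    funext x
    linear_combination (f x * (1 - x ^ 2) ^ (γ + 1 / 2)) * gegenbauer_add_two (γ + 1) n x
  · exact (intervalIntegrable_weightInner hγ (by fun_prop)).const_mul _
  · exact (intervalIntegrable_weightInner hγ (by fun_prop)).const_mul _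

theorem weightInner_gegenbauer_one (γ : ℝ) (f : ℝ → ℝ) :
    weightInner γ (gegenbauer (γ + 1) 1) f =
      2 * (γ + 1) * weightInner γ (gegenbauer (γ + 1) 0) (fun x => x * f x) := by
  unfold weightInner
  rw [← intervalIntegral.integral_const_mul]
  congr 1
  funext x
  rw [gegenbauer_one, gegenbauer_zero]
  ring

theorem weightInner_id_gegenbauer_eq_zero {γ : ℝ} (hγ : -1 < γ) {f : ℝ → ℝ} (hf : Continuous f)
    {k : ℕ} (h0 : weightInner γ f (gegenbauer (γ + 1) k) = 0)
    (h2 : weightInner γ f (gegenbauer (γ + 1) (k + 2)) = 0) :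
    weightInner γ f (fun x => x * gegenbauer (γ + 1) (k + 1) x) = 0 := by
  have h := weightInner_recurrence hγ hf k
  rw [h0, h2] at h
  have hp : 0 < 2 * ((k : ℝ) + 1 + (γ + 1)) := by
    have := k.cast_nonneg (α := ℝ)
    linarith
  have h3 : 2 * ((k : ℝ) + 1 + (γ + 1)) *
      weightInner γ f (fun x => x * gegenbauer (γ + 1) (k + 1) x) = 0 := by linarith
  exact (mul_eq_zero.1 h3).resolve_left hp.ne'

/-- Multiplication by x is symmetric for the weighted inner product. Writing C_{m+2} through x
C_{m+1} and C_m and moving x to the other side leaves pairings of C_{m+1} with C_{n−1} and C_{n+1},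
both of index larger than m + 1, so the induction closes. -/
theorem weightInner_gegenbauer_of_lt {γ : ℝ} (hγ : -1 < γ) (m : ℕ) :
    ∀ n, m < n → weightInner γ (gegenbauer (γ + 1) m) (gegenbauer (γ + 1) n) = 0 := by
  induction m using Nat.twoStepInduction with
  | zero =>
    intro n hn
    simp only [weightInner, gegenbauer_zero, one_mul]
    exact integral_gegenbauer_eq_zero hγ hn.ne'
  | one =>
    intro n hn
    rw [weightInner_gegenbauer_one]
    obtain ⟨k, rfl⟩ : ∃ k, n = k + 1 := ⟨n - 1, by omega⟩
    rw [weightInner_id_gegenbauer_eq_zero hγ (continuous_gegenbauer _ _), mul_zero]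
    all_goals
      simp only [weightInner, gegenbauer_zero, one_mul]
      exact integral_gegenbauer_eq_zero hγ (by omega)
  | more m ih0 ih1 =>
    intro n hn
    obtain ⟨k, rfl⟩ : ∃ k, n = k + 1 := ⟨n - 1, by omega⟩
    have h := weightInner_recurrence hγ (continuous_gegenbauer (γ + 1) (k + 1)) m
    rw [← weightInner_id_mul, weightInner_comm γ _ (gegenbauer (γ + 1) m), ih0 _ (by omega),
      weightInner_comm γ (fun x => x * gegenbauer (γ + 1) (k + 1) x),
      weightInner_id_gegenbauer_eq_zero hγ (continuous_gegenbauer _ _) (ih1 _ (by omega))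
        (ih1 _ (by omega)), weightInner_comm] at h
    have hp : (m : ℝ) + 2 ≠ 0 := by positivity
    rw [mul_zero, mul_zero, sub_zero] at h
    exact (mul_eq_zero.1 h).resolve_left hp

theorem gegenbauerNormSq_eq_weightInner (γ : ℝ) (n : ℕ) :
    gegenbauerNormSq γ n =
      weightInner γ (gegenbauer (γ + 1) n) (gegenbauer (γ + 1) n) := by
  simp only [gegenbauerNormSq, weightInner, sq (gegenbauer _ _ _)]

/-- The cross term ⟨C_n, x C_{n+1}⟩ is computed twice: pairing the recurrence for C_{n+2} with C_n
gives ‖C_n‖² (`hup`), and pairing the one for C_{n+1} with C_{n+1} gives ‖C_{n+1}‖² (`hdown`).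
Orthogonality removes the third term each time. At n = 0 the formula for C_1 replaces the
recurrence. -/
theorem gegenbauerNormSq_succ {γ : ℝ} (hγ : -1 < γ) (n : ℕ) :
    ((n : ℝ) + 1) * (n + 1 + (γ + 1)) * gegenbauerNormSq γ (n + 1) =
      (n + (γ + 1)) * (n + 2 * (γ + 1)) * gegenbauerNormSq γ n := by
  have hc := fun n => continuous_gegenbauer (γ + 1) n
  rw [gegenbauerNormSq_eq_weightInner, gegenbauerNormSq_eq_weightInner]
  have hup : 2 * ((n : ℝ) + 1 + (γ + 1)) * weightInner γ (gegenbauer (γ + 1) n)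
      (fun x => x * gegenbauer (γ + 1) (n + 1) x) = (n + 2 * (γ + 1)) *
        weightInner γ (gegenbauer (γ + 1) n) (gegenbauer (γ + 1) n) := by
    have h := weightInner_recurrence hγ (hc n) n
    rw [weightInner_gegenbauer_of_lt hγ n (n + 2) (by omega)] at h
    linarith
  have hdown : ((n : ℝ) + 1) *
      weightInner γ (gegenbauer (γ + 1) (n + 1)) (gegenbauer (γ + 1) (n + 1)) =
      2 * (n + (γ + 1)) * weightInner γ (gegenbauer (γ + 1) n)
        (fun x => x * gegenbauer (γ + 1) (n + 1) x) := by
    rcases n with _ | k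
    · rw [weightInner_gegenbauer_one]
      push_cast
      ring
    · have h := weightInner_recurrence hγ (hc (k + 2)) k
      rw [weightInner_comm γ _ (gegenbauer (γ + 1) k),
        weightInner_gegenbauer_of_lt hγ k (k + 2) (by omega), ← weightInner_id_mul,
        weightInner_comm γ _ (gegenbauer (γ + 1) (k + 1))] at h
      push_cast
      linear_combination h
  linear_combination ((n : ℝ) + 1 + (γ + 1)) * hdown + ((n : ℝ) + (γ + 1)) * hup

theorem gegenbauerNormSq_pos {γ : ℝ} (hγ : -1 < γ) (n : ℕ) : 0 < gegenbauerNormSq γ n := by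
  induction n with
  | zero =>
    simp only [gegenbauerNormSq, gegenbauer_zero, one_pow, one_mul]
    exact weightIntegral_pos (by linarith)
  | succ n ih =>
    have h := gegenbauerNormSq_succ hγ n
    have hn := n.cast_nonneg (α := ℝ)
    have h1 : 0 < ((n : ℝ) + (γ + 1)) * (n + 2 * (γ + 1)) * gegenbauerNormSq γ n :=
      mul_pos (mul_pos (by linarith) (by linarith)) ih
    rw [← h] at h1
    exact pos_of_mul_pos_right h1 (mul_pos (by linarith) (by linarith)).le

/-! ### Singular values -/

/-- The square of the `n`-th singular value of the weighted X-ray transform on analytic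
functions. -/
def singularValueSq (γ : ℝ) (n : ℕ) : ℝ :=
  2 * Real.pi * momentFactor γ n ^ 2 * gegenbauerNormSq γ n / monomialNormSq γ n

theorem singularValueSq_pos {γ : ℝ} (hγ : -1 < γ) (n : ℕ) : 0 < singularValueSq γ n := by
  have h1 := momentFactor_pos hγ n
  have h2 := gegenbauerNormSq_pos hγ n
  have h3 := monomialNormSq_pos hγ n
  unfold singularValueSq
  positivity

/-- In the quotient of consecutive values all factors n+1 and n+1+(γ+1) cancel among the three
recurrences. The surviving ratio is 1 − (γ+1)/(n+2(γ+1)), hence decay of order n^{-(γ+1)}. -/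
theorem singularValueSq_succ {γ : ℝ} (hγ : -1 < γ) (n : ℕ) :
    ((n : ℝ) + 2 * (γ + 1)) * singularValueSq γ (n + 1) =
      (n + (γ + 1)) * singularValueSq γ n := by
  have hn := n.cast_nonneg (α := ℝ)
  have p1 : 0 < (n : ℝ) + 2 * (γ + 1) := by linarith
  have p2 : 0 < (n : ℝ) + 1 + (γ + 1) := by linarith
  have p3 : 0 < (n : ℝ) + 1 := by linarith
  have e1 : momentFactor γ (n + 1) = (n + 1) * momentFactor γ n / (n + 2 * (γ + 1)) := by
    rw [eq_div_iff p1.ne', ← momentFactor_succ hγ]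
    ring
  have e2 : gegenbauerNormSq γ (n + 1) = (n + (γ + 1)) * (n + 2 * (γ + 1)) *
      gegenbauerNormSq γ n / ((n + 1) * (n + 1 + (γ + 1))) := by
    rw [eq_div_iff (mul_pos p3 p2).ne', ← gegenbauerNormSq_succ hγ]
    ring
  have e3 : monomialNormSq γ (n + 1) = (n + 1) * monomialNormSq γ n / (n + 1 + (γ + 1)) := by
    rw [eq_div_iff p2.ne', ← monomialNormSq_succ hγ]
    ring
  have p4 := monomialNormSq_pos hγ n
  rw [singularValueSq, singularValueSq, e1, e2, e3]
  field_simp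

-- Solving the recursion gives T_n = T_0 (l)_n / (2l)_n. Euler's formula Γ(s) = lim n^s n! /
-- ∏_{j≤n}(s+j), taken for 2l and for l, gives the limit T_0 Γ(2l)/Γ(l) after multiplication by n^l.
open Filter Topology in
theorem tendsto_mul_rpow_of_ratio {l : ℝ} (hl : 0 < l) {T : ℕ → ℝ} (hT0 : 0 < T 0)
    (hT : ∀ n : ℕ, ((n : ℝ) + 2 * l) * T (n + 1) = (n + l) * T n) :
    ∃ L : ℝ, 0 < L ∧ Tendsto (fun n : ℕ => T n * ((n : ℝ) + 1) ^ l) atTop (𝓝 L) := by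
  have hprod : ∀ n : ℕ, T n = T 0 * ((∏ j ∈ Finset.range n, (l + j)) /
      ∏ j ∈ Finset.range n, (2 * l + j)) := fun n => by
    induction n with
    | zero => simp
    | succ n ih =>
      have hp : (0 : ℝ) < (n : ℝ) + 2 * l := by positivity
      have hp2 : ∏ j ∈ Finset.range n, (2 * l + (j : ℝ)) ≠ 0 :=
        (Finset.prod_pos fun j _ => by positivity).ne'
      have : T (n + 1) = (n + l) * T n / (n + 2 * l) := by
        rw [eq_div_iff hp.ne', ← hT]
        ring
      rw [this, ih, Finset.prod_range_succ, Finset.prod_range_succ,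
        show 2 * l + (n : ℝ) = n + 2 * l by ring]
      field_simp
      ring
  have hG1 := Real.GammaSeq_tendsto_Gamma l
  have hG2 := Real.GammaSeq_tendsto_Gamma (2 * l)
  have hp1 := Real.Gamma_pos_of_pos hl
  have hp2 := Real.Gamma_pos_of_pos (mul_pos two_pos hl)
  refine ⟨T 0 * (Real.Gamma (2 * l) / Real.Gamma l), by positivity, ?_⟩
  -- Euler's product at stage n has n + 1 factors and so matches T_{n+1}; the limit `hr` absorbs the
  -- replacement of n^l by (n+2)^l.
  rw [← tendsto_add_atTop_iff_nat 1]
  have hlim := ((hG2.div hG1 hp1.ne').const_mul (T 0))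
  have hr : Tendsto (fun n : ℕ => (((n : ℝ) + 2) / n) ^ l) atTop (𝓝 1) := by
    have h1 : Tendsto (fun n : ℕ => ((n : ℝ) + 2) / n) atTop (𝓝 1) := by
      have h2 := (tendsto_const_div_atTop_nhds_zero_nat (2 : ℝ)).const_add 1
      rw [add_zero] at h2
      refine h2.congr' ?_
      filter_upwards [eventually_gt_atTop 0] with n hn
      have : (n : ℝ) ≠ 0 := by positivity
      field_simp
    simpa using h1.rpow_const (p := l) (Or.inl one_ne_zero)
  have := hlim.mul hr
  rw [mul_one] at this
  refine this.congr' ?_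
  filter_upwards [eventually_gt_atTop 0] with n hn
  have hn' : (0 : ℝ) < n := by positivity
  simp only [Pi.div_apply, Real.GammaSeq]
  rw [hprod (n + 1), Real.div_rpow (by positivity) hn'.le,
    two_mul, Real.rpow_add hn', ← two_mul]
  have q1 : ∏ j ∈ Finset.range (n + 1), (2 * l + (j : ℝ)) ≠ 0 :=
    (Finset.prod_pos fun j _ => by positivity).ne'
  have q2 : ∏ j ∈ Finset.range (n + 1), (l + (j : ℝ)) ≠ 0 :=
    (Finset.prod_pos fun j _ => by positivity).ne'
  have q3 : (n : ℝ) ^ l ≠ 0 := (Real.rpow_pos_of_pos hn' l).ne'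
  have q4 : (Nat.factorial n : ℝ) ≠ 0 := by exact_mod_cast Nat.factorial_ne_zero n
  push_cast
  rw [show (n : ℝ) + 1 + 1 = n + 2 by ring]
  field_simp

open Filter Topology in
theorem exists_bounds_of_tendsto_pos {U : ℕ → ℝ} (hU : ∀ n, 0 < U n) {L : ℝ} (hL : 0 < L)
    (h : Tendsto U atTop (𝓝 L)) : ∃ c C : ℝ, 0 < c ∧ 0 < C ∧ ∀ n, c ≤ U n ∧ U n ≤ C := by
  obtain ⟨C, hC⟩ := h.bddAbove_range
  obtain ⟨D, hD⟩ := (h.inv₀ hL.ne').bddAbove_range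
  have hC' : ∀ n, U n ≤ C := fun n => hC ⟨n, rfl⟩
  have hD' : ∀ n, (U n)⁻¹ ≤ D := fun n => hD ⟨n, rfl⟩
  have hD0 : 0 < D := (inv_pos.2 (hU 0)).trans_le (hD' 0)
  exact ⟨D⁻¹, C, inv_pos.2 hD0, (hU 0).trans_le (hC' 0), fun n =>
    ⟨inv_le_of_inv_le₀ (hU n) (hD' n), hC' n⟩⟩

theorem singularValueSq_bounds {γ : ℝ} (hγ : -1 < γ) :
    ∃ c C : ℝ, 0 < c ∧ 0 < C ∧ ∀ n : ℕ, c ≤ singularValueSq γ n * ((n : ℝ) + 1) ^ (γ + 1) ∧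
      singularValueSq γ n * ((n : ℝ) + 1) ^ (γ + 1) ≤ C := by
  obtain ⟨L, hL, h⟩ := tendsto_mul_rpow_of_ratio (l := γ + 1) (by linarith)
    (singularValueSq_pos hγ 0) (singularValueSq_succ hγ)
  exact exists_bounds_of_tendsto_pos
    (fun n => mul_pos (singularValueSq_pos hγ n) (by positivity)) hL h

/-! ### Santaló's formula -/

/-- Turning the direction of the geodesic onto the real axis makes the chord horizontal at height
sin α, with t − cos α measured from its midpoint. All chord computations reduce to this normal form.
-/
theorem geoPoint_eq (q : ℝ × ℝ) (t : ℝ) :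
    geoPoint q t =
      geoDir q * (((t - Real.cos q.2 : ℝ) : ℂ) + Complex.I * (Real.sin q.2 : ℝ)) := by
  have h : Complex.exp ((q.1 : ℂ) * Complex.I) = geoDir q *
      (-(Real.cos q.2 : ℂ) + Complex.I * (Real.sin q.2 : ℝ)) := by
    have e1 : Complex.exp ((q.1 : ℂ) * Complex.I) =
        geoDir q * Complex.exp (-((q.2 : ℂ) * Complex.I)) * Complex.exp (-(Real.pi * Complex.I)) := by
      rw [geoDir, ← Complex.exp_add, ← Complex.exp_add]
      congr 1
      rw [geoAngle]
      push_cast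
      ring
    rw [e1, Complex.exp_neg (Real.pi * Complex.I), Complex.exp_pi_mul_I, ← neg_mul,
      Complex.exp_mul_I, Complex.cos_neg, Complex.sin_neg, Complex.ofReal_cos, Complex.ofReal_sin]
    ring
  rw [geoPoint, h]
  push_cast
  ring

theorem norm_geoPoint_sq (q : ℝ × ℝ) (t : ℝ) :
    ‖geoPoint q t‖ ^ 2 = (t - Real.cos q.2) ^ 2 + Real.sin q.2 ^ 2 := by
  rw [geoPoint_eq, norm_mul, norm_geoDir, one_mul, ← Complex.normSq_eq_norm_sq,
    Complex.normSq_apply]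
  simp [sq, -Complex.ofReal_sin, -Complex.ofReal_cos]

theorem bdf_geoPoint (q : ℝ × ℝ) (t : ℝ) :
    bdf (geoPoint q t) = Real.cos q.2 ^ 2 - (t - Real.cos q.2) ^ 2 := by
  rw [bdf, norm_geoPoint_sq]
  linarith [Real.sin_sq_add_cos_sq q.2]

theorem geoPoint_mem_ball {q : ℝ × ℝ} {t : ℝ} (ht : t ∈ Set.Ioo 0 (2 * Real.cos q.2)) :
    geoPoint q t ∈ Metric.ball (0 : ℂ) 1 := by
  have h := norm_geoPoint_sq q t
  rw [mem_ball_zero_iff, ← sq_lt_one_iff₀ (norm_nonneg _), h]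
  nlinarith [Real.sin_sq_add_cos_sq q.2, ht.1, ht.2]

/-- The integral of `G` along the chord with direction `ω` at signed distance `sin α` from the
origin. -/
def chordLIntegral (G : ℂ → ENNReal) (p : ℝ × ℂ) : ENNReal :=
  ∫⁻ t in Set.Ioo 0 (2 * Real.cos p.1),
    G (p.2 * (((t - Real.cos p.1 : ℝ) : ℂ) + Complex.I * (Real.sin p.1 : ℝ)))

theorem measurable_chordLIntegral {G : ℂ → ENNReal} (hG : Measurable G) :
    Measurable (chordLIntegral G) := by
  have h : chordLIntegral G = fun p : ℝ × ℂ => ∫⁻ t : ℝ,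
      ({x : (ℝ × ℂ) × ℝ | x.2 ∈ Set.Ioo 0 (2 * Real.cos x.1.1)}.indicator
        (fun x => G (x.1.2 * (((x.2 - Real.cos x.1.1 : ℝ) : ℂ) +
          Complex.I * (Real.sin x.1.1 : ℝ))))) (p, t) := by
    funext p
    rw [chordLIntegral, ← lintegral_indicator measurableSet_Ioo]
    rfl
  rw [h]
  refine Measurable.lintegral_prod_right' (Measurable.indicator ?_ ?_)
  · exact hG.comp (by fun_prop)
  · have hc : Measurable fun x : (ℝ × ℂ) × ℝ => 2 * Real.cos x.1.1 := by fun_prop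
    exact (measurableSet_lt measurable_const measurable_snd).inter
      (measurableSet_lt measurable_snd hc)

theorem chordLIntegral_geoDir (G : ℂ → ENNReal) (q : ℝ × ℝ) :
    chordLIntegral G (q.2, geoDir q) =
      ∫⁻ t in Set.Ioo 0 (2 * Real.cos q.2), G (geoPoint q t) := by
  simp only [chordLIntegral, geoPoint_eq]

theorem sin_image_Ioo :
    Real.sin '' Set.Ioo (-(Real.pi / 2)) (Real.pi / 2) = Set.Ioo (-1) 1 := by
  ext y
  constructor
  · rintro ⟨x, hx, rfl⟩
    have h := Real.cos_pos_of_mem_Ioo hx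
    have := Real.sin_sq_add_cos_sq x
    constructor <;> nlinarith
  · intro hy
    exact ⟨Real.arcsin y, ⟨Real.neg_pi_div_two_lt_arcsin.2 hy.1, Real.arcsin_lt_pi_div_two.2 hy.2⟩,
      Real.sin_arcsin hy.1.le hy.2.le⟩

/-- The area of the disk in the coordinates of a family of parallel chords. -/
theorem lintegral_chords_one {G : ℂ → ENNReal} (hG : Measurable G) :
    ∫⁻ a in Set.Icc (-(Real.pi / 2)) (Real.pi / 2),
      ENNReal.ofReal (Real.cos a) * chordLIntegral G (a, 1) =
    ∫⁻ z in Metric.ball (0 : ℂ) 1, G z := by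
  have mp := Complex.volume_preserving_equiv_real_prod.symm
  set H := (Metric.ball (0 : ℂ) 1).indicator G with hH
  have hHm : Measurable H := hG.indicator Metric.isOpen_ball.measurableSet
  have hz : ∀ s y : ℝ, Complex.measurableEquivRealProd.symm (s, y) = (s : ℂ) + Complex.I * y := by
    intro s y
    rw [Complex.measurableEquivRealProd_symm_apply]
    apply Complex.ext <;> simp
  rw [← lintegral_indicator Metric.isOpen_ball.measurableSet, ← hH,
    ← mp.lintegral_comp hHm, Measure.volume_eq_prod,
    lintegral_prod_symm' (fun p => H (Complex.measurableEquivRealProd.symm p))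
      (hHm.comp Complex.measurableEquivRealProd.symm.measurable)]
  simp only [hz]
  have h1 : ∫⁻ y : ℝ, ∫⁻ s : ℝ, H ((s : ℂ) + Complex.I * y) =
      ∫⁻ y in Set.Ioo (-1 : ℝ) 1, ∫⁻ s : ℝ, H ((s : ℂ) + Complex.I * y) := by
    rw [← lintegral_indicator measurableSet_Ioo]
    congr 1
    funext y
    by_cases hy : y ∈ Set.Ioo (-1 : ℝ) 1
    · rw [Set.indicator_of_mem hy]
    · rw [Set.indicator_of_notMem hy]
      refine lintegral_eq_zero_of_ae_eq_zero (Filter.Eventually.of_forall fun s => ?_)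
      refine Set.indicator_of_notMem (fun h => hy ?_) _
      rw [ball_fiber] at h
      have : |y| < 1 := by
        rw [← sq_lt_one_iff_abs_lt_one]
        nlinarith [sq_nonneg s]
      exact abs_lt.1 this
  -- The heights of the chords are substituted as y = sin a; the Jacobian cos a is the factor μ in
  -- Santaló's formula.
  rw [h1, ← sin_image_Ioo, lintegral_image_eq_lintegral_abs_deriv_mul measurableSet_Ioo
    (fun x _ => (Real.hasDerivAt_sin x).hasDerivWithinAt)
    (Real.injOn_sin.mono Set.Ioo_subset_Icc_self), setLIntegral_congr Ioo_ae_eq_Icc.symm]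
  refine setLIntegral_congr_fun measurableSet_Ioo fun a ha => ?_
  have hc := Real.cos_pos_of_mem_Ioo ha
  rw [abs_of_pos hc, chordLIntegral,
    ← lintegral_sub_right_eq_self (fun s : ℝ => H ((s : ℂ) + Complex.I * (Real.sin a : ℝ)))
      (Real.cos a), ← lintegral_indicator measurableSet_Ioo]
  congr 1
  refine lintegral_congr fun t => ?_
  have hiff : (((t - Real.cos a : ℝ) : ℂ) + Complex.I * (Real.sin a : ℝ)) ∈
      Metric.ball (0 : ℂ) 1 ↔ t ∈ Set.Ioo 0 (2 * Real.cos a) := by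
    rw [ball_fiber, Set.mem_Ioo]
    have := Real.sin_sq_add_cos_sq a
    constructor
    · intro h
      constructor <;> nlinarith
    · rintro ⟨h1, h2⟩
      nlinarith
  by_cases ht : t ∈ Set.Ioo 0 (2 * Real.cos a)
  · rw [Set.indicator_of_mem ht, hH, Set.indicator_of_mem (hiff.2 ht), one_mul]
  · rw [Set.indicator_of_notMem ht, hH, Set.indicator_of_notMem (fun h => ht (hiff.1 h))]

theorem lintegral_chords {G : ℂ → ENNReal} (hG : Measurable G) {ω : ℂ} (hω : ‖ω‖ = 1) :
    ∫⁻ a in Set.Icc (-(Real.pi / 2)) (Real.pi / 2),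
      ENNReal.ofReal (Real.cos a) * chordLIntegral G (a, ω) =
    ∫⁻ z in Metric.ball (0 : ℂ) 1, G z := by
  have hGm : Measurable fun z => G (ω * z) := hG.comp (by fun_prop)
  have h := lintegral_chords_one hGm
  have h2 : ∀ a, chordLIntegral (fun z => G (ω * z)) (a, 1) = chordLIntegral G (a, ω) := by
    intro a
    simp only [chordLIntegral, one_mul]
  simp only [h2] at h
  rw [h, ← lintegral_indicator Metric.isOpen_ball.measurableSet,
    ← lintegral_indicator Metric.isOpen_ball.measurableSet,
    ← (measurePreserving_mul_left hω).lintegral_comp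
      (hG.indicator Metric.isOpen_ball.measurableSet)]
  refine lintegral_congr fun z => ?_
  simp only [Set.indicator, Metric.mem_ball, dist_zero_right, norm_mul, hω, one_mul]

/-- A shifted period is again a fundamental domain for translation by 2π. -/
theorem lintegral_Ico_comp_add {f : ℝ → ENNReal} (hf : Function.Periodic f (2 * Real.pi))
    (c : ℝ) :
    ∫⁻ b in Set.Ico 0 (2 * Real.pi), f (b + c) = ∫⁻ b in Set.Ico 0 (2 * Real.pi), f b := by
  have h2π : 0 < 2 * Real.pi := by positivity
  have e1 : ∫⁻ b in Set.Ico 0 (2 * Real.pi), f (b + c) =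
      ∫⁻ b in Set.Ico c (c + 2 * Real.pi), f b := by
    rw [← lintegral_indicator measurableSet_Ico, ← lintegral_indicator measurableSet_Ico,
      ← lintegral_add_right_eq_self ((Set.Ico c (c + 2 * Real.pi)).indicator f) c]
    refine lintegral_congr fun b => ?_
    have : b ∈ Set.Ico 0 (2 * Real.pi) ↔ b + c ∈ Set.Ico c (c + 2 * Real.pi) := by
      simp only [Set.mem_Ico]
      constructor <;> rintro ⟨h, h'⟩ <;> constructor <;> linarith
    by_cases hb : b ∈ Set.Ico 0 (2 * Real.pi)
    · rw [Set.indicator_of_mem hb, Set.indicator_of_mem (this.1 hb)]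
    · rw [Set.indicator_of_notMem hb, Set.indicator_of_notMem (fun h => hb (this.2 h))]
  rw [e1, setLIntegral_congr Ico_ae_eq_Ioc, setLIntegral_congr (Ico_ae_eq_Ioc (a := (0 : ℝ)))]
  have h0 := isAddFundamentalDomain_Ioc h2π 0
  rw [zero_add] at h0
  have : VAddInvariantMeasure (AddSubgroup.zmultiples (2 * Real.pi)) ℝ volume :=
    ⟨fun c s _ => measure_preimage_add _ _ _⟩
  exact (isAddFundamentalDomain_Ioc h2π c).setLIntegral_eq h0 f hf.map_vadd_zmultiples

theorem measurable_geoDir : Measurable geoDir := continuous_geoDir.measurable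

/-- Santaló's formula for the unit disk. -/
theorem lintegral_inward {G : ℂ → ENNReal} (hG : Measurable G) :
    ∫⁻ q in inward, ENNReal.ofReal (Real.cos q.2) *
      ∫⁻ t in Set.Ioo 0 (2 * Real.cos q.2), G (geoPoint q t) =
    ENNReal.ofReal (2 * Real.pi) * ∫⁻ z in Metric.ball (0 : ℂ) 1, G z := by
  simp only [← chordLIntegral_geoDir]
  have hK := measurable_chordLIntegral hG
  have hm : Measurable fun q : ℝ × ℝ =>
      ENNReal.ofReal (Real.cos q.2) * chordLIntegral G (q.2, geoDir q) :=
    (by fun_prop : Measurable fun q : ℝ × ℝ => ENNReal.ofReal (Real.cos q.2)).mul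
      (hK.comp (measurable_snd.prodMk measurable_geoDir))
  have hm2 : Measurable fun q : ℝ × ℝ => ENNReal.ofReal (Real.cos q.1) *
      chordLIntegral G (q.1, Complex.exp ((q.2 : ℂ) * Complex.I)) :=
    (by fun_prop : Measurable fun q : ℝ × ℝ => ENNReal.ofReal (Real.cos q.1)).mul
      (hK.comp (measurable_fst.prodMk (by fun_prop)))
  rw [inward, Measure.volume_eq_prod, ← Measure.prod_restrict, lintegral_prod_symm' _ hm]
  -- For fixed α the map β ↦ θ is a translation of the circle, so θ may replace β; for fixed θ the
  -- α-integral then sweeps the disk by parallel chords.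
  have h1 : ∀ a : ℝ, ∫⁻ b in Set.Ico 0 (2 * Real.pi), ENNReal.ofReal (Real.cos a) *
      chordLIntegral G (a, geoDir (b, a)) = ∫⁻ b in Set.Ico 0 (2 * Real.pi),
        ENNReal.ofReal (Real.cos a) *
          chordLIntegral G (a, Complex.exp ((b : ℂ) * Complex.I)) := by
    intro a
    rw [← lintegral_Ico_comp_add (f := fun b => ENNReal.ofReal (Real.cos a) *
      chordLIntegral G (a, Complex.exp ((b : ℂ) * Complex.I))) (c := a + Real.pi)]
    · refine lintegral_congr fun b => ?_
      simp only [geoDir, geoAngle, add_assoc]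
    · intro b
      have : Complex.exp (((b + 2 * Real.pi : ℝ) : ℂ) * Complex.I) =
          Complex.exp ((b : ℂ) * Complex.I) := by
        push_cast
        rw [add_mul, Complex.exp_periodic]
      simp only [this]
  simp only [h1]
  rw [lintegral_lintegral_swap hm2.aemeasurable]
  have h2 : ∀ b : ℝ, ∫⁻ a in Set.Icc (-(Real.pi / 2)) (Real.pi / 2),
      ENNReal.ofReal (Real.cos a) * chordLIntegral G (a, Complex.exp ((b : ℂ) * Complex.I)) =
      ∫⁻ z in Metric.ball (0 : ℂ) 1, G z :=
    fun b => lintegral_chords hG (Complex.norm_exp_ofReal_mul_I b)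
  simp only [h2]
  rw [lintegral_const, Measure.restrict_apply_univ, Real.volume_Ico, sub_zero, mul_comm]

/-! ### Null sets on the inward boundary -/

theorem measurableSet_inward : MeasurableSet inward := measurableSet_Ico.prod measurableSet_Icc

theorem measurable_cos_rpow (s : ℝ) : Measurable fun q : ℝ × ℝ => Real.cos q.2 ^ s :=
  (Real.continuous_cos.comp continuous_snd).measurable.pow_const _

theorem ae_inwardMeasure_of_ae {γ : ℝ} {P : ℝ × ℝ → Prop}
    (h : ∀ᵐ q ∂(volume.restrict inward), P q) : ∀ᵐ q ∂inwardMeasure γ, P q :=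
  (withDensity_absolutelyContinuous _ _).ae_le h

theorem ae_cos_pos : ∀ᵐ q ∂(volume.restrict inward), 0 < Real.cos q.2 := by
  rw [ae_restrict_iff' measurableSet_inward]
  have h : ∀ᵐ q : ℝ × ℝ, q.2 ≠ -(Real.pi / 2) ∧ q.2 ≠ Real.pi / 2 := by
    rw [Measure.volume_eq_prod]
    have h0 : ∀ c : ℝ, ∀ᵐ q ∂((volume : Measure ℝ).prod (volume : Measure ℝ)), q.2 ≠ c :=
      fun c => Measure.quasiMeasurePreserving_snd.ae (Measure.ae_ne volume c)
    exact (h0 _).and (h0 _)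
  filter_upwards [h] with q hq hmem
  exact Real.cos_pos_of_mem_Ioo
    ⟨lt_of_le_of_ne hmem.2.1 (Ne.symm hq.1), lt_of_le_of_ne hmem.2.2 hq.2⟩

/-- Santaló's formula is applied to the indicator of a measurable null set containing the
exceptional points. As a result the transform does not depend on the representative of an L² class.
-/
theorem ae_geoPoint_of_ae_diskMeasure {γ : ℝ} {P : ℂ → Prop} (h : ∀ᵐ z ∂diskMeasure γ, P z) :
    ∀ᵐ q ∂inwardMeasure γ, ∀ᵐ t ∂(volume.restrict (Set.Ioo 0 (2 * Real.cos q.2))),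
      P (geoPoint q t) := by
  refine ae_inwardMeasure_of_ae ?_
  rw [ae_diskMeasure_iff, ae_iff] at h
  set S := toMeasurable volume {z : ℂ | ¬(z ∈ Metric.ball (0 : ℂ) 1 → P z)} with hS
  have hS0 : volume S = 0 := by rw [hS, measure_toMeasurable, h]
  have hSm : MeasurableSet S := measurableSet_toMeasurable _ _
  have hG : Measurable (S.indicator (1 : ℂ → ENNReal)) := measurable_one.indicator hSm
  have hs := lintegral_inward hG
  have hz : ∫⁻ z in Metric.ball (0 : ℂ) 1, S.indicator (1 : ℂ → ENNReal) z = 0 := by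
    refine lintegral_eq_zero_of_ae_eq_zero (ae_restrict_of_ae ?_)
    filter_upwards [measure_eq_zero_iff_ae_notMem.1 hS0] with z hzS
    exact Set.indicator_of_notMem hzS _
  rw [hz, mul_zero, lintegral_eq_zero_iff] at hs
  · filter_upwards [hs, ae_cos_pos] with q hq hc
    have h1 : ∫⁻ t in Set.Ioo 0 (2 * Real.cos q.2),
        S.indicator (1 : ℂ → ENNReal) (geoPoint q t) = 0 := by
      rcases mul_eq_zero.1 hq with h | h
      · exact absurd h (ENNReal.ofReal_pos.2 hc).ne'
      · exact h
    have hcont : Measurable (geoPoint q) := by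
      unfold geoPoint
      fun_prop
    have hGc : Measurable fun t => S.indicator (1 : ℂ → ENNReal) (geoPoint q t) := hG.comp hcont
    rw [lintegral_eq_zero_iff hGc] at h1
    filter_upwards [h1, ae_restrict_mem measurableSet_Ioo] with t ht htm
    by_contra hP
    have hmem : geoPoint q t ∈ S := subset_toMeasurable _ _ fun hh => hP (hh (geoPoint_mem_ball htm))
    rw [Set.indicator_of_mem hmem] at ht
    exact one_ne_zero ht
  · simp only [← chordLIntegral_geoDir]
    exact (by fun_prop : Measurable fun q : ℝ × ℝ => ENNReal.ofReal (Real.cos q.2)).mul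
      ((measurable_chordLIntegral hG).comp (measurable_snd.prodMk measurable_geoDir))

/-! ### The weighted X-ray transform of functions -/

theorem intervalIntegrable_sq_sub_sq_rpow {γ : ℝ} (hγ : -1 < γ) {μ : ℝ} (hμ : 0 < μ) :
    IntervalIntegrable (fun s : ℝ => (μ ^ 2 - s ^ 2) ^ γ) volume (-μ) μ := by
  have h := ((intervalIntegrable_one_sub_sq_rpow hγ).comp_mul_left (c := μ⁻¹)).const_mul
    (μ ^ (2 * γ))
  rw [div_inv_eq_mul, div_inv_eq_mul, neg_mul, one_mul] at h
  refine h.congr ?_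
  intro s hs
  rw [Set.uIoc_of_le (by linarith)] at hs
  have h1 : 0 ≤ 1 - (μ⁻¹ * s) ^ 2 := by
    have : (μ⁻¹ * s) ^ 2 = s ^ 2 / μ ^ 2 := by
      field_simp
    rw [this, sub_nonneg, div_le_one (by positivity)]
    nlinarith [hs.1, hs.2]
  have h2 : μ ^ (2 * γ) = (μ ^ 2) ^ γ := by
    rw [← Real.rpow_natCast, ← Real.rpow_mul hμ.le]
    norm_num
  simp only
  rw [h2, ← Real.mul_rpow (by positivity) h1]
  congr 1
  field_simp

theorem intervalIntegrable_bdf_geoPoint {γ : ℝ} (hγ : -1 < γ) {q : ℝ × ℝ}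
    (hq : 0 < Real.cos q.2) :
    IntervalIntegrable (fun t => bdf (geoPoint q t) ^ γ) volume 0 (2 * Real.cos q.2) := by
  have h := (intervalIntegrable_sq_sub_sq_rpow hγ hq).comp_sub_right (Real.cos q.2)
  rw [neg_add_cancel, ← two_mul] at h
  simpa only [bdf_geoPoint] using h

/-- The X-ray transform of `z^n`. -/
theorem integral_geoPoint_pow {γ : ℝ} (hγ : -1 < γ) {q : ℝ × ℝ} (hq : 0 < Real.cos q.2) (n : ℕ) :
    ∫ t in (0 : ℝ)..(2 * Real.cos q.2),
      geoPoint q t ^ n * (((bdf (geoPoint q t) ^ γ : ℝ)) : ℂ) =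
    geoDir q ^ n * ((Real.cos q.2 ^ (2 * γ + 1) : ℝ) : ℂ) * (Complex.I ^ n *
      ((momentFactor γ n * gegenbauer (γ + 1) n (Real.sin q.2) : ℝ) : ℂ)) := by
  have h1 := integral_pow_mul_weight (γ := γ) hq (Real.sin_sq_add_cos_sq q.2) n
  rw [lineMoment_eq_gegenbauer hγ (Real.sin_sq_le_one _)] at h1
  rw [mul_assoc (geoDir q ^ n), ← h1, ← intervalIntegral.integral_const_mul]
  have h2 := intervalIntegral.integral_comp_sub_right (a := 0) (b := 2 * Real.cos q.2)
    (fun s : ℝ => geoDir q ^ n * (((s : ℂ) + Complex.I * (Real.sin q.2 : ℝ)) ^ n *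
      (((Real.cos q.2 ^ 2 - s ^ 2) ^ γ : ℝ) : ℂ))) (Real.cos q.2)
  rw [zero_sub, show 2 * Real.cos q.2 - Real.cos q.2 = Real.cos q.2 by ring] at h2
  rw [← h2]
  congr 1
  funext t
  rw [bdf_geoPoint, geoPoint_eq, mul_pow, mul_assoc]

/-- This is the transform of z^0: the mass of the weight on one geodesic, needed as the constant in
Cauchy–Schwarz. -/
theorem lintegral_bdf_geoPoint {γ : ℝ} (hγ : -1 < γ) {q : ℝ × ℝ} (hq : 0 < Real.cos q.2) :
    ∫⁻ t in Set.Ioo 0 (2 * Real.cos q.2), ENNReal.ofReal (bdf (geoPoint q t) ^ γ) =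
      ENNReal.ofReal (Real.cos q.2 ^ (2 * γ + 1) * momentFactor γ 0) := by
  have h := integral_geoPoint_pow hγ hq 0
  simp only [pow_zero, one_mul, gegenbauer_zero, mul_one] at h
  rw [intervalIntegral.integral_ofReal, ← Complex.ofReal_mul, Complex.ofReal_inj,
    intervalIntegral.integral_of_le (by linarith), integral_Ioc_eq_integral_Ioo] at h
  rw [← h, ofReal_integral_eq_lintegral_ofReal]
  · exact (intervalIntegrable_iff_integrableOn_Ioo_of_le (by linarith)).1
      (intervalIntegrable_bdf_geoPoint hγ hq)
  · rw [Filter.EventuallyLE, ae_restrict_iff' measurableSet_Ioo]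
    exact Filter.Eventually.of_forall fun t ht =>
      Real.rpow_nonneg (bdf_pos (geoPoint_mem_ball ht)).le _

/-- The weighted integral of `G` along the geodesic `q`. -/
def geoLIntegral (γ : ℝ) (G : ℂ → ENNReal) (q : ℝ × ℝ) : ENNReal :=
  ∫⁻ t in Set.Ioo 0 (2 * Real.cos q.2),
    ENNReal.ofReal (bdf (geoPoint q t) ^ γ) * G (geoPoint q t)

theorem measurable_geoPoint (q : ℝ × ℝ) : Measurable (geoPoint q) := by
  unfold geoPoint
  fun_prop

theorem measurable_weighted (γ : ℝ) {G : ℂ → ENNReal} (hG : Measurable G) :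
    Measurable fun z => ENNReal.ofReal (bdf z ^ γ) * G z :=
  (measurable_bdf_rpow γ).ennreal_ofReal.mul hG

theorem measurable_geoLIntegral (γ : ℝ) {G : ℂ → ENNReal} (hG : Measurable G) :
    Measurable (geoLIntegral γ G) := by
  have h : geoLIntegral γ G = fun q =>
      chordLIntegral (fun z => ENNReal.ofReal (bdf z ^ γ) * G z) (q.2, geoDir q) := by
    funext q
    rw [chordLIntegral_geoDir]
    rfl
  rw [h]
  exact (measurable_chordLIntegral (measurable_weighted γ hG)).comp
    (measurable_snd.prodMk measurable_geoDir)

theorem geoLIntegral_sq_le {γ : ℝ} (hγ : -1 < γ) {G : ℂ → ENNReal} (hG : Measurable G)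
    {q : ℝ × ℝ} (hq : 0 < Real.cos q.2) :
    geoLIntegral γ G q ^ 2 ≤ ENNReal.ofReal (Real.cos q.2 ^ (2 * γ + 1) * momentFactor γ 0) *
      geoLIntegral γ (fun z => G z ^ 2) q := by
  set ν : Measure ℝ := (volume.restrict (Set.Ioo 0 (2 * Real.cos q.2))).withDensity
    (fun t => ENNReal.ofReal (bdf (geoPoint q t) ^ γ)) with hν
  have hd : Measurable fun t => ENNReal.ofReal (bdf (geoPoint q t) ^ γ) :=
    (measurable_bdf_rpow γ).ennreal_ofReal.comp (measurable_geoPoint q)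
  have hint : ∀ g : ℝ → ENNReal, ∫⁻ t, g t ∂ν =
      ∫⁻ t in Set.Ioo 0 (2 * Real.cos q.2), ENNReal.ofReal (bdf (geoPoint q t) ^ γ) * g t := by
    intro g
    rw [hν, lintegral_withDensity_eq_lintegral_mul_non_measurable _ hd
      (Filter.Eventually.of_forall fun _ => ENNReal.ofReal_lt_top)]
    rfl
  have h := ENNReal.lintegral_mul_le_Lp_mul_Lq ν Real.HolderConjugate.two_two
    (f := fun t => G (geoPoint q t)) (g := fun _ => 1)
    (hG.comp (measurable_geoPoint q)).aemeasurable aemeasurable_const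
  simp only [Pi.mul_apply, mul_one, ENNReal.rpow_two, one_pow] at h
  rw [hint, hint, hint] at h
  simp only [mul_one] at h
  rw [lintegral_bdf_geoPoint hγ hq] at h
  have h2 := pow_le_pow_left' h 2
  rw [mul_pow, ← ENNReal.rpow_mul_natCast, ← ENNReal.rpow_mul_natCast] at h2
  norm_num at h2
  rw [mul_comm]
  exact h2

/-- Cauchy–Schwarz on each geodesic costs μ^{2γ+1}; with the boundary weight μ^{−2γ} this leaves
exactly the factor μ that Santaló's formula requires. -/
theorem lintegral_geoLIntegral_sq_le {γ : ℝ} (hγ : -1 < γ) {G : ℂ → ENNReal} (hG : Measurable G) :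
    ∫⁻ q, geoLIntegral γ G q ^ 2 ∂inwardMeasure γ ≤
      ENNReal.ofReal (momentFactor γ 0 * (2 * Real.pi)) * ∫⁻ z, G z ^ 2 ∂diskMeasure γ := by
  have hκ := (momentFactor_pos hγ 0).le
  rw [inwardMeasure, lintegral_withDensity_eq_lintegral_mul_non_measurable _
    (measurable_cos_rpow _).ennreal_ofReal
    (Filter.Eventually.of_forall fun _ => ENNReal.ofReal_lt_top), lintegral_diskMeasure,
    ENNReal.ofReal_mul hκ, mul_assoc, ← lintegral_inward (measurable_weighted γ (hG.pow_const 2)),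
    ← lintegral_const_mul' _ _ ENNReal.ofReal_ne_top]
  refine lintegral_mono_ae ?_
  filter_upwards [ae_cos_pos] with q hq
  simp only [Pi.mul_apply]
  calc _ ≤ ENNReal.ofReal (Real.cos q.2 ^ (-2 * γ)) *
        (ENNReal.ofReal (Real.cos q.2 ^ (2 * γ + 1) * momentFactor γ 0) *
          geoLIntegral γ (fun z => G z ^ 2) q) := by
        gcongr
        exact geoLIntegral_sq_le hγ hG hq
    _ = _ := by
        rw [← mul_assoc, ← ENNReal.ofReal_mul (Real.rpow_nonneg hq.le _), ← mul_assoc,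
          ← Real.rpow_add hq, show -2 * γ + (2 * γ + 1) = 1 by ring, Real.rpow_one,
          mul_comm (Real.cos q.2), ENNReal.ofReal_mul hκ, mul_assoc]
        rfl

/-! ### The scalar transform as a relation, and its closed graph -/

/-- `u` is, up to the factor `ω`, the weighted X-ray transform of the function `f`. -/
def IsLineTransform (γ : ℝ) (ω : ℝ × ℝ → ℂ) (f : ℂ → ℂ) (u : ℝ × ℝ → ℂ) : Prop :=
  ∀ᵐ q ∂inwardMeasure γ,
    IntervalIntegrable (fun t => f (geoPoint q t) * ((bdf (geoPoint q t) ^ γ : ℝ) : ℂ))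
      volume 0 (2 * Real.cos q.2) ∧
    u q = ω q * ∫ t in (0 : ℝ)..(2 * Real.cos q.2),
      f (geoPoint q t) * ((bdf (geoPoint q t) ^ γ : ℝ) : ℂ)

theorem IsLineTransform.congr {γ : ℝ} {ω : ℝ × ℝ → ℂ} {f f' : ℂ → ℂ} {u u' : ℝ × ℝ → ℂ}
    (h : IsLineTransform γ ω f u) (hf : f =ᵐ[diskMeasure γ] f')
    (hu : u =ᵐ[inwardMeasure γ] u') : IsLineTransform γ ω f' u' := by
  filter_upwards [h, hu, ae_geoPoint_of_ae_diskMeasure hf, ae_inwardMeasure_of_ae ae_cos_pos]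
    with q hq huq hfq hc
  have hle : (0 : ℝ) ≤ 2 * Real.cos q.2 := by linarith
  have hae : (fun t => f (geoPoint q t) * ((bdf (geoPoint q t) ^ γ : ℝ) : ℂ))
      =ᵐ[volume.restrict (Set.Ioc 0 (2 * Real.cos q.2))]
      (fun t => f' (geoPoint q t) * ((bdf (geoPoint q t) ^ γ : ℝ) : ℂ)) := by
    rw [Measure.restrict_congr_set Ioo_ae_eq_Ioc.symm]
    filter_upwards [hfq] with t ht
    rw [ht]
  rw [intervalIntegrable_iff_integrableOn_Ioc_of_le hle,
    intervalIntegral.integral_of_le hle] at hq ⊢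
  rw [← integral_congr_ae hae, ← huq]
  exact ⟨hq.1.congr hae, hq.2⟩

theorem IsLineTransform.add {γ : ℝ} {ω : ℝ × ℝ → ℂ} {f g : ℂ → ℂ} {u v : ℝ × ℝ → ℂ}
    (h : IsLineTransform γ ω f u) (h' : IsLineTransform γ ω g v) :
    IsLineTransform γ ω (f + g) (u + v) := by
  filter_upwards [h, h'] with q hq hq'
  simp only [Pi.add_apply, add_mul]
  refine ⟨hq.1.add hq'.1, ?_⟩
  rw [intervalIntegral.integral_add hq.1 hq'.1, mul_add, hq.2, hq'.2]

theorem IsLineTransform.const_smul {γ : ℝ} {ω : ℝ × ℝ → ℂ} {f : ℂ → ℂ} {u : ℝ × ℝ → ℂ}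
    (h : IsLineTransform γ ω f u) (c : ℂ) : IsLineTransform γ ω (c • f) (c • u) := by
  filter_upwards [h] with q hq
  simp only [Pi.smul_apply, smul_eq_mul, mul_assoc]
  refine ⟨hq.1.const_mul c, ?_⟩
  rw [intervalIntegral.integral_const_mul, hq.2]
  ring

theorem IsLineTransform.zero (γ : ℝ) (ω : ℝ × ℝ → ℂ) : IsLineTransform γ ω 0 0 :=
  Filter.Eventually.of_forall fun q => by simp

theorem IsLineTransform.sum {γ : ℝ} {ω : ℝ × ℝ → ℂ} {f : ℕ → Lp ℂ 2 (diskMeasure γ)}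
    {u : ℕ → L2Inward γ} (h : ∀ n, IsLineTransform γ ω (f n) (u n)) (s : Finset ℕ) :
    IsLineTransform γ ω (∑ n ∈ s, f n : Lp ℂ 2 (diskMeasure γ)) (∑ n ∈ s, u n : L2Inward γ) := by
  induction s using Finset.cons_induction with
  | empty =>
    simp only [Finset.sum_empty]
    exact (IsLineTransform.zero γ ω).congr (Lp.coeFn_zero _ _ _).symm (Lp.coeFn_zero _ _ _).symm
  | cons a s ha ih =>
    simp only [Finset.sum_cons]
    exact ((h a).add ih).congr (Lp.coeFn_add _ _).symm (Lp.coeFn_add _ _).symm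

theorem ofReal_bdf_mul_enorm {γ : ℝ} {q : ℝ × ℝ} {t : ℝ}
    (ht : t ∈ Set.Ioo 0 (2 * Real.cos q.2)) (w : ℂ) :
    ‖w * ((bdf (geoPoint q t) ^ γ : ℝ) : ℂ)‖ₑ =
      ENNReal.ofReal (bdf (geoPoint q t) ^ γ) * ‖w‖ₑ := by
  have h0 := Real.rpow_nonneg (bdf_pos (geoPoint_mem_ball ht)).le γ
  rw [enorm_mul, mul_comm]
  congr 1
  rw [← ofReal_norm, Complex.norm_real, Real.norm_of_nonneg h0]

/-- Every `L²_γ` function is integrable on almost every geodesic. -/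
theorem ae_intervalIntegrable_geoPoint {γ : ℝ} (hγ : -1 < γ) (f : Lp ℂ 2 (diskMeasure γ)) :
    ∀ᵐ q ∂inwardMeasure γ,
      IntervalIntegrable (fun t => f (geoPoint q t) * ((bdf (geoPoint q t) ^ γ : ℝ) : ℂ))
        volume 0 (2 * Real.cos q.2) := by
  have hfm : Measurable (f : ℂ → ℂ) := (Lp.stronglyMeasurable f).measurable
  have hb := lintegral_geoLIntegral_sq_le hγ hfm.enorm
  have hfin : ∫⁻ z, ‖f z‖ₑ ^ 2 ∂diskMeasure γ < ⊤ := by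
    have := (Lp.memLp f).2
    rw [eLpNorm_lt_top_iff_lintegral_rpow_enorm_lt_top two_ne_zero ENNReal.ofNat_ne_top] at this
    simpa using this
  have hfin2 := hb.trans_lt (ENNReal.mul_lt_top ENNReal.ofReal_lt_top hfin)
  have hae := ae_lt_top' ((measurable_geoLIntegral γ hfm.enorm).pow_const 2).aemeasurable hfin2.ne
  filter_upwards [hae, ae_inwardMeasure_of_ae ae_cos_pos] with q hq hc
  rw [intervalIntegrable_iff_integrableOn_Ioo_of_le (by linarith)]
  refine ⟨?_, ?_⟩
  · refine Measurable.aestronglyMeasurable ?_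
    exact (hfm.comp (measurable_geoPoint q)).mul
      (Complex.measurable_ofReal.comp ((measurable_bdf_rpow γ).comp (measurable_geoPoint q)))
  · rw [hasFiniteIntegral_iff_enorm, setLIntegral_congr_fun measurableSet_Ioo
      (fun t ht => ofReal_bdf_mul_enorm ht _)]
    exact (ENNReal.pow_lt_top_iff.1 hq).resolve_right two_ne_zero

open Filter Topology in
/-- The graph of the weighted X-ray transform is closed. -/
theorem IsLineTransform.of_tendsto {γ : ℝ} (hγ : -1 < γ) {ω : ℝ × ℝ → ℂ} (hω : ∀ q, ‖ω q‖ = 1)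
    {ι : Type*} {l : Filter ι} [l.NeBot] [l.IsCountablyGenerated]
    {f : ι → Lp ℂ 2 (diskMeasure γ)} {u : ι → L2Inward γ} {f₀ : Lp ℂ 2 (diskMeasure γ)}
    {u₀ : L2Inward γ} (h : ∀ n, IsLineTransform γ ω (f n) (u n))
    (hf : Tendsto f l (𝓝 f₀)) (hu : Tendsto u l (𝓝 u₀)) : IsLineTransform γ ω f₀ u₀ := by
  -- A sequence suffices, and it keeps the almost everywhere statements countable in number; for a
  -- `HasSum` the filter lives on finite sets.
  obtain ⟨x, hx⟩ := exists_seq_tendsto l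
  have hfm : ∀ g : Lp ℂ 2 (diskMeasure γ), Measurable (g : ℂ → ℂ) :=
    fun g => (Lp.stronglyMeasurable g).measurable
  have hum : ∀ g : L2Inward γ, Measurable (g : ℝ × ℝ → ℂ) :=
    fun g => (Lp.stronglyMeasurable g).measurable
  let A : ℕ → ℂ → ENNReal := fun n z => ‖f₀ z - f (x n) z‖ₑ
  let B : ℕ → ℝ × ℝ → ENNReal := fun n q => ‖u₀ q - u (x n) q‖ₑ
  have hA : ∀ n, Measurable (A n) := fun n => ((hfm f₀).sub (hfm _)).enorm
  have hB : ∀ n, Measurable (B n) := fun n => ((hum u₀).sub (hum _)).enorm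
  -- For almost every q, each `E n q` bounds the error in the identity to be proved for the limit,
  -- whatever n is.
  let E : ℕ → ℝ × ℝ → ENNReal := fun n q => B n q + geoLIntegral γ (A n) q
  have hE : ∀ n, Measurable (E n) := fun n => (hB n).add (measurable_geoLIntegral γ (hA n))
  have key : ∀ {α : Type} [MeasurableSpace α] (ν : Measure α) (g : ℕ → Lp ℂ 2 ν) (g₀ : Lp ℂ 2 ν),
      Tendsto g atTop (𝓝 g₀) →
      Tendsto (fun n => ∫⁻ a, ‖g₀ a - g n a‖ₑ ^ 2 ∂ν) atTop (𝓝 0) := by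
    intro α _ ν g g₀ hg
    have h1 : ∀ n, ∫⁻ a, ‖g₀ a - g n a‖ₑ ^ 2 ∂ν = edist g₀ (g n) ^ 2 := fun n => by
      rw [Lp.edist_def, eLpNorm_eq_lintegral_rpow_enorm_toReal two_ne_zero ENNReal.ofNat_ne_top,
        ← ENNReal.rpow_mul_natCast]
      norm_num
    simp only [h1]
    have h2 : Tendsto (fun n => edist g₀ (g n)) atTop (𝓝 0) := by
      simpa only [edist_comm] using tendsto_iff_edist_tendsto_0.1 hg
    simpa using ENNReal.Tendsto.pow (n := 2) h2
  have hEint : Tendsto (fun n => ∫⁻ q, E n q ^ 2 ∂inwardMeasure γ) atTop (𝓝 0) := by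
    have hlim := (ENNReal.Tendsto.const_mul (key _ _ _ (hu.comp hx)) (a := 4)
      (Or.inr (by norm_num))).add (ENNReal.Tendsto.const_mul (key _ _ _ (hf.comp hx))
        (a := 4 * ENNReal.ofReal (momentFactor γ 0 * (2 * Real.pi)))
        (Or.inr (ENNReal.mul_ne_top (by norm_num) ENNReal.ofReal_ne_top)))
    simp only [mul_zero, add_zero] at hlim
    refine tendsto_of_tendsto_of_tendsto_of_le_of_le tendsto_const_nhds hlim
      (fun _ => zero_le) fun n => ?_
    have hsq : ∀ a b : ENNReal, (a + b) ^ 2 ≤ 4 * a ^ 2 + 4 * b ^ 2 := by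
      intro a b
      rcases le_total a b with hab | hab
      · calc (a + b) ^ 2 ≤ (b + b) ^ 2 := by gcongr
          _ = 4 * b ^ 2 := by ring
          _ ≤ _ := le_add_self
      · calc (a + b) ^ 2 ≤ (a + a) ^ 2 := by gcongr
          _ = 4 * a ^ 2 := by ring
          _ ≤ _ := le_self_add
    calc ∫⁻ q, E n q ^ 2 ∂inwardMeasure γ
        ≤ ∫⁻ q, 4 * B n q ^ 2 + 4 * geoLIntegral γ (A n) q ^ 2 ∂inwardMeasure γ :=
          lintegral_mono fun q => hsq _ _
      _ = 4 * ∫⁻ q, B n q ^ 2 ∂inwardMeasure γ +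
          4 * ∫⁻ q, geoLIntegral γ (A n) q ^ 2 ∂inwardMeasure γ := by
          rw [lintegral_add_left (((hB n).pow_const 2).const_mul 4),
            lintegral_const_mul _ ((hB n).pow_const 2),
            lintegral_const_mul _ ((measurable_geoLIntegral γ (hA n)).pow_const 2)]
      _ ≤ _ := by
          rw [mul_assoc]
          gcongr
          · exact le_rfl
          · exact lintegral_geoLIntegral_sq_le hγ (hA n)
  -- Taking the infimum of these bounds avoids extracting a pointwise convergent subsequence.
  have hinf : ∫⁻ q, (⨅ n, E n q) ^ 2 ∂inwardMeasure γ = 0 := by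
    refine le_antisymm (ge_of_tendsto' hEint fun n => lintegral_mono fun q => ?_) zero_le
    gcongr
    exact iInf_le _ n
  rw [lintegral_eq_zero_iff ((Measurable.iInf hE).pow_const 2)] at hinf
  filter_upwards [hinf, ae_all_iff.2 fun n => h (x n), ae_intervalIntegrable_geoPoint hγ f₀,
    ae_inwardMeasure_of_ae ae_cos_pos] with q hq hn hi hc
  refine ⟨hi, ?_⟩
  have hle : (0 : ℝ) ≤ 2 * Real.cos q.2 := by linarith
  rw [← sub_eq_zero, ← enorm_eq_zero]
  have hq0 : (⨅ n, E n q) = 0 := by simpa using hq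
  refine le_antisymm (hq0 ▸ le_iInf fun n => ?_) zero_le
  obtain ⟨hni, hnu⟩ := hn n
  set I₀ := ∫ t in (0 : ℝ)..(2 * Real.cos q.2),
    f₀ (geoPoint q t) * ((bdf (geoPoint q t) ^ γ : ℝ) : ℂ)
  have e1 : u₀ q - ω q * I₀ = (u₀ q - u (x n) q) - ω q * (I₀ -
      ∫ t in (0 : ℝ)..(2 * Real.cos q.2),
        f (x n) (geoPoint q t) * ((bdf (geoPoint q t) ^ γ : ℝ) : ℂ)) := by
    rw [hnu]
    ring
  have hω1 : ‖ω q‖ₑ = 1 := by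
    rw [← ofReal_norm, hω, ENNReal.ofReal_one]
  rw [e1]
  refine (enorm_sub_le).trans ?_
  rw [enorm_mul, hω1, one_mul]
  refine add_le_add le_rfl ?_
  rw [← intervalIntegral.integral_sub hi hni, intervalIntegral.integral_of_le hle,
    integral_Ioc_eq_integral_Ioo]
  refine (enorm_integral_le_lintegral_enorm _).trans (le_of_eq ?_)
  rw [geoLIntegral]
  refine setLIntegral_congr_fun measurableSet_Ioo fun t ht => ?_
  simp only [A]
  rw [← ofReal_bdf_mul_enorm ht, sub_mul]

theorem IsLineTransform.of_hasSum {γ : ℝ} (hγ : -1 < γ) {ω : ℝ × ℝ → ℂ} (hω : ∀ q, ‖ω q‖ = 1)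
    {f : ℕ → Lp ℂ 2 (diskMeasure γ)} {u : ℕ → L2Inward γ} {f₀ : Lp ℂ 2 (diskMeasure γ)}
    {u₀ : L2Inward γ} (h : ∀ n, IsLineTransform γ ω (f n) (u n))
    (hf : HasSum f f₀) (hu : HasSum u u₀) : IsLineTransform γ ω f₀ u₀ :=
  IsLineTransform.of_tendsto hγ hω (IsLineTransform.sum h) hf hu

/-! ### Taylor coefficients of `L²_γ` analytic functions -/

theorem monomialNormSq_eq_integral (γ : ℝ) (n : ℕ) :
    ∫ z, (starRingEnd ℂ) (z ^ n) * z ^ n ∂diskMeasure γ = monomialNormSq γ n := by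
  rw [monomialNormSq, ← integral_complex_ofReal]
  congr 1
  funext z
  rw [Complex.conj_mul', norm_pow]
  push_cast
  ring

theorem setIntegral_ball_conj_pow_mul_pow {γ : ℝ} (R : ℝ) {m n : ℕ} (hmn : m ≠ n) :
    ∫ z in Metric.ball (0 : ℂ) R, (starRingEnd ℂ) (z ^ m) * z ^ n ∂diskMeasure γ = 0 := by
  rw [← integral_indicator Metric.isOpen_ball.measurableSet]
  refine Eq.trans ?_
    (integral_radial_mul_conj_pow_mul_pow (γ := γ) (fun r => if r < R then 1 else 0) hmn)
  congr 1
  funext z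
  simp [Set.indicator]

/-- On a disk of radius R < 1 the power series is dominated by ∑ ‖a k‖ R^k and may be integrated
term by term; orthogonality of the monomials on that disk leaves one term. -/
theorem setIntegral_ball_conj_pow_mul {γ : ℝ} (hγ : -1 < γ) {f : ℂ → ℂ} {a : ℕ → ℂ}
    (hs : ∀ z ∈ Metric.ball (0 : ℂ) 1, HasSum (fun k => a k * z ^ k) (f z)) {R : ℝ} (hR0 : 0 < R)
    (hR : R < 1) (n : ℕ) :
    ∫ z in Metric.ball (0 : ℂ) R, (starRingEnd ℂ) (z ^ n) * f z ∂diskMeasure γ =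
      a n * ∫ z in Metric.ball (0 : ℂ) R, (starRingEnd ℂ) (z ^ n) * z ^ n ∂diskMeasure γ := by
  have := isFiniteMeasure_diskMeasure hγ
  have hball : MeasurableSet (Metric.ball (0 : ℂ) R) := Metric.isOpen_ball.measurableSet
  let F : ℕ → ℂ → ℂ := fun k z => a k * ((starRingEnd ℂ) (z ^ n) * z ^ k)
  have hFc : ∀ k, Continuous (F k) := fun k => by
    have := Complex.continuous_conj
    simp only [F]
    fun_prop
  have hFi : ∀ k, Integrable (F k) ((diskMeasure γ).restrict (Metric.ball 0 R)) := fun k =>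
    (memLp_one_iff_integrable.1 (memLp_of_continuous hγ (hFc k) 1)).integrableOn
  have hsR : Summable fun k => ‖a k‖ * R ^ k := by
    have h := (hs (R : ℂ) (by simpa [abs_of_pos hR0] using hR)).summable.norm
    simpa [abs_of_pos hR0] using h
  have hbound : ∀ k, ∀ z ∈ Metric.ball (0 : ℂ) R, ‖F k z‖ ≤ ‖a k‖ * R ^ k := by
    intro k z hz
    have hz' : ‖z‖ < R := mem_ball_zero_iff.1 hz
    simp only [F]
    rw [norm_mul, norm_mul, RCLike.norm_conj, norm_pow, norm_pow]
    have h1 : ‖z‖ ^ n ≤ 1 := pow_le_one₀ (norm_nonneg _) (by linarith)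
    have h2 : ‖z‖ ^ k ≤ R ^ k := by gcongr
    calc _ ≤ ‖a k‖ * (1 * R ^ k) := by gcongr
      _ = _ := by ring
  have hsum : Summable fun k => ∫ z in Metric.ball (0 : ℂ) R, ‖F k z‖ ∂diskMeasure γ := by
    refine Summable.of_nonneg_of_le (fun k => integral_nonneg fun _ => norm_nonneg _) (fun k => ?_)
      (hsR.mul_right ((diskMeasure γ).real (Metric.ball 0 R)))
    have h := norm_setIntegral_le_of_norm_le_const (μ := diskMeasure γ)
      (f := fun z => ‖F k z‖) (C := ‖a k‖ * R ^ k)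
      (measure_lt_top (diskMeasure γ) (Metric.ball (0 : ℂ) R))
      (fun z hz => by rw [norm_norm]; exact hbound k z hz)
    exact (Real.le_norm_self _).trans h
  have hI := hasSum_integral_of_summable_integral_norm hFi hsum
  have htsum : ∫ z in Metric.ball (0 : ℂ) R, ∑' k, F k z ∂diskMeasure γ =
      ∫ z in Metric.ball (0 : ℂ) R, (starRingEnd ℂ) (z ^ n) * f z ∂diskMeasure γ := by
    refine setIntegral_congr_fun hball fun z hz => ?_
    have h := (hs z (Metric.ball_subset_ball hR.le hz)).mul_left ((starRingEnd ℂ) (z ^ n))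
    rw [← h.tsum_eq]
    refine tsum_congr fun k => ?_
    simp only [F]
    ring
  rw [htsum] at hI
  have hI2 := hasSum_single (f := fun k => ∫ z in Metric.ball (0 : ℂ) R, F k z ∂diskMeasure γ) n
    (fun k hk => by
      simp only [F]
      rw [integral_const_mul, setIntegral_ball_conj_pow_mul_pow R hk.symm, mul_zero])
  rw [hI.unique hI2]
  simp only [F]
  rw [integral_const_mul]

-- Exhaustion by concentric disks. The shift by 2 keeps every radius strictly between 0 and 1, as
-- the termwise integration demands.
open Filter Topology in
theorem tendsto_setIntegral_ball {γ : ℝ} {f : ℂ → ℂ} (hf : Integrable f (diskMeasure γ)) :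
    Tendsto (fun k : ℕ => ∫ z in Metric.ball (0 : ℂ) (1 - 1 / (k + 2)), f z ∂diskMeasure γ) atTop
      (𝓝 (∫ z, f z ∂diskMeasure γ)) := by
  have h := tendsto_setIntegral_of_monotone (μ := diskMeasure γ) (f := f)
    (s := fun k : ℕ => Metric.ball (0 : ℂ) (1 - 1 / (k + 2)))
    (fun k => Metric.isOpen_ball.measurableSet)
    (fun i j hij => Metric.ball_subset_ball (by
      have : (i : ℝ) ≤ j := by exact_mod_cast hij
      gcongr)) hf.integrableOn
  have hU : (⋃ k : ℕ, Metric.ball (0 : ℂ) (1 - 1 / ((k : ℝ) + 2))) = Metric.ball 0 1 := by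
    ext z
    simp only [Set.mem_iUnion, mem_ball_zero_iff]
    constructor
    · rintro ⟨k, hk⟩
      have : (0 : ℝ) < 1 / ((k : ℝ) + 2) := by positivity
      linarith
    · intro hz
      obtain ⟨k, hk⟩ := exists_nat_one_div_lt (sub_pos.2 hz)
      refine ⟨k, ?_⟩
      have : 1 / ((k : ℝ) + 2) ≤ 1 / ((k : ℝ) + 1) := by
        gcongr
        norm_num
      linarith
  rw [hU] at h
  rwa [Measure.restrict_eq_self_of_ae_mem] at h
  rw [ae_diskMeasure_iff]
  exact Eventually.of_forall fun z hz => hz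

open Filter Topology in
theorem integral_conj_pow_mul {γ : ℝ} (hγ : -1 < γ) {f : ℂ → ℂ} {a : ℕ → ℂ}
    (hs : ∀ z ∈ Metric.ball (0 : ℂ) 1, HasSum (fun k => a k * z ^ k) (f z)) (n : ℕ)
    (hint : Integrable (fun z => (starRingEnd ℂ) (z ^ n) * f z) (diskMeasure γ)) :
    ∫ z, (starRingEnd ℂ) (z ^ n) * f z ∂diskMeasure γ = a n * monomialNormSq γ n := by
  have h1 := tendsto_setIntegral_ball hint
  have hint2 : Integrable (fun z : ℂ => (starRingEnd ℂ) (z ^ n) * z ^ n) (diskMeasure γ) := by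
    refine memLp_one_iff_integrable.1 (memLp_of_continuous hγ ?_ 1)
    have := Complex.continuous_conj
    fun_prop
  have h2 := (tendsto_setIntegral_ball hint2).const_mul (a n)
  rw [monomialNormSq_eq_integral] at h2
  refine tendsto_nhds_unique h1 (h2.congr fun k => ?_)
  have hk : (1 : ℝ) / ((k : ℝ) + 2) < 1 := by
    rw [div_lt_one (by positivity)]
    have := k.cast_nonneg (α := ℝ)
    linarith
  have hk0 : (0 : ℝ) < 1 / ((k : ℝ) + 2) := by positivity
  exact (setIntegral_ball_conj_pow_mul hγ hs (by linarith) (by linarith) n).symm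

theorem hasSum_taylor {f : ℂ → ℂ} (hf : DifferentiableOn ℂ f (Metric.ball 0 1)) {z : ℂ}
    (hz : z ∈ Metric.ball (0 : ℂ) 1) :
    HasSum (fun k : ℕ => ((Nat.factorial k : ℂ)⁻¹ * iteratedDeriv k f 0) * z ^ k) (f z) := by
  have h := Complex.hasSum_taylorSeries_on_ball hf hz
  refine h.congr_fun fun k => ?_
  simp only [sub_zero, smul_eq_mul]
  ring

/-- The moment against conj(z^n) is the n-th Taylor coefficient times a positive number, so all
Taylor coefficients vanish. This is completeness of the monomials in the Bergman space. -/
theorem eqOn_zero_of_integral_conj_pow_mul {γ : ℝ} (hγ : -1 < γ) {f : ℂ → ℂ}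
    (hf : DifferentiableOn ℂ f (Metric.ball 0 1))
    (hint : ∀ n : ℕ, Integrable (fun z => (starRingEnd ℂ) (z ^ n) * f z) (diskMeasure γ))
    (h0 : ∀ n : ℕ, ∫ z, (starRingEnd ℂ) (z ^ n) * f z ∂diskMeasure γ = 0) :
    ∀ z ∈ Metric.ball (0 : ℂ) 1, f z = 0 := by
  intro z hz
  have ha : ∀ k : ℕ, (Nat.factorial k : ℂ)⁻¹ * iteratedDeriv k f 0 = 0 := fun k => by
    have h := integral_conj_pow_mul hγ (fun z hz => hasSum_taylor hf hz) k (hint k)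
    rw [h0] at h
    refine (mul_eq_zero.1 h.symm).resolve_right ?_
    exact_mod_cast (monomialNormSq_pos hγ k).ne'
  have h := hasSum_taylor hf hz
  simp only [ha, zero_mul] at h
  exact h.unique hasSum_zero

/-! ### The weighted Bergman space -/

/-- The normalized monomial `z^n / ‖z^n‖`. -/
def normalizedMonomial (γ : ℝ) (n : ℕ) (z : ℂ) : ℂ :=
  (((Real.sqrt (monomialNormSq γ n))⁻¹ : ℝ) : ℂ) * z ^ n

theorem continuous_normalizedMonomial (γ : ℝ) (n : ℕ) : Continuous (normalizedMonomial γ n) := by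
  unfold normalizedMonomial
  fun_prop

/-- The normalized monomials in `L²_γ(𝔻)`. -/
def monomialLp {γ : ℝ} (hγ : -1 < γ) (n : ℕ) : Lp ℂ 2 (diskMeasure γ) :=
  (memLp_of_continuous hγ (continuous_normalizedMonomial γ n) 2).toLp

theorem coeFn_monomialLp {γ : ℝ} (hγ : -1 < γ) (n : ℕ) :
    monomialLp hγ n =ᵐ[diskMeasure γ] normalizedMonomial γ n :=
  MemLp.coeFn_toLp _

theorem inner_monomialLp {γ : ℝ} (hγ : -1 < γ) (n : ℕ) (f : Lp ℂ 2 (diskMeasure γ)) {g : ℂ → ℂ}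
    (hg : f =ᵐ[diskMeasure γ] g) :
    inner ℂ (monomialLp hγ n) f = (((Real.sqrt (monomialNormSq γ n))⁻¹ : ℝ) : ℂ) *
      ∫ z, (starRingEnd ℂ) (z ^ n) * g z ∂diskMeasure γ := by
  rw [L2.inner_def, ← integral_const_mul]
  refine integral_congr_ae ?_
  filter_upwards [coeFn_monomialLp hγ n, hg] with z h1 h2
  rw [h1, h2, normalizedMonomial, RCLike.inner_apply, map_mul, Complex.conj_ofReal]
  ring

theorem orthonormal_monomialLp {γ : ℝ} (hγ : -1 < γ) : Orthonormal ℂ (monomialLp hγ) := by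
  rw [orthonormal_iff_ite]
  intro m n
  rw [inner_monomialLp hγ m _ (coeFn_monomialLp hγ n)]
  have h : ∀ z : ℂ, (starRingEnd ℂ) (z ^ m) * normalizedMonomial γ n z =
      (((Real.sqrt (monomialNormSq γ n))⁻¹ : ℝ) : ℂ) * ((starRingEnd ℂ) (z ^ m) * z ^ n) := by
    intro z
    rw [normalizedMonomial]
    ring
  simp only [h]
  rw [integral_const_mul]
  split_ifs with hmn
  · subst hmn
    have hp := Real.sqrt_pos.2 (monomialNormSq_pos hγ m)
    have hsq := Real.mul_self_sqrt (monomialNormSq_pos hγ m).le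
    rw [monomialNormSq_eq_integral, ← Complex.ofReal_mul, ← Complex.ofReal_mul]
    rw [← Complex.ofReal_one]
    congr 1
    nth_rewrite 3 [← hsq]
    field_simp
  · rw [integral_conj_pow_mul_pow hmn, mul_zero, mul_zero]

-- Ratio test: ‖z^n‖²/‖z^{n+1}‖² = 1 + (γ+1)/(n+1) tends to 1. Bergman expansions with bounded
-- coefficients therefore converge locally uniformly.
open Filter Topology in
theorem summable_normalizedMonomial {γ : ℝ} (hγ : -1 < γ) {r : ℝ} (hr0 : 0 < r) (hr : r < 1) :
    Summable fun n : ℕ => (Real.sqrt (monomialNormSq γ n))⁻¹ * r ^ n := by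
  have hpos : ∀ n, 0 < Real.sqrt (monomialNormSq γ n) :=
    fun n => Real.sqrt_pos.2 (monomialNormSq_pos hγ n)
  refine summable_of_ratio_test_tendsto_lt_one hr
    (Eventually.of_forall fun n => (mul_pos (inv_pos.2 (hpos n)) (pow_pos hr0 n)).ne') ?_
  have h1 : Tendsto (fun n : ℕ => 1 + (γ + 1) * (1 / ((n : ℝ) + 1))) atTop (𝓝 1) := by
    have := ((tendsto_one_div_add_atTop_nhds_zero_nat (𝕜 := ℝ)).const_mul (γ + 1)).const_add 1
    simpa using this
  have h2 := (h1.sqrt).const_mul r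
  rw [Real.sqrt_one, mul_one] at h2
  refine h2.congr fun n => ?_
  have hn : (0 : ℝ) < (n : ℝ) + 1 := by positivity
  have e : 1 + (γ + 1) * (1 / ((n : ℝ) + 1)) = monomialNormSq γ n / monomialNormSq γ (n + 1) := by
    rw [eq_div_iff (monomialNormSq_pos hγ _).ne']
    field_simp
    linarith [monomialNormSq_succ hγ n]
  rw [e, Real.sqrt_div (monomialNormSq_pos hγ n).le,
    Real.norm_of_nonneg (mul_pos (inv_pos.2 (hpos _)) (pow_pos hr0 _)).le,
    Real.norm_of_nonneg (mul_pos (inv_pos.2 (hpos _)) (pow_pos hr0 _)).le]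
  have := hpos n
  have := hpos (n + 1)
  field_simp
  ring

theorem norm_normalizedMonomial (γ : ℝ) (n : ℕ) (z : ℂ) :
    ‖normalizedMonomial γ n z‖ = (Real.sqrt (monomialNormSq γ n))⁻¹ * ‖z‖ ^ n := by
  rw [normalizedMonomial, norm_mul, norm_pow, Complex.norm_real,
    Real.norm_of_nonneg (inv_nonneg.2 (Real.sqrt_nonneg _))]

open Filter Topology in
/-- Square summable combinations of the normalized monomials are analytic. -/
theorem exists_analytic_of_hasSum {γ : ℝ} (hγ : -1 < γ) {b : ℕ → ℂ}
    (hb : Summable fun n => ‖b n‖ ^ 2) {f : Lp ℂ 2 (diskMeasure γ)}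
    (hf : HasSum (fun n => b n • monomialLp hγ n) f) :
    ∃ g : ℂ → ℂ, f =ᵐ[diskMeasure γ] g ∧ DifferentiableOn ℂ g (Metric.ball 0 1) := by
  obtain ⟨M, hM⟩ := hb.tendsto_atTop_zero.bddAbove_range
  have hbM : ∀ n, ‖b n‖ ≤ M + 1 := fun n => by
    have h1 : ‖b n‖ ^ 2 ≤ M := hM ⟨n, rfl⟩
    nlinarith [norm_nonneg (b n), sq_nonneg (‖b n‖ - 1), sq_nonneg M]
  have hM0 : 0 ≤ M + 1 := (norm_nonneg _).trans (hbM 0)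
  have hle : ∀ (r : ℝ) (n : ℕ) (z : ℂ), z ∈ Metric.ball (0 : ℂ) r →
      ‖b n * normalizedMonomial γ n z‖ ≤
        (M + 1) * ((Real.sqrt (monomialNormSq γ n))⁻¹ * r ^ n) := by
    intro r n z hz
    have hz' : ‖z‖ < r := mem_ball_zero_iff.1 hz
    rw [norm_mul, norm_normalizedMonomial]
    have := Real.sqrt_nonneg (monomialNormSq γ n)
    gcongr
    exact hbM n
  have hex : ∀ z ∈ Metric.ball (0 : ℂ) 1, ∃ r : ℝ, 0 < r ∧ r < 1 ∧ z ∈ Metric.ball (0 : ℂ) r := by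
    intro z hz
    obtain ⟨r, hr1, hr2⟩ := exists_between (mem_ball_zero_iff.1 hz)
    exact ⟨r, (norm_nonneg z).trans_lt hr1, hr2, mem_ball_zero_iff.2 hr1⟩
  refine ⟨fun z => ∑' n, b n * normalizedMonomial γ n z, ?_, ?_⟩
  -- L² convergence gives a subsequence of partial sums converging almost everywhere; its limit must
  -- be the pointwise sum of the series.
  · obtain ⟨ns, hns, hae⟩ :=
      (tendstoInMeasure_of_tendsto_Lp hf.tendsto_sum_nat).exists_seq_tendsto_ae
    have hpart : ∀ N : ℕ, (∑ n ∈ Finset.range N, b n • monomialLp hγ n :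
        Lp ℂ 2 (diskMeasure γ)) =ᵐ[diskMeasure γ]
        fun z => ∑ n ∈ Finset.range N, b n * normalizedMonomial γ n z := by
      intro N
      induction N with
      | zero =>
        simp only [Finset.range_zero, Finset.sum_empty]
        exact Lp.coeFn_zero _ _ _
      | succ N ih =>
        rw [Finset.sum_range_succ]
        filter_upwards [Lp.coeFn_add (∑ n ∈ Finset.range N, b n • monomialLp hγ n)
          (b N • monomialLp hγ N), Lp.coeFn_smul (b N) (monomialLp hγ N), ih,
          coeFn_monomialLp hγ N] with z h1 h2 h3 h4
        rw [h1, Pi.add_apply, h2, Pi.smul_apply, h3, h4, Finset.sum_range_succ, smul_eq_mul]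
    have hball : ∀ᵐ z ∂diskMeasure γ, z ∈ Metric.ball (0 : ℂ) 1 := by
      rw [ae_diskMeasure_iff]
      exact Eventually.of_forall fun z hz => hz
    filter_upwards [hae, ae_all_iff.2 hpart, hball] with z h1 h2 h3
    obtain ⟨r, hr0, hr1, hzr⟩ := hex z h3
    have hs : Summable fun n => b n * normalizedMonomial γ n z :=
      Summable.of_norm_bounded ((summable_normalizedMonomial hγ hr0 hr1).mul_left (M + 1))
        (fun n => hle r n z hzr)
    simp only [h2] at h1
    exact tendsto_nhds_unique h1 (hs.hasSum.tendsto_sum_nat.comp hns.tendsto_atTop)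
  · intro z hz
    obtain ⟨r, hr0, hr1, hzr⟩ := hex z hz
    have hd := Complex.differentiableOn_tsum_of_summable_norm
      (F := fun n z => b n * normalizedMonomial γ n z) (U := Metric.ball (0 : ℂ) r)
      ((summable_normalizedMonomial hγ hr0 hr1).mul_left (M + 1))
      (fun n => by
        unfold normalizedMonomial
        fun_prop) Metric.isOpen_ball (fun n w hw => hle r n w hw)
    exact ((hd z hzr).differentiableAt (Metric.isOpen_ball.mem_nhds hzr)).differentiableWithinAt

/-- The isometry `ℓ² → H` defined by an orthonormal sequence. -/
def synthesis {H : Type*} [NormedAddCommGroup H] [InnerProductSpace ℂ H] [CompleteSpace H]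
    {e : ℕ → H} (he : Orthonormal ℂ e) : lp (fun _ : ℕ => ℂ) 2 →ₗᵢ[ℂ] H :=
  he.orthogonalFamily.linearIsometry

theorem hasSum_synthesis {H : Type*} [NormedAddCommGroup H] [InnerProductSpace ℂ H]
    [CompleteSpace H] {e : ℕ → H} (he : Orthonormal ℂ e) (b : lp (fun _ : ℕ => ℂ) 2) :
    HasSum (fun n => b n • e n) (synthesis he b) :=
  he.orthogonalFamily.hasSum_linearIsometry b

theorem memℓp_two_iff {b : ℕ → ℂ} : Memℓp b 2 ↔ Summable fun n => ‖b n‖ ^ 2 := by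
  rw [memℓp_gen_iff (by norm_num)]
  norm_num

theorem inner_of_hasSum {H : Type*} [NormedAddCommGroup H] [InnerProductSpace ℂ H]
    {e : ℕ → H} (he : Orthonormal ℂ e) {b : ℕ → ℂ} {x : H} (h : HasSum (fun n => b n • e n) x)
    (n : ℕ) : inner ℂ (e n) x = b n := by
  have h1 := h.mapL (innerSL ℂ (e n))
  simp only [innerSL_apply_apply, inner_smul_right] at h1
  refine h1.unique ?_
  have h2 := hasSum_single (f := fun k => b k * inner ℂ (e n) (e k)) n (fun k hk => by
    rw [he.2 hk.symm, mul_zero])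
  simpa [inner_self_eq_norm_sq_to_K, he.1 n] using h2

/-- Every analytic function in `L²_γ` is a square summable combination of the monomials. -/
theorem exists_synthesis_eq_of_analytic {γ : ℝ} (hγ : -1 < γ) {f : Lp ℂ 2 (diskMeasure γ)}
    {g : ℂ → ℂ} (hfg : f =ᵐ[diskMeasure γ] g) (hg : DifferentiableOn ℂ g (Metric.ball 0 1)) :
    ∃ b : lp (fun _ : ℕ => ℂ) 2, synthesis (orthonormal_monomialLp hγ) b = f := by
  have he := orthonormal_monomialLp hγ
  let b : lp (fun _ : ℕ => ℂ) 2 :=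
    ⟨fun n => inner ℂ (monomialLp hγ n) f, memℓp_two_iff.2 (he.inner_products_summable (x := f))⟩
  refine ⟨b, ?_⟩
  have hsum := hasSum_synthesis he b
  obtain ⟨g', hfg', hg'⟩ := exists_analytic_of_hasSum hγ (memℓp_two_iff.1 b.2) hsum
  set f' := synthesis he b with hf'
  -- The difference between `f` and its projection onto the monomials is analytic and orthogonal to
  -- every monomial, hence zero.
  have hort : ∀ n, inner ℂ (monomialLp hγ n) (f - f') = 0 := fun n => by
    rw [inner_sub_right, inner_of_hasSum he hsum n]
    exact sub_self _
  have hae : ((f - f' : Lp ℂ 2 (diskMeasure γ)) : ℂ → ℂ) =ᵐ[diskMeasure γ] g - g' := by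
    filter_upwards [Lp.coeFn_sub f f', hfg, hfg'] with z h1 h2 h3
    rw [h1, Pi.sub_apply, h2, h3, Pi.sub_apply]
  have hz := eqOn_zero_of_integral_conj_pow_mul hγ (hg.sub hg') (fun n => by
      have hm1 : MemLp (fun z : ℂ => (starRingEnd ℂ) (z ^ n)) 2 (diskMeasure γ) := by
        refine memLp_of_continuous hγ ?_ 2
        have := Complex.continuous_conj
        fun_prop
      exact hm1.integrable_mul ((memLp_congr_ae hae).1 (Lp.memLp (f - f'))))
    (fun n => by
      have h := inner_monomialLp hγ n (f - f') hae
      rw [hort] at h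
      refine (mul_eq_zero.1 h.symm).resolve_left ?_
      exact_mod_cast (inv_pos.2 (Real.sqrt_pos.2 (monomialNormSq_pos hγ n))).ne')
  rw [eq_comm, ← sub_eq_zero, Lp.eq_zero_iff_ae_eq_zero]
  refine hae.trans ?_
  rw [Filter.EventuallyEq, ae_diskMeasure_iff]
  exact Filter.Eventually.of_forall hz

/-! ### Weighted sequence spaces and Hilbert scales -/

theorem eLpNorm_count_eq_enorm (b : lp (fun _ : ℕ => ℂ) 2) :
    eLpNorm (fun n => b n) 2 Measure.count = ‖b‖ₑ := by
  have hs : Summable fun n => ‖b n‖ ^ 2 := memℓp_two_iff.1 b.2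
  have h1 : ‖b‖ ^ 2 = ∑' n, ‖b n‖ ^ 2 := by
    have h := lp.norm_rpow_eq_tsum (p := 2) (by norm_num) b
    simpa using h
  have h2 : ‖b‖ₑ ^ 2 = ∑' n, ‖b n‖ₑ ^ 2 := by
    rw [← ofReal_norm, ← ENNReal.ofReal_pow (norm_nonneg _), h1,
      ENNReal.ofReal_tsum_of_nonneg (fun n => by positivity) hs]
    refine tsum_congr fun n => ?_
    rw [ENNReal.ofReal_pow (norm_nonneg _), ofReal_norm]
  rw [eLpNorm_eq_lintegral_rpow_enorm_toReal two_ne_zero ENNReal.ofNat_ne_top, lintegral_count]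
  simp only [ENNReal.toReal_ofNat, ENNReal.rpow_ofNat]
  rw [← h2, ← ENNReal.rpow_natCast, ← ENNReal.rpow_mul]
  norm_num

section

variable {H : Type*} [NormedAddCommGroup H] [InnerProductSpace ℂ H] {s : ℝ} {ψ : ℕ → H}

theorem HScale.edist_eq (u v : HScale s ψ) : edist u v = HScale.enorm (u - v) := rfl

theorem HScale.summable_inner (hψ : Orthonormal ℂ ψ) (u : HScale s ψ) :
    Summable fun n : ℕ => ((n : ℝ) + 1) ^ (2 * s) * ‖(inner ℂ (ψ n) u.incl : ℂ)‖ ^ 2 := by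
  obtain ⟨a, ha, hu⟩ := u.2
  refine ha.congr fun n => ?_
  have h : (inner ℂ (ψ n) u.incl : ℂ) = a n := inner_of_hasSum hψ hu n
  rw [h]

theorem HScale.hasSum_inner (hψ : Orthonormal ℂ ψ) (u : HScale s ψ) :
    HasSum (fun n : ℕ => (inner ℂ (ψ n) u.incl : ℂ) • ψ n) u.incl := by
  obtain ⟨a, ha, hu⟩ := u.2
  have h : ∀ n, (inner ℂ (ψ n) u.incl : ℂ) = a n := inner_of_hasSum hψ hu
  simp only [h]
  exact hu

variable [CompleteSpace H]

/-- `ℓ²` is isomorphic to the Hilbert scale through weights comparable to `(n+1)^{-s}`. -/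
theorem HScale.exists_equiv_lp (hψ : Orthonormal ℂ ψ) (hs : 0 ≤ s) {w : ℕ → ℂ} {c C : ℝ}
    (hc : 0 < c) (hw : ∀ n : ℕ, c ≤ ((n : ℝ) + 1) ^ s * ‖w n‖ ∧ ((n : ℝ) + 1) ^ s * ‖w n‖ ≤ C) :
    ∃ Φ : lp (fun _ : ℕ => ℂ) 2 ≃L[ℂ] HScale s ψ,
      ∀ b, HasSum (fun n => (b n * w n) • ψ n) (Φ b).incl := by
  have hC : 0 ≤ C := hc.le.trans ((hw 0).1.trans (hw 0).2)
  have hpow : ∀ n : ℕ, (1 : ℝ) ≤ ((n : ℝ) + 1) ^ s := fun n =>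
    Real.one_le_rpow (by linarith [n.cast_nonneg (α := ℝ)]) hs
  have hsq : ∀ n : ℕ, ((n : ℝ) + 1) ^ (2 * s) = (((n : ℝ) + 1) ^ s) ^ 2 := fun n => by
    rw [← Real.rpow_natCast, ← Real.rpow_mul (by positivity), mul_comm]
    norm_num
  have hw0 : ∀ n, w n ≠ 0 := fun n h => by
    have h1 := (hw n).1
    rw [h, norm_zero, mul_zero] at h1
    linarith
  -- Here `0 ≤ s` enters: (n+1)^s ≥ 1 makes the weights themselves bounded, so the weighted series
  -- converges in `H`.
  have hwC : ∀ n, ‖w n‖ ≤ C := fun n =>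
    (le_mul_of_one_le_left (norm_nonneg _) (hpow n)).trans (hw n).2
  have hup : ∀ (b : ℂ) (n : ℕ), ((n : ℝ) + 1) ^ s * ‖b * w n‖ ≤ C * ‖b‖ := fun b n => by
    rw [norm_mul]
    calc _ = (((n : ℝ) + 1) ^ s * ‖w n‖) * ‖b‖ := by ring
      _ ≤ _ := by
        gcongr
        exact (hw n).2
  have hlow : ∀ (a : ℂ) (n : ℕ), ‖a / w n‖ ≤ c⁻¹ * (((n : ℝ) + 1) ^ s * ‖a‖) := fun a n => by
    have h1 := norm_pos_iff.2 (hw0 n)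
    rw [norm_div, div_le_iff₀ h1, ← div_eq_inv_mul, div_mul_eq_mul_div, le_div_iff₀ hc]
    calc ‖a‖ * c ≤ ‖a‖ * (((n : ℝ) + 1) ^ s * ‖w n‖) := by
          gcongr
          exact (hw n).1
      _ = _ := by ring
  have hmem : ∀ b : lp (fun _ : ℕ => ℂ) 2, Memℓp (fun n => b n * w n) 2 := fun b => by
    rw [memℓp_two_iff]
    refine Summable.of_nonneg_of_le (fun n => by positivity) (fun n => ?_)
      ((memℓp_two_iff.1 b.2).mul_left (C ^ 2))
    rw [norm_mul, mul_pow, mul_comm]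
    gcongr
    exact hwC n
  have hsum : ∀ b : lp (fun _ : ℕ => ℂ) 2,
      HasSum (fun n => (b n * w n) • ψ n) (synthesis hψ ⟨_, hmem b⟩) :=
    fun b => hasSum_synthesis hψ ⟨_, hmem b⟩
  let T : lp (fun _ : ℕ => ℂ) 2 → HScale s ψ := fun b =>
    ⟨synthesis hψ ⟨_, hmem b⟩, fun n => b n * w n, by
      refine Summable.of_nonneg_of_le (fun n => by positivity) (fun n => ?_)
        ((memℓp_two_iff.1 b.2).mul_left (C ^ 2))
      rw [hsq, ← mul_pow, ← mul_pow]
      have := hup (b n) n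
      gcongr, hsum b⟩
  have hT : ∀ b, HasSum (fun n => (b n * w n) • ψ n) (T b).incl := hsum
  have hTi : ∀ b n, (inner ℂ (ψ n) (T b).incl : ℂ) = b n * w n :=
    fun b n => inner_of_hasSum hψ (hT b) n
  let S : HScale s ψ → lp (fun _ : ℕ => ℂ) 2 := fun u =>
    ⟨fun n => inner ℂ (ψ n) u.incl / w n, by
      refine memℓp_two_iff.2 ?_
      refine Summable.of_nonneg_of_le (fun n => by positivity) (fun n => ?_)
        ((u.summable_inner hψ).mul_left (c⁻¹ ^ 2))
      rw [hsq, ← mul_pow, ← mul_pow]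
      have := hlow (inner ℂ (ψ n) u.incl) n
      gcongr⟩
  have hSi : ∀ u n, (S u) n = inner ℂ (ψ n) u.incl / w n := fun _ _ => rfl
  have hST : ∀ b, S (T b) = b := fun b => by
    ext n
    rw [hSi, hTi, mul_div_cancel_right₀ _ (hw0 n)]
  have hincl : ∀ u v : HScale s ψ, u.incl = v.incl → u = v := fun u v h => Subtype.ext h
  have hTS : ∀ u, T (S u) = u := fun u => by
    refine hincl _ _ ((hT (S u)).unique ?_)
    have h := u.hasSum_inner hψ
    refine h.congr_fun fun n => ?_
    rw [hSi, div_mul_cancel₀ _ (hw0 n)]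
  let L : lp (fun _ : ℕ => ℂ) 2 ≃ₗ[ℂ] HScale s ψ :=
    { toFun := T
      invFun := S
      left_inv := hST
      right_inv := hTS
      map_add' := fun b b' => by
        refine hincl _ _ ((hT _).unique ?_)
        rw [map_add]
        refine ((hT b).add (hT b')).congr_fun fun n => ?_
        rw [lp.coeFn_add, Pi.add_apply, add_mul, add_smul]
      map_smul' := fun k b => by
        refine hincl _ _ ((hT _).unique ?_)
        rw [RingHom.id_apply, map_smul]
        refine ((hT b).const_smul k).congr_fun fun n => ?_
        rw [lp.coeFn_smul, Pi.smul_apply, smul_smul, smul_eq_mul, mul_assoc] }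
  have hLT : ∀ b, L b = T b := fun _ => rfl
  have hLS : ∀ u, L.symm u = S u := fun _ => rfl
  -- The scale carries only an extended distance, so continuity in both directions is proved as a
  -- Lipschitz bound, by comparing coefficients termwise.
  have hL : LipschitzWith C.toNNReal L := by
    intro b b'
    rw [HScale.edist_eq, ← map_sub, HScale.enorm, edist_eq_enorm_sub, ← eLpNorm_count_eq_enorm]
    refine eLpNorm_le_mul_eLpNorm_of_ae_le_mul (Filter.Eventually.of_forall fun n => ?_) 2
    rw [hLT, hTi, norm_mul, Complex.norm_real, Real.norm_of_nonneg (by positivity)]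
    exact hup _ n
  have hL' : LipschitzWith c⁻¹.toNNReal L.symm := by
    intro u v
    rw [HScale.edist_eq, HScale.enorm, edist_eq_enorm_sub, ← map_sub, ← eLpNorm_count_eq_enorm]
    refine eLpNorm_le_mul_eLpNorm_of_ae_le_mul (Filter.Eventually.of_forall fun n => ?_) 2
    rw [hLS, hSi, norm_mul, Complex.norm_real, Real.norm_of_nonneg (by positivity)]
    exact hlow _ n
  exact ⟨{ L with
    continuous_toFun := hL.continuous
    continuous_invFun := hL'.continuous }, hT⟩

end

/-! ### Fan-beam functions -/

/-- `μ^{2γ+1} e^{ik(β+α+π)} L̂_n^γ(sin α) / 2π`. -/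
def fanFun (γ : ℝ) (n : ℕ) (k : ℤ) (q : ℝ × ℝ) : ℂ :=
  ((Real.cos q.2 ^ (2 * γ + 1) : ℝ) : ℂ) * geoDir q ^ k *
    (Lhat γ n (Real.sin q.2) : ℂ) / (2 * (Real.pi : ℂ))

theorem geoDir_ne_zero (q : ℝ × ℝ) : geoDir q ≠ 0 := by
  rw [← norm_ne_zero_iff, norm_geoDir]
  exact one_ne_zero

theorem geoDir_mul_psiFun_eq_fanFun (γ : ℝ) (n : ℕ) (k : ℤ) :
    (fun q => geoDir q * psiFun γ n k q) = fanFun γ n (n - 2 * k + 1) := by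
  funext q
  rw [psiFun, fanFun, zpow_add_one₀ (geoDir_ne_zero q)]
  ring

theorem conj_geoDir (q : ℝ × ℝ) : (starRingEnd ℂ) (geoDir q) = (geoDir q)⁻¹ := by
  rw [Complex.inv_def, Complex.normSq_eq_norm_sq, norm_geoDir]
  simp

/-- Only the exponential is not real, so conjugation reverses the frequency. This transports the
analytic half to the antianalytic half. -/
theorem conj_fanFun (γ : ℝ) (n : ℕ) (k : ℤ) (q : ℝ × ℝ) :
    (starRingEnd ℂ) (fanFun γ n k q) = fanFun γ n (-k) q := by
  simp only [fanFun, map_div₀, map_mul, map_zpow₀, Complex.conj_ofReal, conj_geoDir, inv_zpow',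
    map_ofNat]

theorem integral_Lhat_sq {γ : ℝ} (hγ : -1 < γ) (n : ℕ) :
    ∫ x in (-1 : ℝ)..1, Lhat γ n x ^ 2 * (1 - x ^ 2) ^ (γ + 1 / 2) = 2 * Real.pi := by
  have hG := gegenbauerNormSq_pos hγ n
  have h : ∀ x : ℝ, Lhat γ n x ^ 2 * (1 - x ^ 2) ^ (γ + 1 / 2) =
      (2 * Real.pi / gegenbauerNormSq γ n) *
        (gegenbauer (γ + 1) n x ^ 2 * (1 - x ^ 2) ^ (γ + 1 / 2)) := fun x => by
    rw [Lhat, mul_pow, div_pow, Real.sq_sqrt (by positivity), Real.sq_sqrt hG.le]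
    ring
  simp only [h]
  rw [intervalIntegral.integral_const_mul, ← gegenbauerNormSq, div_mul_cancel₀ _ hG.ne']

theorem integral_Lhat_sin_sq {γ : ℝ} (hγ : -1 < γ) (n : ℕ) :
    ∫ a in Set.Icc (-(Real.pi / 2)) (Real.pi / 2),
      Real.cos a ^ (2 * γ + 2) * Lhat γ n (Real.sin a) ^ 2 = 2 * Real.pi := by
  rw [← integral_Lhat_sq hγ n, intervalIntegral.integral_of_le (by norm_num),
    integral_Ioc_eq_integral_Ioo, ← sin_image_Ioo,
    integral_image_eq_integral_abs_deriv_smul measurableSet_Ioo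
    (fun x _ => (Real.hasDerivAt_sin x).hasDerivWithinAt)
    (Real.injOn_sin.mono Set.Ioo_subset_Icc_self), integral_Icc_eq_integral_Ioo]
  refine setIntegral_congr_fun measurableSet_Ioo fun a ha => ?_
  have hc := Real.cos_pos_of_mem_Ioo ha
  rw [abs_of_pos hc, smul_eq_mul, ← Real.cos_sq', ← Real.rpow_natCast (Real.cos a) 2,
    ← Real.rpow_mul hc.le, mul_left_comm, mul_comm (Real.cos a),
    ← Real.rpow_add_one hc.ne', mul_comm]
  congr 2
  push_cast
  ring

/-- The exponential of θ = β + α + π splits, so the integral factors. The exponents of μ add up to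
−2γ + 2(2γ+1) = 2γ + 2. -/
theorem integral_conj_fanFun_mul {γ : ℝ} (n n' : ℕ) (k k' : ℤ) :
    ∫ q, (starRingEnd ℂ) (fanFun γ n k q) * fanFun γ n' k' q ∂inwardMeasure γ =
      (∫ b in Set.Ico 0 (2 * Real.pi), Complex.exp (((k' - k : ℤ) * Complex.I) * (b : ℝ))) *
      ∫ a in Set.Icc (-(Real.pi / 2)) (Real.pi / 2),
        Complex.exp (((k' - k : ℤ) * Complex.I) * ((a + Real.pi : ℝ) : ℂ)) *
        ((Real.cos a ^ (2 * γ + 2) * (Lhat γ n (Real.sin a) * Lhat γ n' (Real.sin a)) : ℝ) : ℂ) /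
          (2 * Real.pi) ^ 2 := by
  rw [← integral_prod_mul (μ := volume.restrict (Set.Ico 0 (2 * Real.pi)))
    (ν := volume.restrict (Set.Icc (-(Real.pi / 2)) (Real.pi / 2))), Measure.prod_restrict,
    ← Measure.volume_eq_prod, ← inward, inwardMeasure,
    integral_withDensity_eq_integral_toReal_smul (measurable_cos_rpow _).ennreal_ofReal
    (Filter.Eventually.of_forall fun _ => ENNReal.ofReal_lt_top)]
  refine integral_congr_ae ?_
  filter_upwards [ae_cos_pos] with q hq
  have hgeo : geoDir q ^ (k' - k) = Complex.exp (((k' - k : ℤ) * Complex.I) * (q.1 : ℝ)) *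
      Complex.exp (((k' - k : ℤ) * Complex.I) * ((q.2 + Real.pi : ℝ) : ℂ)) := by
    rw [geoDir, ← Complex.exp_int_mul, ← Complex.exp_add, geoAngle]
    congr 1
    push_cast
    ring
  have hpow : Real.cos q.2 ^ (2 * γ + 2) = Real.cos q.2 ^ (-2 * γ) *
      (Real.cos q.2 ^ (2 * γ + 1) * Real.cos q.2 ^ (2 * γ + 1)) := by
    rw [← Real.rpow_add hq, ← Real.rpow_add hq]
    congr 1
    ring
  rw [ENNReal.toReal_ofReal (Real.rpow_nonneg hq.le _), conj_fanFun, fanFun, fanFun,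
    Complex.real_smul, hpow]
  have e : geoDir q ^ (k' - k) = geoDir q ^ (-k) * geoDir q ^ k' := by
    rw [← zpow_add₀ (geoDir_ne_zero q)]
    congr 1
    ring
  rw [e] at hgeo
  simp only [Complex.ofReal_mul]
  linear_combination (((Real.cos q.2 ^ (-2 * γ) : ℝ) : ℂ) *
    ((Real.cos q.2 ^ (2 * γ + 1) : ℝ) : ℂ) ^ 2 * (Lhat γ n (Real.sin q.2) : ℂ) *
    (Lhat γ n' (Real.sin q.2) : ℂ) / (2 * Real.pi) ^ 2) * hgeo

/-- Distinct frequencies are orthogonal through the β-integral. The hypothesis `h` excludes equal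
frequencies with different degrees, so only the norm of `Lhat` is needed, not orthogonality between
degrees. -/
theorem inner_of_ae_eq_fanFun {γ : ℝ} (hγ : -1 < γ) {n n' : ℕ} {k k' : ℤ} {u v : L2Inward γ}
    (hu : u =ᵐ[inwardMeasure γ] fanFun γ n k) (hv : v =ᵐ[inwardMeasure γ] fanFun γ n' k')
    (h : k = k' → n = n') : inner ℂ u v = if k = k' then 1 else 0 := by
  have e : inner ℂ u v =
      ∫ q, (starRingEnd ℂ) (fanFun γ n k q) * fanFun γ n' k' q ∂inwardMeasure γ := by
    rw [L2.inner_def]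
    refine integral_congr_ae ?_
    filter_upwards [hu, hv] with q h1 h2
    rw [h1, h2, RCLike.inner_apply, mul_comm]
  have h2pi : (0 : ℝ) ≤ 2 * Real.pi := by positivity
  rw [e, integral_conj_fanFun_mul]
  split_ifs with hk
  · obtain rfl := h hk
    subst hk
    simp only [sub_self, Int.cast_zero, zero_mul, Complex.exp_zero, one_mul, ← sq (Lhat _ _ _)]
    rw [integral_div, integral_complex_ofReal, integral_Lhat_sin_sq hγ, setIntegral_const]
    have hpi : (Real.pi : ℂ) ≠ 0 := by exact_mod_cast Real.pi_ne_zero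
    rw [Real.volume_real_Ico_of_le h2pi]
    simp only [Complex.real_smul]
    push_cast
    field_simp
    ring
  · have hk' : (((k' - k : ℤ) : ℂ) * Complex.I) ≠ 0 :=
      mul_ne_zero (by exact_mod_cast sub_ne_zero.2 (Ne.symm hk)) Complex.I_ne_zero
    have hz : ∫ b in Set.Ico 0 (2 * Real.pi),
        Complex.exp (((k' - k : ℤ) * Complex.I) * (b : ℝ)) = 0 := by
      rw [integral_Ico_eq_integral_Ioo, ← integral_Ioc_eq_integral_Ioo,
        ← intervalIntegral.integral_of_le h2pi, integral_exp_mul_complex hk']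
      have h1 : Complex.exp (((k' - k : ℤ) * Complex.I) * ((2 * Real.pi : ℝ) : ℂ)) = 1 := by
        rw [Complex.exp_eq_one_iff]
        refine ⟨k' - k, ?_⟩
        push_cast
        ring
      rw [h1]
      simp
    rw [hz, zero_mul]

/-- Fan-beam functions with positive and negative angular frequencies form an orthonormal
system. -/
theorem orthonormal_sumElim_of_ae_eq_fanFun {γ : ℝ} (hγ : -1 < γ) {m : ℕ} (hm : 1 ≤ m)
    {u v : ℕ → L2Inward γ} (hu : ∀ n, u n =ᵐ[inwardMeasure γ] fanFun γ n (n + m))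
    (hv : ∀ n, v n =ᵐ[inwardMeasure γ] fanFun γ n (-(n + m))) :
    Orthonormal ℂ (Sum.elim u v) := by
  rw [orthonormal_iff_ite]
  rintro (i | i) (j | j)
  · simp only [Sum.elim_inl, Sum.inl.injEq]
    rw [inner_of_ae_eq_fanFun hγ (hu i) (hu j) (by omega)]
    refine if_congr (by omega) rfl rfl
  -- Since m ≥ 1, i + m is positive and −(j + m) is negative; for m = 0 they would meet at i = j =
  -- 0.
  · simp only [Sum.elim_inl, Sum.elim_inr]
    rw [inner_of_ae_eq_fanFun hγ (hu i) (hv j) (by omega), if_neg (by omega), if_neg (by simp)]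
  · simp only [Sum.elim_inl, Sum.elim_inr]
    rw [inner_of_ae_eq_fanFun hγ (hv i) (hu j) (by omega), if_neg (by omega), if_neg (by simp)]
  · simp only [Sum.elim_inr, Sum.inr.injEq]
    rw [inner_of_ae_eq_fanFun hγ (hv i) (hv j) (by omega)]
    refine if_congr (by omega) rfl rfl

/-! ### The X-ray transform of the monomials -/

/-- The coefficient of the transform of the `n`-th normalized monomial. -/
def transformCoeff (γ : ℝ) (n : ℕ) : ℂ :=
  Complex.I ^ n * ((momentFactor γ n * Real.sqrt (gegenbauerNormSq γ n) *
    Real.sqrt (2 * Real.pi) / Real.sqrt (monomialNormSq γ n) : ℝ) : ℂ)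

theorem norm_transformCoeff {γ : ℝ} (hγ : -1 < γ) (n : ℕ) :
    ‖transformCoeff γ n‖ = Real.sqrt (singularValueSq γ n) := by
  have h1 := momentFactor_pos hγ n
  have h2 := gegenbauerNormSq_pos hγ n
  have h3 := monomialNormSq_pos hγ n
  rw [transformCoeff, norm_mul, norm_pow, Complex.norm_I, one_pow, one_mul, Complex.norm_real,
    Real.norm_of_nonneg (by positivity), singularValueSq, Real.sqrt_div' _ h3.le,
    Real.sqrt_mul' _ h2.le, Real.sqrt_mul' (2 * Real.pi) (sq_nonneg _), Real.sqrt_sq h1.le]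
  ring

theorem transformCoeff_bounds {γ : ℝ} (hγ : -1 < γ) : ∃ c C : ℝ, 0 < c ∧ ∀ n : ℕ,
    c ≤ ((n : ℝ) + 1) ^ ((1 + γ) / 2) * ‖transformCoeff γ n‖ ∧
      ((n : ℝ) + 1) ^ ((1 + γ) / 2) * ‖transformCoeff γ n‖ ≤ C := by
  obtain ⟨c, C, hc, -, h⟩ := singularValueSq_bounds hγ
  refine ⟨Real.sqrt c, Real.sqrt C, Real.sqrt_pos.2 hc, fun n => ?_⟩
  have e : ((n : ℝ) + 1) ^ ((1 + γ) / 2) * ‖transformCoeff γ n‖ =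
      Real.sqrt (singularValueSq γ n * ((n : ℝ) + 1) ^ (γ + 1)) := by
    rw [norm_transformCoeff hγ, Real.sqrt_mul (singularValueSq_pos hγ n).le, mul_comm,
      Real.sqrt_eq_rpow (((n : ℝ) + 1) ^ (γ + 1)), ← Real.rpow_mul (by positivity)]
    congr 2
    ring
  rw [e]
  exact ⟨Real.sqrt_le_sqrt (h n).1, Real.sqrt_le_sqrt (h n).2⟩

/-- The factor `geoDir q ^ m` is the value of dz^m on the velocity; it raises the frequency from n
to n + m. The two roots √(2π), from `Lhat` and `transformCoeff`, cancel the 1/2π of the fan-beam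
function. -/
theorem isLineTransform_normalizedMonomial {γ : ℝ} (hγ : -1 < γ) (m n : ℕ) :
    IsLineTransform γ (fun q => geoDir q ^ m) (normalizedMonomial γ n)
      (transformCoeff γ n • fanFun γ n (n + m)) := by
  filter_upwards [ae_inwardMeasure_of_ae ae_cos_pos] with q hc
  constructor
  · have h := intervalIntegrable_bdf_geoPoint hγ hc
    have h' : IntervalIntegrable (fun t => ((bdf (geoPoint q t) ^ γ : ℝ) : ℂ)) volume 0
        (2 * Real.cos q.2) := ⟨h.1.ofReal, h.2.ofReal⟩
    refine h'.continuousOn_mul (Continuous.continuousOn ?_)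
    refine (continuous_normalizedMonomial γ n).comp ?_
    unfold geoPoint
    fun_prop
  · simp only [normalizedMonomial, mul_assoc]
    rw [intervalIntegral.integral_const_mul, integral_geoPoint_pow hγ hc n]
    have h2 := Real.sqrt_pos.2 (gegenbauerNormSq_pos hγ n)
    have h3 := Real.sqrt_pos.2 (monomialNormSq_pos hγ n)
    have hpi : Real.sqrt (2 * Real.pi) * Real.sqrt (2 * Real.pi) = 2 * Real.pi :=
      Real.mul_self_sqrt (by positivity)
    have hpi' : (Real.sqrt (2 * Real.pi) : ℂ) * Real.sqrt (2 * Real.pi) = 2 * Real.pi := by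
      exact_mod_cast hpi
    have h2' : (Real.sqrt (gegenbauerNormSq γ n) : ℂ) ≠ 0 := by exact_mod_cast h2.ne'
    have h3' : (Real.sqrt (monomialNormSq γ n) : ℂ) ≠ 0 := by exact_mod_cast h3.ne'
    have hp : (Real.pi : ℂ) ≠ 0 := by exact_mod_cast Real.pi_ne_zero
    have hz : geoDir q ^ ((n : ℤ) + m) = geoDir q ^ n * geoDir q ^ m := by
      rw [zpow_add₀ (geoDir_ne_zero q), zpow_natCast, zpow_natCast]
    simp only [Pi.smul_apply, smul_eq_mul]
    rw [fanFun, transformCoeff, Lhat, hz]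
    push_cast
    field_simp
    linear_combination (momentFactor γ n * ((Real.cos q.2 ^ (2 * γ + 1) : ℝ) : ℂ) *
      geoDir q ^ n * geoDir q ^ m *
      (gegenbauer (γ + 1) n (Real.sin q.2) : ℂ)) * hpi'

theorem IsLineTransform.conj {γ : ℝ} {ω : ℝ × ℝ → ℂ} {f : ℂ → ℂ} {u : ℝ × ℝ → ℂ}
    (h : IsLineTransform γ ω f u) :
    IsLineTransform γ (fun q => (starRingEnd ℂ) (ω q)) (fun z => (starRingEnd ℂ) (f z))
      (fun q => (starRingEnd ℂ) (u q)) := by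
  filter_upwards [h] with q hq
  have e : ∀ t, (starRingEnd ℂ) (f (geoPoint q t)) * ((bdf (geoPoint q t) ^ γ : ℝ) : ℂ) =
      (starRingEnd ℂ) (f (geoPoint q t) * ((bdf (geoPoint q t) ^ γ : ℝ) : ℂ)) := fun t => by
    rw [map_mul, Complex.conj_ofReal]
  simp only [e]
  refine ⟨?_, ?_⟩
  · exact ⟨(Complex.conjCLE : ℂ →L[ℝ] ℂ).integrable_comp hq.1.1,
      (Complex.conjCLE : ℂ →L[ℝ] ℂ).integrable_comp hq.1.2⟩
  · rw [hq.2, map_mul, intervalIntegral.intervalIntegral_conj]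

/-! ### Antianalytic functions -/

/-- Complex conjugation on `L²_γ(𝔻)`. -/
def conjLp (γ : ℝ) : Lp ℂ 2 (diskMeasure γ) →L⋆[ℂ] Lp ℂ 2 (diskMeasure γ) :=
  ((starL ℂ : ℂ ≃L⋆[ℂ] ℂ) : ℂ →L⋆[ℂ] ℂ).compLpL 2 (diskMeasure γ)

theorem coeFn_conjLp {γ : ℝ} (f : Lp ℂ 2 (diskMeasure γ)) :
    conjLp γ f =ᵐ[diskMeasure γ] fun z => (starRingEnd ℂ) (f z) :=
  ContinuousLinearMap.coeFn_compLpL _ f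

theorem conjLp_conjLp {γ : ℝ} (f : Lp ℂ 2 (diskMeasure γ)) : conjLp γ (conjLp γ f) = f := by
  refine Lp.ext ?_
  filter_upwards [coeFn_conjLp (conjLp γ f), coeFn_conjLp f] with z h1 h2
  rw [h1, h2, Complex.conj_conj]

theorem inner_conjLp {γ : ℝ} (f g : Lp ℂ 2 (diskMeasure γ)) :
    inner ℂ (conjLp γ f) (conjLp γ g) = (starRingEnd ℂ) (inner ℂ f g) := by
  rw [L2.inner_def, L2.inner_def, ← integral_conj]
  refine integral_congr_ae ?_
  filter_upwards [coeFn_conjLp f, coeFn_conjLp g] with z h1 h2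
  rw [h1, h2, RCLike.inner_apply, RCLike.inner_apply, map_mul]

theorem orthonormal_conjLp_monomialLp {γ : ℝ} (hγ : -1 < γ) :
    Orthonormal ℂ (fun n => conjLp γ (monomialLp hγ n)) := by
  have h := orthonormal_iff_ite.1 (orthonormal_monomialLp hγ)
  rw [orthonormal_iff_ite]
  intro i j
  rw [inner_conjLp, h]
  split_ifs <;> simp

theorem hasSum_conjLp {γ : ℝ} {b : ℕ → ℂ} {e : ℕ → Lp ℂ 2 (diskMeasure γ)}
    {f : Lp ℂ 2 (diskMeasure γ)} (h : HasSum (fun n => b n • e n) f) :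
    HasSum (fun n => (starRingEnd ℂ) (b n) • conjLp γ (e n)) (conjLp γ f) := by
  refine ((conjLp γ).hasSum h).congr_fun fun n => ?_
  rw [map_smulₛₗ]

theorem exists_antianalytic_of_hasSum {γ : ℝ} (hγ : -1 < γ) {b : ℕ → ℂ}
    (hb : Summable fun n => ‖b n‖ ^ 2) {f : Lp ℂ 2 (diskMeasure γ)}
    (hf : HasSum (fun n => b n • conjLp γ (monomialLp hγ n)) f) :
    ∃ g : ℂ → ℂ, f =ᵐ[diskMeasure γ] g ∧
      DifferentiableOn ℂ (fun z => (starRingEnd ℂ) (g z)) (Metric.ball 0 1) := by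
  have h := hasSum_conjLp hf
  simp only [conjLp_conjLp] at h
  obtain ⟨g, hg, hd⟩ := exists_analytic_of_hasSum hγ (by simpa using hb) h
  refine ⟨fun z => (starRingEnd ℂ) (g z), ?_, by simpa using hd⟩
  filter_upwards [coeFn_conjLp f, hg] with z h1 h2
  rw [← h2, h1, Complex.conj_conj]

theorem exists_synthesis_eq_of_antianalytic {γ : ℝ} (hγ : -1 < γ) {f : Lp ℂ 2 (diskMeasure γ)}
    {g : ℂ → ℂ} (hfg : f =ᵐ[diskMeasure γ] g)
    (hg : DifferentiableOn ℂ (fun z => (starRingEnd ℂ) (g z)) (Metric.ball 0 1)) :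
    ∃ b : lp (fun _ : ℕ => ℂ) 2, synthesis (orthonormal_conjLp_monomialLp hγ) b = f := by
  have hc : conjLp γ f =ᵐ[diskMeasure γ] fun z => (starRingEnd ℂ) (g z) := by
    filter_upwards [coeFn_conjLp f, hfg] with z h1 h2
    rw [h1, h2]
  obtain ⟨b, hb⟩ := exists_synthesis_eq_of_analytic hγ hc hg
  have h := hasSum_conjLp (hasSum_synthesis (orthonormal_monomialLp hγ) b)
  rw [hb, conjLp_conjLp] at h
  have hmem : Memℓp (fun n => (starRingEnd ℂ) (b n)) 2 :=
    memℓp_two_iff.2 (by simpa using memℓp_two_iff.1 b.2)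
  exact ⟨⟨_, hmem⟩, (hasSum_synthesis (orthonormal_conjLp_monomialLp hγ) ⟨_, hmem⟩).unique h⟩

/-! ### Coefficients of tensors -/

/-- Evaluation of symmetric tensors. -/
def evalTensor {m : ℕ} (v : Fin m → ℂ) : SymTensor m →L[ℂ] ℂ :=
  LinearMap.mkContinuous
    { toFun := fun T => T.val v
      map_add' := fun _ _ => rfl
      map_smul' := fun _ _ => rfl } (∏ i, ‖v i‖) fun T => by
    rw [mul_comm]
    exact T.val.le_opNorm v

theorem evalTensor_apply {m : ℕ} (v : Fin m → ℂ) (T : SymTensor m) :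
    evalTensor v T = T.val v := rfl

theorem dzPow_apply {m : ℕ} (v : Fin m → ℂ) : evalTensor v (dzPow m) = ∏ i, v i := rfl

theorem dzbarPow_apply {m : ℕ} (v : Fin m → ℂ) :
    evalTensor v (dzbarPow m) = ∏ i, (starRingEnd ℂ) (v i) := rfl

/-- Evaluation at (1, …, 1) and at (i, 1, …, 1) gives 1, i on dz^m and 1, −i on dz̄^m, an invertible
2 × 2 system. For m = 0 the two tensors coincide. -/
theorem exists_dual_dzPow {m : ℕ} (hm : 1 ≤ m) : ∃ A B : SymTensor m →L[ℂ] ℂ,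
    A (dzPow m) = 1 ∧ A (dzbarPow m) = 0 ∧ B (dzPow m) = 0 ∧ B (dzbarPow m) = 1 := by
  let v : Fin m → ℂ := Function.update 1 ⟨0, hm⟩ Complex.I
  have h1 : ∏ i, v i = Complex.I := by
    simp only [v]
    rw [Finset.prod_update_of_mem (Finset.mem_univ _)]
    simp
  have h2 : ∏ i, (starRingEnd ℂ) (v i) = -Complex.I := by
    rw [← map_prod, h1, Complex.conj_I]
  have hI := Complex.I_mul_I
  refine ⟨(1 / 2 : ℂ) • (evalTensor 1 - Complex.I • evalTensor v),
    (1 / 2 : ℂ) • (evalTensor 1 + Complex.I • evalTensor v), ?_, ?_, ?_, ?_⟩ <;>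
  · simp only [smul_apply, sub_apply,
      add_apply, dzPow_apply, dzbarPow_apply, h1, h2, smul_eq_mul,
      Pi.one_apply, map_one, Finset.prod_const_one, mul_neg, hI]
    norm_num

/-- The tensor field `f dz^m + g dz̄^m`. -/
def tensorLp (γ : ℝ) (m : ℕ) :
    (Lp ℂ 2 (diskMeasure γ) × Lp ℂ 2 (diskMeasure γ)) →L[ℂ] L2Tensor γ m :=
  ((ContinuousLinearMap.toSpanSingleton ℂ (dzPow m)).compLpL 2 (diskMeasure γ)).coprod
    ((ContinuousLinearMap.toSpanSingleton ℂ (dzbarPow m)).compLpL 2 (diskMeasure γ))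

theorem coeFn_tensorLp {γ : ℝ} {m : ℕ} (f g : Lp ℂ 2 (diskMeasure γ)) :
    tensorLp γ m (f, g) =ᵐ[diskMeasure γ] fun z => f z • dzPow m + g z • dzbarPow m := by
  rw [tensorLp, ContinuousLinearMap.coprod_apply]
  filter_upwards [Lp.coeFn_add
      ((ContinuousLinearMap.toSpanSingleton ℂ (dzPow m)).compLpL 2 (diskMeasure γ) f)
      ((ContinuousLinearMap.toSpanSingleton ℂ (dzbarPow m)).compLpL 2 (diskMeasure γ) g),
    (ContinuousLinearMap.toSpanSingleton ℂ (dzPow m)).coeFn_compLpL f,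
    (ContinuousLinearMap.toSpanSingleton ℂ (dzbarPow m)).coeFn_compLpL g] with z h1 h2 h3
  rw [h1, Pi.add_apply, h2, h3]
  rfl

theorem exists_leftInverse_tensorLp (γ : ℝ) {m : ℕ} (hm : 1 ≤ m) :
    ∃ R : L2Tensor γ m →L[ℂ] (Lp ℂ 2 (diskMeasure γ) × Lp ℂ 2 (diskMeasure γ)),
      ∀ x, R (tensorLp γ m x) = x := by
  obtain ⟨A, B, h1, h2, h3, h4⟩ := exists_dual_dzPow hm
  refine ⟨(A.compLpL 2 (diskMeasure γ)).prod (B.compLpL 2 (diskMeasure γ)), ?_⟩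
  rintro ⟨f, g⟩
  rw [ContinuousLinearMap.prod_apply]
  refine Prod.ext (Lp.ext ?_) (Lp.ext ?_)
  · filter_upwards [A.coeFn_compLpL (tensorLp γ m (f, g)), coeFn_tensorLp f g] with z e1 e2
    rw [e1, e2, map_add, map_smul, map_smul, h1, h2]
    simp
  · filter_upwards [B.coeFn_compLpL (tensorLp γ m (f, g)), coeFn_tensorLp f g] with z e1 e2
    rw [e1, e2, map_add, map_smul, map_smul, h3, h4]
    simp

/-- The transverse-tracefree tensor fields in terms of the Taylor coefficients. -/
theorem exists_equiv_ttTensors {γ : ℝ} (hγ : -1 < γ) {m : ℕ} (hm : 1 ≤ m) :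
    ∃ J : (lp (fun _ : ℕ => ℂ) 2 × lp (fun _ : ℕ => ℂ) 2) ≃L[ℂ] ttTensors γ m,
      ∀ b, (J b : L2Tensor γ m) = tensorLp γ m (synthesis (orthonormal_monomialLp hγ) b.1,
        synthesis (orthonormal_conjLp_monomialLp hγ) b.2) := by
  have he := orthonormal_monomialLp hγ
  have he' := orthonormal_conjLp_monomialLp hγ
  obtain ⟨R, hR⟩ := exists_leftInverse_tensorLp γ hm
  let S : (lp (fun _ : ℕ => ℂ) 2 × lp (fun _ : ℕ => ℂ) 2) →L[ℂ]
      (Lp ℂ 2 (diskMeasure γ) × Lp ℂ 2 (diskMeasure γ)) :=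
    (synthesis he).toContinuousLinearMap.prodMap (synthesis he').toContinuousLinearMap
  have hS : ∀ b, S b = (synthesis he b.1, synthesis he' b.2) := fun _ => rfl
  -- The adjoint of an isometry is a left inverse. With the left inverse `R` this makes the inverse
  -- of `T` explicitly continuous, without the open mapping theorem or closedness of the subspace.
  let S' : (Lp ℂ 2 (diskMeasure γ) × Lp ℂ 2 (diskMeasure γ)) →L[ℂ]
      (lp (fun _ : ℕ => ℂ) 2 × lp (fun _ : ℕ => ℂ) 2) :=
    (ContinuousLinearMap.adjoint (synthesis he).toContinuousLinearMap).prodMap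
      (ContinuousLinearMap.adjoint (synthesis he').toContinuousLinearMap)
  have hS' : ∀ b, S' (S b) = b := by
    rintro ⟨b, b'⟩
    have h1 := DFunLike.congr_fun ((ContinuousLinearMap.norm_map_iff_adjoint_comp_self
      (synthesis he).toContinuousLinearMap).1 (synthesis he).norm_map) b
    have h2 := DFunLike.congr_fun ((ContinuousLinearMap.norm_map_iff_adjoint_comp_self
      (synthesis he').toContinuousLinearMap).1 (synthesis he').norm_map) b'
    exact Prod.ext h1 h2
  have hmem : ∀ b, ((tensorLp γ m).comp S) b ∈ ttTensors γ m := by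
    rintro ⟨b, b'⟩
    obtain ⟨f, hf, hfd⟩ := exists_analytic_of_hasSum hγ (memℓp_two_iff.1 b.2)
      (hasSum_synthesis he b)
    obtain ⟨g, hg, hgd⟩ := exists_antianalytic_of_hasSum hγ (memℓp_two_iff.1 b'.2)
      (hasSum_synthesis he' b')
    refine ⟨f, g, ⟨(memLp_congr_ae hf).1 (Lp.memLp _), hfd⟩,
      ⟨(memLp_congr_ae hg).1 (Lp.memLp _), hgd⟩, ?_⟩
    rw [ContinuousLinearMap.comp_apply, hS]
    filter_upwards [coeFn_tensorLp (m := m) (synthesis he b) (synthesis he' b'), hf, hg]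
      with z h1 h2 h3
    rw [h1, h2, h3]
  let T := ((tensorLp γ m).comp S).codRestrict (ttTensors γ m) hmem
  let T' := (S'.comp R).comp (ttTensors γ m).subtypeL
  have hleft : Function.LeftInverse T' T := fun b => by
    change S' (R (tensorLp γ m (S b))) = b
    rw [hR, hS']
  have hsurj : Function.Surjective T := by
    rintro ⟨F, f, g, hf, hg, hF⟩
    obtain ⟨b, hb⟩ := exists_synthesis_eq_of_analytic hγ hf.1.coeFn_toLp
      (f := hf.1.toLp) hf.2
    obtain ⟨b', hb'⟩ := exists_synthesis_eq_of_antianalytic hγ hg.1.coeFn_toLp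
      (f := hg.1.toLp) hg.2
    refine ⟨(b, b'), Subtype.ext (Lp.ext ?_)⟩
    change (tensorLp γ m (synthesis he b, synthesis he' b') : ℂ → SymTensor m) =ᵐ[_] F
    rw [hb, hb']
    filter_upwards [coeFn_tensorLp (m := m) hf.1.toLp hg.1.toLp, hF, hf.1.coeFn_toLp,
      hg.1.coeFn_toLp] with z h1 h2 h3 h4
    rw [h1, h2, h3, h4]
  exact ⟨ContinuousLinearEquiv.equivOfInverse T T' hleft
    (hleft.rightInverse_of_surjective hsurj), fun b => rfl⟩

/-! ### The weighted X-ray transform of tensor fields -/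

/-- The velocity is constant along a geodesic, so its powers leave the integral and the tensor
transform splits into two scalar ones. -/
theorem isXrayTransform_tensorLp {γ : ℝ} {m : ℕ} {f g : Lp ℂ 2 (diskMeasure γ)}
    {u v : L2Inward γ} (hf : IsLineTransform γ (fun q => geoDir q ^ m) f u)
    (hg : IsLineTransform γ (fun q => (starRingEnd ℂ) (geoDir q ^ m)) g v) :
    IsXrayTransform γ (tensorLp γ m (f, g)) (u + v) := by
  filter_upwards [hf, hg, ae_geoPoint_of_ae_diskMeasure (coeFn_tensorLp (m := m) f g),
    Lp.coeFn_add u v, ae_inwardMeasure_of_ae ae_cos_pos] with q h1 h2 h3 h4 hc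
  have hle : (0 : ℝ) ≤ 2 * Real.cos q.2 := by linarith
  have hae : (fun t => geoDir q ^ m * (f (geoPoint q t) * ((bdf (geoPoint q t) ^ γ : ℝ) : ℂ)) +
      (starRingEnd ℂ) (geoDir q ^ m) *
        (g (geoPoint q t) * ((bdf (geoPoint q t) ^ γ : ℝ) : ℂ)))
      =ᵐ[volume.restrict (Set.Ioc 0 (2 * Real.cos q.2))]
      xrayIntegrand γ (tensorLp γ m (f, g)) q := by
    rw [Measure.restrict_congr_set Ioo_ae_eq_Ioc.symm]
    filter_upwards [h3] with t ht
    have e : ell (tensorLp γ m (f, g)) (geoPoint q t) (geoDir q) =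
        f (geoPoint q t) * geoDir q ^ m +
          g (geoPoint q t) * (starRingEnd ℂ) (geoDir q ^ m) := by
      rw [ell, ht, ← evalTensor_apply, map_add, map_smul, map_smul, dzPow_apply, dzbarPow_apply]
      simp
    rw [xrayIntegrand, e]
    ring
  have hi1 := h1.1.const_mul (geoDir q ^ m)
  have hi2 := h2.1.const_mul ((starRingEnd ℂ) (geoDir q ^ m))
  constructor
  · have hi := hi1.add hi2
    rw [intervalIntegrable_iff_integrableOn_Ioc_of_le hle] at hi ⊢
    exact hi.congr hae
  · rw [h4, Pi.add_apply, h1.2, h2.2, intervalIntegral.integral_of_le hle (f := xrayIntegrand _ _ _),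
      ← integral_congr_ae hae, ← intervalIntegral.integral_of_le hle,
      intervalIntegral.integral_add hi1 hi2, intervalIntegral.integral_const_mul,
      intervalIntegral.integral_const_mul]

/-- The map takes Taylor coefficients by `J.symm` and multiplies them by τ_n and its conjugate. It
is the X-ray transform on each monomial, hence on every tensor by `IsLineTransform.of_hasSum`. -/
theorem exists_equiv_isXrayTransform {γ : ℝ} (hγ : -1 < γ) {m : ℕ} (hm : 1 ≤ m)
    {u v : ℕ → L2Inward γ} (hu : ∀ n, u n =ᵐ[inwardMeasure γ] fanFun γ n (n + m))
    (hv : ∀ n, v n =ᵐ[inwardMeasure γ] fanFun γ n (-(n + m))) :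
    Orthonormal ℂ (Sum.elim u v) ∧
    ∃ Φ : ttTensors γ m ≃L[ℂ] HScale ((1 + γ) / 2) u × HScale ((1 + γ) / 2) v,
      ∀ F : ttTensors γ m,
        IsXrayTransform γ (F : L2Tensor γ m) ((Φ F).1.incl + (Φ F).2.incl) := by
  have horth := orthonormal_sumElim_of_ae_eq_fanFun hγ hm hu hv
  refine ⟨horth, ?_⟩
  have hou : Orthonormal ℂ u := horth.comp Sum.inl Sum.inl_injective
  have hov : Orthonormal ℂ v := horth.comp Sum.inr Sum.inr_injective
  obtain ⟨c, C, hc, hτ⟩ := transformCoeff_bounds hγ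
  obtain ⟨U, hU⟩ := HScale.exists_equiv_lp hou (by linarith) hc hτ
  obtain ⟨V, hV⟩ := HScale.exists_equiv_lp hov (s := (1 + γ) / 2) (by linarith)
    (w := fun n => (starRingEnd ℂ) (transformCoeff γ n)) hc (by simpa using hτ)
  obtain ⟨J, hJ⟩ := exists_equiv_ttTensors hγ hm
  refine ⟨J.symm.trans (U.prodCongr V), fun F => ?_⟩
  obtain ⟨b, rfl⟩ := J.surjective F
  rw [ContinuousLinearEquiv.trans_apply, ContinuousLinearEquiv.symm_apply_apply, hJ]
  have hmon : ∀ n, IsLineTransform γ (fun q => geoDir q ^ m) (monomialLp hγ n)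
      (transformCoeff γ n • u n : L2Inward γ) := fun n =>
    (isLineTransform_normalizedMonomial hγ m n).congr (coeFn_monomialLp hγ n).symm (by
      filter_upwards [Lp.coeFn_smul (transformCoeff γ n) (u n), hu n] with q h1 h2
      rw [h1, Pi.smul_apply, Pi.smul_apply, h2])
  have hmon' : ∀ n, IsLineTransform γ (fun q => (starRingEnd ℂ) (geoDir q ^ m))
      (conjLp γ (monomialLp hγ n))
      ((starRingEnd ℂ) (transformCoeff γ n) • v n : L2Inward γ) := fun n =>
    (hmon n).conj.congr (coeFn_conjLp _).symm (by
      filter_upwards [Lp.coeFn_smul (transformCoeff γ n) (u n), hu n, hv n,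
        Lp.coeFn_smul ((starRingEnd ℂ) (transformCoeff γ n)) (v n)] with q h1 h2 h3 h4
      rw [h1, h4, Pi.smul_apply, Pi.smul_apply, h2, h3, smul_eq_mul, smul_eq_mul, map_mul,
        conj_fanFun])
  refine isXrayTransform_tensorLp ?_ ?_
  · refine IsLineTransform.of_hasSum hγ (fun q => by rw [norm_pow, norm_geoDir, one_pow])
      (fun n => ?_) (hasSum_synthesis (orthonormal_monomialLp hγ) b.1) (hU b.1)
    refine ((hmon n).const_smul (b.1 n)).congr (Lp.coeFn_smul _ _).symm ?_
    rw [mul_smul]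
    exact (Lp.coeFn_smul _ _).symm
  · refine IsLineTransform.of_hasSum hγ
      (fun q => by rw [RCLike.norm_conj, norm_pow, norm_geoDir, one_pow])
      (fun n => ?_) (hasSum_synthesis (orthonormal_conjLp_monomialLp hγ) b.2) (hV b.2)
    refine ((hmon' n).const_smul (b.2 n)).congr (Lp.coeFn_smul _ _).symm ?_
    rw [mul_smul]
    exact (Lp.coeFn_smul _ _).symm

/-! ### Frequencies of the two boundary families, and the conclusion -/

theorem coeFn_psiPlus {γ : ℝ} (hγ : -1 < γ) (n : ℕ) {k j : ℤ} (h : (n : ℤ) - 2 * k = j) :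
    psiPlus hγ n k =ᵐ[inwardMeasure γ] fanFun γ n j := by
  rw [← h]
  exact (memLp_psiFun hγ n k).coeFn_toLp

theorem coeFn_psiMinus {γ : ℝ} (hγ : -1 < γ) (n : ℕ) {k j : ℤ} (h : (n : ℤ) - 2 * k + 1 = j) :
    psiMinus hγ n k =ᵐ[inwardMeasure γ] fanFun γ n j := by
  rw [← h, ← geoDir_mul_psiFun_eq_fanFun]
  exact (memLp_geoDir_mul_psiFun hγ n k).coeFn_toLp

end TTXray

end

theorem lemma2p4 (γ : ℝ) (hγ : -1 < γ) :
    (∀ p : ℕ, 1 ≤ p →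
      Orthonormal ℂ (Sum.elim
        (fun n : ℕ => TTXray.psiPlus hγ n (-(p : ℤ)))
        (fun n : ℕ => TTXray.psiPlus hγ n ((n : ℤ) + p))) ∧
      ∃ Φ : TTXray.ttTensors γ (2 * p) ≃L[ℂ]
          TTXray.HScale ((1 + γ) / 2) (fun n : ℕ => TTXray.psiPlus hγ n (-(p : ℤ))) ×
          TTXray.HScale ((1 + γ) / 2) (fun n : ℕ => TTXray.psiPlus hγ n ((n : ℤ) + p)),
        ∀ F : TTXray.ttTensors γ (2 * p),
          TTXray.IsXrayTransform γ (F : TTXray.L2Tensor γ (2 * p))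
            ((Φ F).1.incl + (Φ F).2.incl)) ∧
    (∀ p : ℕ,
      Orthonormal ℂ (Sum.elim
        (fun n : ℕ => TTXray.psiMinus hγ n (-(p : ℤ)))
        (fun n : ℕ => TTXray.psiMinus hγ n ((n : ℤ) + p + 1))) ∧
      ∃ Φ : TTXray.ttTensors γ (2 * p + 1) ≃L[ℂ]
          TTXray.HScale ((1 + γ) / 2) (fun n : ℕ => TTXray.psiMinus hγ n (-(p : ℤ))) ×
          TTXray.HScale ((1 + γ) / 2) (fun n : ℕ => TTXray.psiMinus hγ n ((n : ℤ) + p + 1)),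
        ∀ F : TTXray.ttTensors γ (2 * p + 1),
          TTXray.IsXrayTransform γ (F : TTXray.L2Tensor γ (2 * p + 1))
            ((Φ F).1.incl + (Φ F).2.incl)) := by
  refine ⟨fun p hp => ?_, fun p => ?_⟩
  -- The indices k = −p and k = n + p give n − 2k = ±(n + 2p).
  · exact TTXray.exists_equiv_isXrayTransform hγ (m := 2 * p) (by omega)
      (fun n => TTXray.coeFn_psiPlus hγ n (by push_cast; ring))
      (fun n => TTXray.coeFn_psiPlus hγ n (by push_cast; ring))
  -- The extra factor e^{iθ} adds 1: k = −p and k = n + p + 1 give n − 2k + 1 = ±(n + 2p + 1).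
  · exact TTXray.exists_equiv_isXrayTransform hγ (m := 2 * p + 1) (by omega)
      (fun n => TTXray.coeFn_psiMinus hγ n (by push_cast; ring))
      (fun n => TTXray.coeFn_psiMinus hγ n (by push_cast; ring))
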